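/- Let $S=\mathbb P^1\times\mathbb P^1$ over $\mathbb C$, and let $\mathrm{Aut}(S)$ be its group of automorphisms as an algebraic variety over $\mathbb C$. Let $\mathbb T\cong(\mathbb C^*)^2$ be the subgroup of $\mathrm{Aut}(S)$ formed by the automorphisms $((1:x),(1:y))\mapsto((1:ax),(1:by))$ with $a,b\in\mathbb C^*$, and let $N(\mathbb T)$ be its normalizer in $\mathrm{Aut}(S)$. A subgroup of $\mathrm{Aut}(S)$ is called toric if it is conjugate in $\mathrm{Aut}(S)$ to a subgroup of $N(\mathbb T)$. For a subgroup $G\subset\mathrm{Aut}(S)$, let $\rho^G(S)$ be the rank of the subgroup $\mathrm{Pic}(S)^G$ of $G$-invariant elements of the Picard group of $S$. Let $G\subset\mathrm{Aut}(S)$ be a finite subgroup such that $\rho^G(S)=1$. Then $G$ is toric if and only if $G$ has no subgroup isomorphic to the alternating group $\mathfrak A_4$. -/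

import Mathlib

open scoped LinearAlgebra.Projectivization MatrixGroups

noncomputable section

namespace P1xP1

/-! ### The variety `S = ℙ¹ × ℙ¹` over `ℂ` -/

/-- The (closed) points of the complex projective line. -/
abbrev P1 : Type := ℙ ℂ (Fin 2 → ℂ)

/-- The (closed) points of the surface `S = ℙ¹ × ℙ¹`. -/
abbrev S : Type := P1 × P1

/-- The Cox ring `ℂ[x₀, x₁, y₀, y₁]` of `ℙ¹ × ℙ¹`; `x` is `Sum.inl`, `y` is `Sum.inr`. -/
abbrev CoxRing : Type := MvPolynomial (Fin 2 ⊕ Fin 2) ℂ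

/-- `F` is bihomogeneous of bidegree `d`. -/
def Bihomogeneous (F : CoxRing) (d : ℕ × ℕ) : Prop :=
  MvPolynomial.IsWeightedHomogeneous
    (Sum.elim (fun _ => ((1, 0) : ℕ × ℕ)) (fun _ => ((0, 1) : ℕ × ℕ))) F d

/-- The value of `F` at the chosen homogeneous coordinates of `p`.  For bihomogeneous `F`, `G` of
the same bidegree, the conditions `evalAt p F = 0` and the quotient `evalAt p F / evalAt p G` do
not depend on the choice of the homogeneous coordinates. -/
def evalAt (p : S) : CoxRing →+* ℂ :=
  MvPolynomial.eval (Sum.elim p.1.rep p.2.rep)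

/-- Zariski open subsets of `S`: complements of common zero loci of families of bihomogeneous
polynomials. -/
def IsZariskiOpen (U : Set S) : Prop :=
  ∃ I : Set CoxRing, (∀ F ∈ I, ∃ d, Bihomogeneous F d) ∧ U = {p | ∃ F ∈ I, evalAt p F ≠ 0}

/-- The restriction of `f` to `U` is a regular function: locally on `U` it is a quotient of two
bihomogeneous polynomials of the same bidegree, with nowhere vanishing denominator. -/
def RegularOn (U : Set S) (f : S → ℂ) : Prop :=
  ∀ p ∈ U, ∃ V : Set S, IsZariskiOpen V ∧ p ∈ V ∧ V ⊆ U ∧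
    ∃ (d : ℕ × ℕ) (F G : CoxRing), Bihomogeneous F d ∧ Bihomogeneous G d ∧
      ∀ q ∈ V, evalAt q G ≠ 0 ∧ f q = evalAt q F / evalAt q G

/-- Morphisms of varieties `S → S`: Zariski continuous maps pulling back regular functions to
regular functions. -/
def IsMorphism (φ : S → S) : Prop :=
  (∀ U, IsZariskiOpen U → IsZariskiOpen (φ ⁻¹' U)) ∧
    ∀ U f, IsZariskiOpen U → RegularOn U f → RegularOn (φ ⁻¹' U) (f ∘ φ)

lemma IsMorphism.id : IsMorphism (fun p => p) :=
  ⟨fun _ h => h, fun _ _ _ h => h⟩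

lemma IsMorphism.comp {φ ψ : S → S} (hφ : IsMorphism φ) (hψ : IsMorphism ψ) :
    IsMorphism (φ ∘ ψ) :=
  ⟨fun U hU => hψ.1 _ (hφ.1 U hU), fun U f hU hf => hψ.2 _ _ (hφ.1 U hU) (hφ.2 U f hU hf)⟩

/-- The group `Aut(S)` of automorphisms of the variety `S`. -/
def Aut : Subgroup (Equiv.Perm S) where
  carrier := {φ | IsMorphism φ ∧ IsMorphism φ.symm}
  one_mem' := ⟨IsMorphism.id, IsMorphism.id⟩
  mul_mem' := fun ha hb => ⟨ha.1.comp hb.1, hb.2.comp ha.2⟩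
  inv_mem' := fun ha => ⟨ha.2, ha.1⟩

/-! ### The Zariski topology and regular functions -/

lemma isZariskiOpen_univ : IsZariskiOpen Set.univ :=
  ⟨{1}, by
    rintro F rfl
    exact ⟨0, MvPolynomial.isWeightedHomogeneous_one _ _⟩, by ext p; simp⟩

lemma IsZariskiOpen.inter {U V : Set S} (hU : IsZariskiOpen U) (hV : IsZariskiOpen V) :
    IsZariskiOpen (U ∩ V) := by
  obtain ⟨I, hI, rfl⟩ := hU
  obtain ⟨J, hJ, rfl⟩ := hV
  refine ⟨{H | ∃ F ∈ I, ∃ G ∈ J, H = F * G}, ?_, ?_⟩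
  · rintro _ ⟨F, hF, G, hG, rfl⟩
    obtain ⟨d, hd⟩ := hI F hF
    obtain ⟨e, he⟩ := hJ G hG
    exact ⟨d + e, MvPolynomial.IsWeightedHomogeneous.mul hd he⟩
  · ext p
    constructor
    · rintro ⟨⟨F, hF, hF0⟩, G, hG, hG0⟩
      exact ⟨F * G, ⟨F, hF, G, hG, rfl⟩, by rw [map_mul]; exact mul_ne_zero hF0 hG0⟩
    · rintro ⟨_, ⟨F, hF, G, hG, rfl⟩, h⟩
      rw [map_mul] at h
      exact ⟨⟨F, hF, left_ne_zero_of_mul h⟩, G, hG, right_ne_zero_of_mul h⟩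

lemma RegularOn.mono {U V : Set S} {f : S → ℂ} (hf : RegularOn U f) (hV : IsZariskiOpen V)
    (h : V ⊆ U) : RegularOn V f := by
  intro p hp
  obtain ⟨W, hW, hpW, -, d, F, G, hF, hG, hq⟩ := hf p (h hp)
  exact ⟨W ∩ V, hW.inter hV, ⟨hpW, hp⟩, Set.inter_subset_right, d, F, G, hF, hG,
    fun q hqW => hq q hqW.1⟩

lemma regularOn_one {U : Set S} (hU : IsZariskiOpen U) : RegularOn U 1 := fun p hp =>
  ⟨U, hU, hp, subset_rfl, 0, 1, 1, MvPolynomial.isWeightedHomogeneous_one _ _,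
    MvPolynomial.isWeightedHomogeneous_one _ _, by simp⟩

lemma RegularOn.mul {U : Set S} {f g : S → ℂ} (hf : RegularOn U f) (hg : RegularOn U g) :
    RegularOn U (f * g) := by
  intro p hp
  obtain ⟨V, hV, hpV, hVU, d, F, G, hF, hG, hq⟩ := hf p hp
  obtain ⟨V', hV', hpV', -, d', F', G', hF', hG', hq'⟩ := hg p hp
  refine ⟨V ∩ V', hV.inter hV', ⟨hpV, hpV'⟩, fun x hx => hVU hx.1, d + d', F * F', G * G',
    MvPolynomial.IsWeightedHomogeneous.mul hF hF', MvPolynomial.IsWeightedHomogeneous.mul hG hG',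
    fun q h => ?_⟩
  obtain ⟨h1, h2⟩ := hq q h.1
  obtain ⟨h3, h4⟩ := hq' q h.2
  refine ⟨by rw [map_mul]; exact mul_ne_zero h1 h3, ?_⟩
  rw [Pi.mul_apply, h2, h4, map_mul, map_mul, div_mul_div_comm]

lemma RegularOn.inv {U : Set S} {f : S → ℂ} (hf : RegularOn U f) (h0 : ∀ p ∈ U, f p ≠ 0) :
    RegularOn U f⁻¹ := by
  intro p hp
  obtain ⟨V, hV, hpV, hVU, d, F, G, hF, hG, hq⟩ := hf p hp
  refine ⟨V, hV, hpV, hVU, d, G, F, hG, hF, fun q h => ?_⟩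
  obtain ⟨h1, h2⟩ := hq q h
  have h3 := h0 q (hVU h)
  refine ⟨fun h4 => h3 (by rw [h2, h4, zero_div]), ?_⟩
  rw [Pi.inv_apply, h2, inv_div]

/-- The restriction of `f` to `U` is an invertible regular function, i.e. an element of
`𝒪(U)ˣ`. -/
def UnitOn (U : Set S) (f : S → ℂ) : Prop :=
  RegularOn U f ∧ ∀ p ∈ U, f p ≠ 0

lemma UnitOn.mono {U V : Set S} {f : S → ℂ} (hf : UnitOn U f) (hV : IsZariskiOpen V)
    (h : V ⊆ U) : UnitOn V f :=
  ⟨hf.1.mono hV h, fun p hp => hf.2 p (h hp)⟩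

lemma unitOn_one {U : Set S} (hU : IsZariskiOpen U) : UnitOn U 1 :=
  ⟨regularOn_one hU, fun _ _ => one_ne_zero⟩

lemma UnitOn.mul {U : Set S} {f g : S → ℂ} (hf : UnitOn U f) (hg : UnitOn U g) :
    UnitOn U (f * g) :=
  ⟨hf.1.mul hg.1, fun p hp => mul_ne_zero (hf.2 p hp) (hg.2 p hp)⟩

lemma UnitOn.inv {U : Set S} {f : S → ℂ} (hf : UnitOn U f) : UnitOn U f⁻¹ :=
  ⟨hf.1.inv hf.2, fun p hp => inv_ne_zero (hf.2 p hp)⟩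

lemma UnitOn.comp {U : Set S} {f : S → ℂ} (hf : UnitOn U f) (hU : IsZariskiOpen U)
    {φ : S → S} (hφ : IsMorphism φ) : UnitOn (φ ⁻¹' U) (f ∘ φ) :=
  ⟨hφ.2 U f hU hf.1, fun p hp => hf.2 (φ p) hp⟩

/-! ### The Picard group of `S` -/

/-- A line bundle on `S`, given by transition functions: an open cover, which is taken to be indexed
by the points of `S` with `p ∈ U p`, and a Čech 1-cocycle of invertible regular functions. -/
structure LineBundle where
  U : S → Set S
  isOpen : ∀ p, IsZariskiOpen (U p)
  mem : ∀ p, p ∈ U p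
  g : S → S → S → ℂ
  unit : ∀ p q, UnitOn (U p ∩ U q) (g p q)
  cocycle : ∀ p q r, ∀ x ∈ U p ∩ U q ∩ U r, g p q x * g q r x = g p r x

namespace LineBundle

/-- Isomorphism of line bundles: on a common refinement of the two covers, the cocycles differ by
the coboundary of a family of invertible regular functions. -/
def Iso (L M : LineBundle) : Prop :=
  ∃ (W : S → Set S) (h : S → S → ℂ),
    (∀ p, IsZariskiOpen (W p)) ∧ (∀ p, p ∈ W p) ∧ (∀ p, W p ⊆ L.U p ∩ M.U p) ∧
    (∀ p, UnitOn (W p) (h p)) ∧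
    ∀ p q, ∀ x ∈ W p ∩ W q, M.g p q x * h q x = h p x * L.g p q x

lemma iso_of_eqOn (L M : LineBundle)
    (h : ∀ p q, ∀ x ∈ (L.U p ∩ M.U p) ∩ (L.U q ∩ M.U q), M.g p q x = L.g p q x) : Iso L M :=
  ⟨fun p => L.U p ∩ M.U p, fun _ => 1, fun p => (L.isOpen p).inter (M.isOpen p),
    fun p => ⟨L.mem p, M.mem p⟩, fun _ => subset_rfl,
    fun p => unitOn_one ((L.isOpen p).inter (M.isOpen p)), fun p q x hx => by
      simp [h p q x hx]⟩

lemma Iso.refl (L : LineBundle) : Iso L L := iso_of_eqOn L L fun _ _ _ _ => rfl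

lemma Iso.symm {L M : LineBundle} : Iso L M → Iso M L := by
  rintro ⟨W, h, hW, hm, hs, hu, hc⟩
  refine ⟨W, fun p => (h p)⁻¹, hW, hm, fun p => fun x hx => (hs p hx).symm,
    fun p => (hu p).inv, fun p q x hx => ?_⟩
  have h1 := (hu p).2 x hx.1
  have h2 := (hu q).2 x hx.2
  have h3 := hc p q x hx
  simp only [Pi.inv_apply]
  field_simp
  linear_combination -h3

lemma Iso.trans {L M N : LineBundle} : Iso L M → Iso M N → Iso L N := by
  rintro ⟨W, h, hW, hm, hs, hu, hc⟩ ⟨W', h', hW', hm', hs', hu', hc'⟩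
  refine ⟨fun p => W p ∩ W' p, fun p => h' p * h p, fun p => (hW p).inter (hW' p),
    fun p => ⟨hm p, hm' p⟩, fun p x hx => ⟨(hs p hx.1).1, (hs' p hx.2).2⟩,
    fun p => ((hu' p).mono ((hW p).inter (hW' p)) Set.inter_subset_right).mul
      ((hu p).mono ((hW p).inter (hW' p)) Set.inter_subset_left), fun p q x hx => ?_⟩
  have h1 := hc p q x ⟨hx.1.1, hx.2.1⟩
  have h2 := hc' p q x ⟨hx.1.2, hx.2.2⟩
  simp only [Pi.mul_apply]
  linear_combination h q x * h2 + h' p x * h1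

instance setoid : Setoid LineBundle where
  r := Iso
  iseqv := ⟨Iso.refl, Iso.symm, Iso.trans⟩

/-- The trivial line bundle. -/
def trivial : LineBundle where
  U _ := Set.univ
  isOpen _ := isZariskiOpen_univ
  mem _ := Set.mem_univ _
  g _ _ := 1
  unit _ _ := unitOn_one (isZariskiOpen_univ.inter isZariskiOpen_univ)
  cocycle _ _ _ _ _ := by simp

/-- The tensor product of line bundles. -/
def tensor (L M : LineBundle) : LineBundle where
  U p := L.U p ∩ M.U p
  isOpen p := (L.isOpen p).inter (M.isOpen p)
  mem p := ⟨L.mem p, M.mem p⟩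
  g p q := L.g p q * M.g p q
  unit p q :=
    have ho := ((L.isOpen p).inter (M.isOpen p)).inter ((L.isOpen q).inter (M.isOpen q))
    ((L.unit p q).mono ho fun _ hx => ⟨hx.1.1, hx.2.1⟩).mul
      ((M.unit p q).mono ho fun _ hx => ⟨hx.1.2, hx.2.2⟩)
  cocycle p q r x hx := by
    have h1 := L.cocycle p q r x ⟨⟨hx.1.1.1, hx.1.2.1⟩, hx.2.1⟩
    have h2 := M.cocycle p q r x ⟨⟨hx.1.1.2, hx.1.2.2⟩, hx.2.2⟩
    simp only [Pi.mul_apply, ← h1, ← h2]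
    ring

/-- The dual line bundle. -/
def dual (L : LineBundle) : LineBundle where
  U := L.U
  isOpen := L.isOpen
  mem := L.mem
  g p q := (L.g p q)⁻¹
  unit p q := (L.unit p q).inv
  cocycle p q r x hx := by
    simp only [Pi.inv_apply, ← L.cocycle p q r x hx, mul_inv]

/-- The pull-back of a line bundle by a morphism. -/
def pullback (L : LineBundle) {φ : S → S} (hφ : IsMorphism φ) : LineBundle where
  U p := φ ⁻¹' L.U (φ p)
  isOpen _ := hφ.1 _ (L.isOpen _)
  mem p := L.mem (φ p)
  g p q := L.g (φ p) (φ q) ∘ φ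
  unit p q := (L.unit (φ p) (φ q)).comp ((L.isOpen _).inter (L.isOpen _)) hφ
  cocycle p q r x hx := L.cocycle (φ p) (φ q) (φ r) (φ x) hx

lemma Iso.tensor {L L' M M' : LineBundle} :
    Iso L L' → Iso M M' → Iso (L.tensor M) (L'.tensor M') := by
  rintro ⟨W, h, hW, hm, hs, hu, hc⟩ ⟨W', h', hW', hm', hs', hu', hc'⟩
  refine ⟨fun p => W p ∩ W' p, fun p => h p * h' p, fun p => (hW p).inter (hW' p),
    fun p => ⟨hm p, hm' p⟩,
    fun p x hx => ⟨⟨(hs p hx.1).1, (hs' p hx.2).1⟩, (hs p hx.1).2, (hs' p hx.2).2⟩,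
    fun p => ((hu p).mono ((hW p).inter (hW' p)) Set.inter_subset_left).mul
      ((hu' p).mono ((hW p).inter (hW' p)) Set.inter_subset_right), fun p q x hx => ?_⟩
  have h1 := hc p q x ⟨hx.1.1, hx.2.1⟩
  have h2 := hc' p q x ⟨hx.1.2, hx.2.2⟩
  simp only [LineBundle.tensor, Pi.mul_apply]
  linear_combination (M'.g p q x * h' q x) * h1 + (h p x * L.g p q x) * h2

lemma Iso.dual {L M : LineBundle} : Iso L M → Iso L.dual M.dual := by
  rintro ⟨W, h, hW, hm, hs, hu, hc⟩
  refine ⟨W, fun p => (h p)⁻¹, hW, hm, hs, fun p => (hu p).inv, fun p q x hx => ?_⟩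
  have h1 := hc p q x hx
  simp only [LineBundle.dual, Pi.inv_apply]
  rw [← mul_inv, ← mul_inv, h1]

lemma Iso.pullback {L M : LineBundle} {φ : S → S} (hφ : IsMorphism φ) :
    Iso L M → Iso (L.pullback hφ) (M.pullback hφ) := by
  rintro ⟨W, h, hW, hm, hs, hu, hc⟩
  exact ⟨fun p => φ ⁻¹' W (φ p), fun p => h (φ p) ∘ φ, fun p => hφ.1 _ (hW _), fun p => hm _,
    fun p x hx => hs (φ p) hx, fun p => (hu (φ p)).comp (hW _) hφ,
    fun p q x hx => hc (φ p) (φ q) (φ x) hx⟩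

end LineBundle

/-- The Picard group `Pic(S)`: isomorphism classes of line bundles under tensor product. -/
def Pic : Type := Quotient LineBundle.setoid

instance : CommGroup Pic where
  mul := Quotient.map₂ LineBundle.tensor fun _ _ h _ _ h' => LineBundle.Iso.tensor h h'
  one := Quotient.mk _ LineBundle.trivial
  inv := Quotient.map LineBundle.dual fun _ _ h => LineBundle.Iso.dual h
  mul_assoc := by
    rintro ⟨L⟩ ⟨M⟩ ⟨N⟩
    exact Quotient.sound (LineBundle.iso_of_eqOn _ _ fun p q x _ =>
      (mul_assoc (L.g p q x) (M.g p q x) (N.g p q x)).symm)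
  one_mul := by
    rintro ⟨L⟩
    exact Quotient.sound (LineBundle.iso_of_eqOn _ _ fun p q x _ => (one_mul (L.g p q x)).symm)
  mul_one := by
    rintro ⟨L⟩
    exact Quotient.sound (LineBundle.iso_of_eqOn _ _ fun p q x _ => (mul_one (L.g p q x)).symm)
  inv_mul_cancel := by
    rintro ⟨L⟩
    exact Quotient.sound (LineBundle.iso_of_eqOn _ _ fun p q x hx =>
      (inv_mul_cancel₀ ((L.unit p q).2 x ⟨hx.1.1.1, hx.2.1.1⟩)).symm)
  mul_comm := by
    rintro ⟨L⟩ ⟨M⟩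
    exact Quotient.sound (LineBundle.iso_of_eqOn _ _ fun p q x _ =>
      mul_comm (M.g p q x) (L.g p q x))

/-- Pull-back of line bundle classes along an automorphism of `S`. -/
def Pic.pullback (φ : Aut) : Pic →* Pic where
  toFun := Quotient.map (fun L => L.pullback φ.2.1) fun _ _ h => LineBundle.Iso.pullback φ.2.1 h
  map_one' := Quotient.sound (LineBundle.iso_of_eqOn _ _ fun _ _ _ _ => rfl)
  map_mul' := by
    rintro ⟨L⟩ ⟨M⟩
    exact Quotient.sound (LineBundle.iso_of_eqOn _ _ fun _ _ _ _ => rfl)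

/-- The `G`-invariant part `Pic(S)^G` of the Picard group. -/
def invariantPic (G : Subgroup Aut) : Subgroup Pic where
  carrier := {L | ∀ φ ∈ G, Pic.pullback φ L = L}
  one_mem' := fun φ _ => map_one (Pic.pullback φ)
  mul_mem' := fun ha hb φ hφ => by rw [map_mul, ha φ hφ, hb φ hφ]
  inv_mem' := fun ha φ hφ => by rw [map_inv, ha φ hφ]

/-- The invariant Picard number `ρ^G(S)`: the rank of `Pic(S)^G`. -/
def rho (G : Subgroup Aut) : Cardinal :=
  Module.rank ℤ (Additive (invariantPic G))

/-! ### The torus and toric subgroups -/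

/-- The projective transformation `(1 : x) ↦ (1 : a x)` of `ℙ¹`, as an invertible matrix. -/
def scale (a : ℂˣ) : GL (Fin 2) ℂ :=
  Matrix.GeneralLinearGroup.mkOfDetNeZero !![1, 0; 0, (a : ℂ)] (by simp [Matrix.det_fin_two])

lemma scale_one : scale 1 = 1 := by
  ext i j
  fin_cases i <;> fin_cases j <;> simp [scale, Matrix.GeneralLinearGroup.mkOfDetNeZero]

lemma scale_mul (a b : ℂˣ) : scale (a * b) = scale a * scale b := by
  ext i j
  fin_cases i <;> fin_cases j <;>
    simp [scale, Matrix.GeneralLinearGroup.mkOfDetNeZero, Matrix.mul_apply]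

/-- The torus `𝕋 ≅ (ℂˣ)²` in `Aut(S)`: the automorphisms
`((1 : x), (1 : y)) ↦ ((1 : a x), (1 : b y))` with `a, b ∈ ℂˣ`. -/
def torus : Subgroup Aut where
  carrier := {φ | ∃ a b : ℂˣ, ∀ p : S, φ.1 p = (scale a • p.1, scale b • p.2)}
  one_mem' := ⟨1, 1, fun p => by simp [scale_one]⟩
  mul_mem' := by
    rintro φ ψ ⟨a, b, h⟩ ⟨c, d, h'⟩
    refine ⟨a * c, b * d, fun p => ?_⟩
    rw [Subgroup.coe_mul, Equiv.Perm.mul_apply, h', h, scale_mul, scale_mul, mul_smul, mul_smul]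
  inv_mem' := by
    rintro φ ⟨a, b, h⟩
    refine ⟨a⁻¹, b⁻¹, fun p => ?_⟩
    rw [Subgroup.coe_inv, Equiv.Perm.inv_eq_iff_eq, h, ← mul_smul, ← mul_smul, ← scale_mul,
      ← scale_mul]
    simp [scale_one]

/-- A subgroup of `Aut(S)` is toric if it is conjugate in `Aut(S)` to a subgroup of the normalizer
`N(𝕋)` of the torus. -/
def IsToric (G : Subgroup Aut) : Prop :=
  ∃ c : Aut, G.map (MulAut.conj c).toMonoidHom ≤ Subgroup.normalizer (torus : Set Aut)

end P1xP1

end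

namespace P1xP1

/-! ### Divisors of homogeneous polynomials -/

section Homogeneous

/-! A morphism from S to the projective line is globally a pair of bihomogeneous forms of one
bidegree without common zeros, and this bidegree is unique because a nowhere vanishing section
exists only in bidegree (0,0). Bidegrees of an automorphism form a 2 by 2 matrix over ℕ,
multiplicative under composition, so it is a permutation matrix: every automorphism is a pair of
projective transformations, up to exchanging the factors (`Aut.exists_PGL`). If no element of G
exchanged the factors, 𝒪(1,0) and 𝒪(0,1) would be independent invariant classes and the rank would
be at least 2; hence some σ in G exchanges them (`exists_swap_of_rho_eq_one`).

Toric implies no 𝔄₄: an element of the normalizer with trivial cube can neither exchange the factors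
nor exchange 0 and ∞ on a factor, so it lies in the torus (`mem_torus_of_cube_eq_one`). The torus is
commutative, but 𝔄₄ contains 3-cycles that do not commute.

Conversely, let H be the subgroup of G preserving the factors. The element σ makes its two
projections to PGL₂ conjugate. If one of them preserves a pair of points, so does the other, and
moving the pairs to {∞, 0} conjugates G into the normalizer (`isToric_of_invariant_pair`). Otherwise
both projections are polyhedral: Klein's orbit count gives order 12, 24 or 60, and Sylow theory
produces a tetrahedral pair, that is, generators t, v of a copy of 𝔄₄ in which t permutes the
involutions v, w, vw cyclically (`MoebiusAction.exists_tetrahedralPair`).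

It remains to lift such a pair to H, by an argument in the style of Goursat
(`MoebiusAction.exists_tetrahedralPair_prod`). Each kernel of a projection is normal in the opposite
projection, hence is trivial, a Klein four-group, or without an invariant pair. In the last case it
contains a tetrahedral pair itself; if a kernel is trivial, H embeds in one factor; if both are
Klein, an element of order 3 of H acts on both at once. -/

open Polynomial in
/-- The ring homomorphism `Xᵢ ↦ Xᵢ T ^ wᵢ`, which detects weighted homogeneity. -/
noncomputable def gradingHom {σ : Type*} (w : σ → ℕ) :
    MvPolynomial σ ℂ →+* (MvPolynomial σ ℂ)[X] :=
  MvPolynomial.eval₂Hom (Polynomial.C.comp MvPolynomial.C)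
    fun i => Polynomial.C (MvPolynomial.X i) * Polynomial.X ^ w i

variable {σ : Type*} (w : σ → ℕ)

lemma gradingHom_monomial (m : σ →₀ ℕ) (c : ℂ) :
    gradingHom w (MvPolynomial.monomial m c) =
      Polynomial.monomial (Finsupp.weight w m) (MvPolynomial.monomial m c) := by
  rw [gradingHom, MvPolynomial.coe_eval₂Hom, MvPolynomial.eval₂_monomial,
    ← Polynomial.C_mul_X_pow_eq_monomial, MvPolynomial.monomial_eq]
  simp only [Finsupp.prod, mul_pow, Finset.prod_mul_distrib, RingHom.comp_apply, map_mul, map_prod,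
    map_pow, mul_assoc]
  congr 2
  simp only [← pow_mul, Finset.prod_pow_eq_pow_sum, Finsupp.weight_apply, Finsupp.sum, smul_eq_mul]
  congr 1
  exact Finset.sum_congr rfl fun i _ => mul_comm _ _

lemma eval_one_gradingHom (F : MvPolynomial σ ℂ) : (gradingHom w F).eval 1 = F := by
  induction F using MvPolynomial.induction_on' with
  | monomial m c => rw [gradingHom_monomial]; simp
  | add p q hp hq => rw [map_add, Polynomial.eval_add, hp, hq]

lemma coeff_coeff_gradingHom (F : MvPolynomial σ ℂ) (n : ℕ) (m : σ →₀ ℕ) :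
    ((gradingHom w F).coeff n).coeff m = if Finsupp.weight w m = n then F.coeff m else 0 := by
  classical
  induction F using MvPolynomial.induction_on' with
  | monomial m' c =>
    rw [gradingHom_monomial, Polynomial.coeff_monomial]
    by_cases h : m' = m
    · subst h; split_ifs <;> simp
    · split_ifs <;> simp [MvPolynomial.coeff_monomial, h]
  | add p q hp hq =>
    rw [map_add, Polynomial.coeff_add, MvPolynomial.coeff_add, hp, hq, MvPolynomial.coeff_add]
    split_ifs <;> simp

lemma isWeightedHomogeneous_iff_gradingHom (F : MvPolynomial σ ℂ) (n : ℕ) :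
    MvPolynomial.IsWeightedHomogeneous w F n ↔ gradingHom w F = Polynomial.monomial n F := by
  constructor
  · intro h
    ext k m
    rw [coeff_coeff_gradingHom, Polynomial.coeff_monomial]
    by_cases hm : F.coeff m = 0
    · split_ifs <;> simp [hm]
    · rw [h hm]; split_ifs <;> simp
  · intro h m hm
    by_contra hne
    have := coeff_coeff_gradingHom w F n m
    rw [h, Polynomial.coeff_monomial, if_pos rfl, if_neg hne] at this
    exact hm this

/-- Over a domain both the degree and the trailing degree are additive. They agree for the product,
so they agree for each factor. -/
lemma eq_monomial_of_mul_eq_monomial {R : Type*} [CommRing R] [IsDomain R] {p q : Polynomial R}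
    {n : ℕ} {c : R} (hc : c ≠ 0) (h : p * q = Polynomial.monomial n c) :
    ∃ k a, p = Polynomial.monomial k a := by
  have h0 : p * q ≠ 0 := by rw [h]; simpa using hc
  have hp := left_ne_zero_of_mul h0
  have hq := right_ne_zero_of_mul h0
  have h1 := Polynomial.natDegree_mul hp hq
  have h2 := Polynomial.natTrailingDegree_mul hp hq
  rw [h, Polynomial.natDegree_monomial_eq n hc] at h1
  rw [h, Polynomial.natTrailingDegree_monomial hc] at h2
  have h3 := p.natTrailingDegree_le_natDegree
  have h4 := q.natTrailingDegree_le_natDegree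
  refine ⟨p.natDegree, p.leadingCoeff, ?_⟩
  ext k
  rw [Polynomial.coeff_monomial]
  split_ifs with hk
  · rw [← hk]; rfl
  · rcases lt_or_gt_of_ne hk with hk | hk
    · exact Polynomial.coeff_eq_zero_of_natDegree_lt hk
    · exact Polynomial.coeff_eq_zero_of_lt_natTrailingDegree (by omega)

lemma exists_isWeightedHomogeneous_of_mul {F G : MvPolynomial σ ℂ} {n : ℕ} (h0 : F * G ≠ 0)
    (h : MvPolynomial.IsWeightedHomogeneous w (F * G) n) :
    ∃ k, MvPolynomial.IsWeightedHomogeneous w F k := by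
  rw [isWeightedHomogeneous_iff_gradingHom, map_mul] at h
  obtain ⟨k, a, hk⟩ := eq_monomial_of_mul_eq_monomial h0 h
  refine ⟨k, (isWeightedHomogeneous_iff_gradingHom w F k).2 ?_⟩
  -- Setting T = 1 identifies the coefficient `a` with F.
  have := eval_one_gradingHom w F
  rw [hk] at this ⊢
  simp at this
  rw [this]

end Homogeneous

/-- The argument on divisors uses degrees of polynomials in one variable T, so the grading by pairs
is split into two gradings by ℕ. -/
lemma bihomogeneous_iff (F : CoxRing) (d : ℕ × ℕ) : Bihomogeneous F d ↔
    MvPolynomial.IsWeightedHomogeneous (Sum.elim (fun _ => 1) fun _ => 0 : Fin 2 ⊕ Fin 2 → ℕ) F d.1 ∧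
    MvPolynomial.IsWeightedHomogeneous (Sum.elim (fun _ => 0) fun _ => 1 : Fin 2 ⊕ Fin 2 → ℕ) F d.2 := by
  have key : ∀ m : Fin 2 ⊕ Fin 2 →₀ ℕ,
      Finsupp.weight (Sum.elim (fun _ => ((1, 0) : ℕ × ℕ)) (fun _ => ((0, 1) : ℕ × ℕ))) m =
      (Finsupp.weight (Sum.elim (fun _ => 1) fun _ => 0 : Fin 2 ⊕ Fin 2 → ℕ) m,
        Finsupp.weight (Sum.elim (fun _ => 0) fun _ => 1 : Fin 2 ⊕ Fin 2 → ℕ) m) := by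
    intro m
    simp [Finsupp.weight_apply, Finsupp.sum_fintype, Prod.ext_iff]
  constructor
  · intro h
    exact ⟨fun m hm => by simpa [key] using congrArg Prod.fst (h hm),
      fun m hm => by simpa [key] using congrArg Prod.snd (h hm)⟩
  · intro h m hm
    rw [key, h.1 hm, h.2 hm]

lemma Bihomogeneous.of_mul {F G : CoxRing} {d : ℕ × ℕ} (h0 : F * G ≠ 0)
    (h : Bihomogeneous (F * G) d) : ∃ e, Bihomogeneous F e := by
  rw [bihomogeneous_iff] at h
  obtain ⟨k, hk⟩ := exists_isWeightedHomogeneous_of_mul _ h0 h.1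
  obtain ⟨l, hl⟩ := exists_isWeightedHomogeneous_of_mul _ h0 h.2
  exact ⟨(k, l), (bihomogeneous_iff _ _).2 ⟨hk, hl⟩⟩

lemma Bihomogeneous.mul {F G : CoxRing} {d e : ℕ × ℕ} (hF : Bihomogeneous F d)
    (hG : Bihomogeneous G e) : Bihomogeneous (F * G) (d + e) :=
  MvPolynomial.IsWeightedHomogeneous.mul hF hG

/-! ### Evaluation of bihomogeneous polynomials -/

/-- The value of `F` at a pair of vectors. -/
noncomputable def ev (v w : Fin 2 → ℂ) : CoxRing →+* ℂ := MvPolynomial.eval (Sum.elim v w)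

lemma ev_inl (v w : Fin 2 → ℂ) (i : Fin 2) : ev v w (MvPolynomial.X (Sum.inl i)) = v i := by
  simp [ev]

lemma ev_inr (v w : Fin 2 → ℂ) (i : Fin 2) : ev v w (MvPolynomial.X (Sum.inr i)) = w i := by
  simp [ev]

lemma Bihomogeneous.ev_smul {F : CoxRing} {d : ℕ × ℕ} (hF : Bihomogeneous F d) (a b : ℂ)
    (v w : Fin 2 → ℂ) : ev (a • v) (b • w) F = a ^ d.1 * b ^ d.2 * ev v w F := by
  rw [bihomogeneous_iff] at hF
  rw [ev, ev, MvPolynomial.eval_eq', MvPolynomial.eval_eq', Finset.mul_sum]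
  refine Finset.sum_congr rfl fun m hm => ?_
  have hm' := MvPolynomial.mem_support_iff.1 hm
  have h1 := hF.1 hm'
  have h2 := hF.2 hm'
  simp [Finsupp.weight_apply, Finsupp.sum_fintype] at h1 h2
  simp only [Fintype.prod_sum_type, Sum.elim_inl, Sum.elim_inr, Pi.smul_apply, smul_eq_mul,
    Fin.prod_univ_two, mul_pow, ← h1, ← h2, pow_add]
  ring

lemma evalAt_eq_ev (p : S) (F : CoxRing) : evalAt p F = ev p.1.rep p.2.rep F := rfl

lemma exists_rep_mk {v : Fin 2 → ℂ} (hv : v ≠ 0) :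
    ∃ a : ℂ, a ≠ 0 ∧ (Projectivization.mk ℂ v hv).rep = a • v := by
  obtain ⟨a, ha⟩ := Projectivization.exists_smul_eq_mk_rep ℂ v hv
  exact ⟨a, a.ne_zero, ha.symm⟩

lemma Bihomogeneous.evalAt_mk {F : CoxRing} {d : ℕ × ℕ} (hF : Bihomogeneous F d)
    {v w : Fin 2 → ℂ} (hv : v ≠ 0) (hw : w ≠ 0) :
    evalAt (Projectivization.mk ℂ v hv, Projectivization.mk ℂ w hw) F = 0 ↔ ev v w F = 0 := by
  obtain ⟨a, ha, hav⟩ := exists_rep_mk hv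
  obtain ⟨b, hb, hbw⟩ := exists_rep_mk hw
  rw [evalAt_eq_ev, hav, hbw, hF.ev_smul]
  simp [ha, hb]

/-- Quotients of bihomogeneous polynomials of the same bidegree are functions on `S`. -/
lemma Bihomogeneous.evalAt_div_mk {F G : CoxRing} {d : ℕ × ℕ} (hF : Bihomogeneous F d)
    (hG : Bihomogeneous G d) {v w : Fin 2 → ℂ} (hv : v ≠ 0) (hw : w ≠ 0) :
    evalAt (Projectivization.mk ℂ v hv, Projectivization.mk ℂ w hw) F /
      evalAt (Projectivization.mk ℂ v hv, Projectivization.mk ℂ w hw) G =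
    ev v w F / ev v w G := by
  obtain ⟨a, ha, hav⟩ := exists_rep_mk hv
  obtain ⟨b, hb, hbw⟩ := exists_rep_mk hw
  rw [evalAt_eq_ev, evalAt_eq_ev, hav, hbw, hF.ev_smul, hG.ev_smul, mul_div_mul_left]
  simp [ha, hb]

lemma eq_zero_of_ev_eq_zero {F : CoxRing}
    (h : ∀ v w : Fin 2 → ℂ, v ≠ 0 → w ≠ 0 → ev v w F = 0) : F = 0 := by
  -- The extra factor vanishes when v = 0 or w = 0, the cases on which the hypothesis is silent.
  have h1 : F * (MvPolynomial.X (Sum.inl 0) * MvPolynomial.X (Sum.inr 0)) = 0 := by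
    apply MvPolynomial.funext
    intro x
    obtain ⟨v, w, rfl⟩ : ∃ v w, x = Sum.elim v w :=
      ⟨x ∘ Sum.inl, x ∘ Sum.inr, (Sum.elim_comp_inl_inr x).symm⟩
    rw [map_mul, map_mul, map_zero]
    by_cases hv : v = 0
    · simp [hv]
    by_cases hw : w = 0
    · simp [hw]
    have := h v w hv hw
    rw [ev] at this
    rw [this, zero_mul]
  simpa [MvPolynomial.X_ne_zero] using h1

lemma Bihomogeneous.eq_zero {F : CoxRing} {d : ℕ × ℕ} (hF : Bihomogeneous F d)
    (h : ∀ p, evalAt p F = 0) : F = 0 :=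
  eq_zero_of_ev_eq_zero fun v w hv hw => (hF.evalAt_mk hv hw).1 (h _)

/-- A nonempty open set contains the nonvanishing locus of a nonzero bihomogeneous polynomial
around each of its points. -/
lemma IsZariskiOpen.exists_bihomogeneous {U : Set S} (hU : IsZariskiOpen U) {p : S} (hp : p ∈ U) :
    ∃ (A : CoxRing) (d : ℕ × ℕ), Bihomogeneous A d ∧ evalAt p A ≠ 0 ∧
      ∀ q, evalAt q A ≠ 0 → q ∈ U := by
  obtain ⟨I, hI, rfl⟩ := hU
  obtain ⟨F, hF, h0⟩ := hp
  obtain ⟨d, hd⟩ := hI F hF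
  exact ⟨F, d, hd, h0, fun q hq => ⟨F, hF, hq⟩⟩

/-- The identity theorem on a dense open subset of `S`. -/
lemma Bihomogeneous.eq_of_eqOn {F G : CoxRing} {d : ℕ × ℕ} (hF : Bihomogeneous F d)
    (hG : Bihomogeneous G d) {U V : Set S} (hU : IsZariskiOpen U) (hV : IsZariskiOpen V)
    (hU' : U.Nonempty) (hV' : V.Nonempty)
    (h : ∀ q ∈ U, q ∈ V → evalAt q F = evalAt q G) : F = G := by
  obtain ⟨p, hp⟩ := hU'
  obtain ⟨p', hp'⟩ := hV'
  obtain ⟨A, a, hA, hA0, hAU⟩ := hU.exists_bihomogeneous hp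
  obtain ⟨B, b, hB, hB0, hBV⟩ := hV.exists_bihomogeneous hp'
  have hFG : Bihomogeneous (F - G) d := MvPolynomial.IsWeightedHomogeneous.sub hF hG
  -- Off U or off V one of A, B vanishes, so this product vanishes at every point of S.
  have h1 : (F - G) * (A * B) = 0 := by
    refine (hFG.mul (hA.mul hB)).eq_zero fun q => ?_
    rw [map_mul, map_mul]
    by_cases hqA : evalAt q A = 0
    · simp [hqA]
    by_cases hqB : evalAt q B = 0
    · simp [hqB]
    rw [map_sub, h q (hAU q hqA) (hBV q hqB), sub_self, zero_mul]
  have hA' : A ≠ 0 := by rintro rfl; simp at hA0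
  have hB' : B ≠ 0 := by rintro rfl; simp at hB0
  rcases mul_eq_zero.1 h1 with h1 | h1
  · exact sub_eq_zero.1 h1
  · exact absurd h1 (mul_ne_zero hA' hB')

end P1xP1


namespace P1xP1

/-! ### Maps to the projective line are given by pairs of bihomogeneous polynomials -/

/-- Cancelling a common factor preserves bihomogeneity because divisors of nonzero bihomogeneous
polynomials are bihomogeneous. -/
lemma Bihomogeneous.exists_reduced {F G : CoxRing} {d : ℕ × ℕ} (hF : Bihomogeneous F d)
    (hG : Bihomogeneous G d) (hG0 : G ≠ 0) :
    ∃ (c F' G' : CoxRing) (e : ℕ × ℕ), IsRelPrime F' G' ∧ c * F' = F ∧ c * G' = G ∧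
      Bihomogeneous F' e ∧ Bihomogeneous G' e := by
  obtain ⟨G', F', c, hrel, rfl, rfl⟩ := UniqueFactorizationMonoid.exists_reduced_factors G hG0 F
  obtain ⟨k, hk⟩ := hG.of_mul hG0
  obtain ⟨e, he⟩ := Bihomogeneous.of_mul (F := G') (G := c) (d := d) (by rwa [mul_comm])
    (by rwa [mul_comm])
  refine ⟨c, F', G', e, hrel.symm, rfl, rfl, ?_, he⟩
  -- Zero has every bidegree, so in this case the bidegree of G' is imposed instead of being
  -- compared.
  by_cases hF0 : F' = 0
  · rw [hF0]; exact MvPolynomial.isWeightedHomogeneous_zero _ _ _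
  have hF0' : c * F' ≠ 0 := mul_ne_zero (left_ne_zero_of_mul hG0) hF0
  obtain ⟨e', he'⟩ := Bihomogeneous.of_mul (F := F') (G := c) (d := d) (by rwa [mul_comm])
    (by rwa [mul_comm])
  have h1 := MvPolynomial.IsWeightedHomogeneous.inj_right hF0' (hk.mul he') hF
  have h2 := MvPolynomial.IsWeightedHomogeneous.inj_right hG0 (hk.mul he) hG
  rw [add_left_cancel (h2.trans h1.symm)]
  exact he'

lemma RegularOn.exists_eq_div {U : Set S} {f : S → ℂ} (hf : RegularOn U f) (hU : U.Nonempty) :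
    ∃ (d : ℕ × ℕ) (F G : CoxRing), Bihomogeneous F d ∧ Bihomogeneous G d ∧ IsRelPrime F G ∧
      G ≠ 0 ∧ ∃ V, IsZariskiOpen V ∧ V.Nonempty ∧ V ⊆ U ∧
        ∀ q ∈ V, evalAt q G ≠ 0 ∧ f q = evalAt q F / evalAt q G := by
  obtain ⟨p, hp⟩ := hU
  obtain ⟨V, hV, hpV, hVU, d, F, G, hF, hG, h⟩ := hf p hp
  have hG0 : G ≠ 0 := by rintro rfl; simpa using (h p hpV).1
  obtain ⟨c, F', G', e, hrel, rfl, rfl, hF', hG'⟩ := hF.exists_reduced hG hG0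
  refine ⟨e, F', G', hF', hG', hrel, right_ne_zero_of_mul hG0, V, hV, ⟨p, hpV⟩, hVU,
    fun q hq => ?_⟩
  obtain ⟨h1, h2⟩ := h q hq
  rw [map_mul] at h1
  refine ⟨right_ne_zero_of_mul h1, ?_⟩
  rw [h2, map_mul, map_mul, mul_div_mul_left _ _ (left_ne_zero_of_mul h1)]

/-- A map to `ℙ¹`, given by mutually inverse regular functions on the members of an open cover,
is globally a pair of bihomogeneous polynomials without common zeros. -/
lemma exists_global_quotient {V₀ V₁ : Set S} {f₀ f₁ : S → ℂ}
    (hne : V₀.Nonempty) (hf₀ : RegularOn V₀ f₀) (hf₁ : RegularOn V₁ f₁)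
    (hmul : ∀ p ∈ V₀, p ∈ V₁ → f₀ p * f₁ p = 1) :
    ∃ (d : ℕ × ℕ) (F G : CoxRing), Bihomogeneous F d ∧ Bihomogeneous G d ∧
      (∀ p ∈ V₀, evalAt p G ≠ 0 ∧ f₀ p = evalAt p F / evalAt p G) ∧
      ∀ p ∈ V₁, evalAt p F ≠ 0 ∧ f₁ p = evalAt p G / evalAt p F := by
  obtain ⟨d, F, G, hF, hG, hrel, hG0, V, hV, hVne, hVV, h⟩ := hf₀.exists_eq_div hne
  refine ⟨d, F, G, hF, hG, fun p hp => ?_, fun p hp => ?_⟩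
  · obtain ⟨W, hW, hpW, hWV, e, F', G', hF', hG', h'⟩ := hf₀ p hp
    have heq : F * G' = G * F' := by
      refine (hF.mul hG').eq_of_eqOn (hG.mul hF') hV hW hVne ⟨p, hpW⟩ fun q hq hq' => ?_
      have h1 := (h q hq).2.symm.trans (h' q hq').2
      rw [div_eq_div_iff (h q hq).1 (h' q hq').1] at h1
      rw [map_mul, map_mul, h1, mul_comm]
    -- As F and G are coprime, G divides every local denominator; hence G is nonzero wherever some
    -- local denominator is.
    obtain ⟨c, rfl⟩ := hrel.symm.dvd_of_dvd_mul_left (Dvd.intro _ heq.symm)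
    obtain ⟨h1, h2⟩ := h' p hpW
    rw [map_mul] at h1
    have h3 : evalAt p F * evalAt p c = evalAt p F' := by
      rw [← map_mul]
      congr 1
      exact mul_left_cancel₀ hG0 (by rw [← heq]; ring)
    refine ⟨left_ne_zero_of_mul h1, ?_⟩
    rw [h2, map_mul, ← h3, mul_div_mul_right _ _ (right_ne_zero_of_mul h1)]
  · obtain ⟨W, hW, hpW, hWV, e, G', F', hG', hF', h'⟩ := hf₁ p hp
    have heq : F * G' = G * F' := by
      refine (hF.mul hG').eq_of_eqOn (hG.mul hF') hV hW hVne ⟨p, hpW⟩ fun q hq hq' => ?_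
      have h1 := hmul q (hVV hq) (hWV hq')
      rw [(h q hq).2, (h' q hq').2, div_mul_div_comm,
        div_eq_one_iff_eq (mul_ne_zero (h q hq).1 (h' q hq').1)] at h1
      rw [map_mul, map_mul, h1]
    obtain ⟨h1, h2⟩ := h' p hpW
    have hF0 : F ≠ 0 := by
      rintro rfl
      rw [zero_mul] at heq
      rcases mul_eq_zero.1 heq.symm with h3 | h3
      · exact hG0 h3
      · rw [h3, map_zero] at h1; exact h1 rfl
    obtain ⟨c, rfl⟩ := hrel.dvd_of_dvd_mul_left (Dvd.intro _ heq)
    rw [map_mul] at h1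
    have h3 : evalAt p G * evalAt p c = evalAt p G' := by
      rw [← map_mul]
      congr 1
      exact mul_left_cancel₀ hF0 (by rw [heq]; ring)
    refine ⟨left_ne_zero_of_mul h1, ?_⟩
    rw [h2, map_mul, ← h3, mul_div_mul_right _ _ (right_ne_zero_of_mul h1)]

/-! ### Nowhere vanishing sections -/

/-- `f : ℂ → ℂ` is a quotient of two polynomials without zeros near each point, in the Zariski
topology. -/
def IsUnitFunction (f : ℂ → ℂ) : Prop :=
  ∀ t, ∃ P Q : Polynomial ℂ, P.eval t ≠ 0 ∧ Q.eval t ≠ 0 ∧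
    ∃ A : Polynomial ℂ, A.eval t ≠ 0 ∧ ∀ s, A.eval s ≠ 0 → f s * Q.eval s = P.eval s

/-- All local quotients agree with a single reduced fraction, whose numerator and denominator have
no zeros on ℂ. Over ℂ both are then constant. -/
lemma IsUnitFunction.exists_const {f : ℂ → ℂ} (hf : IsUnitFunction f) : ∃ c, ∀ t, f t = c := by
  obtain ⟨P, Q, hP, hQ, A, hA, h⟩ := hf 0
  have hQ0 : Q ≠ 0 := by rintro rfl; simp at hQ
  have hA0 : A ≠ 0 := by rintro rfl; simp at hA
  obtain ⟨Q', P', c, hrel, rfl, rfl⟩ := UniqueFactorizationMonoid.exists_reduced_factors Q hQ0 P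
  have hc0 := left_ne_zero_of_mul hQ0
  have key : ∀ t, P'.eval t ≠ 0 ∧ Q'.eval t ≠ 0 ∧ f t = P'.eval t / Q'.eval t := by
    intro t
    obtain ⟨P₁, Q₁, hP₁, hQ₁, B, hB, h'⟩ := hf t
    have hB0 : B ≠ 0 := by rintro rfl; simp at hB
    have heq : P' * Q₁ = P₁ * Q' := by
      have h1 : (P' * Q₁ - P₁ * Q') * (c * A * B) = 0 := by
        refine Polynomial.funext fun s => ?_
        simp only [Polynomial.eval_mul, Polynomial.eval_sub, Polynomial.eval_zero] at h ⊢
        by_cases h2 : A.eval s = 0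
        · simp [h2]
        by_cases h3 : B.eval s = 0
        · simp [h3]
        have h4 := h s h2
        have h5 := h' s h3
        linear_combination (-A.eval s * B.eval s * Q₁.eval s) * h4 +
          (A.eval s * B.eval s * c.eval s * Q'.eval s) * h5
      rcases mul_eq_zero.1 h1 with h1 | h1
      · exact sub_eq_zero.1 h1
      · exact absurd h1 (mul_ne_zero (mul_ne_zero hc0 hA0) hB0)
    obtain ⟨a, b, hab⟩ := hrel.isCoprime
    have h1 := congrArg (Polynomial.eval t) heq
    have h2 := congrArg (Polynomial.eval t) hab
    simp only [Polynomial.eval_mul, Polynomial.eval_add, Polynomial.eval_one] at h1 h2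
    have hP' : P'.eval t ≠ 0 := by
      intro h3
      rw [h3, zero_mul] at h1
      have h4 := (mul_eq_zero.1 h1.symm).resolve_left hP₁
      rw [h3, h4] at h2; simp at h2
    have hQ' : Q'.eval t ≠ 0 := by
      intro h3
      rw [h3, mul_zero] at h1
      exact hP' ((mul_eq_zero.1 h1).resolve_right hQ₁)
    refine ⟨hP', hQ', ?_⟩
    rw [eq_div_iff hQ']
    have h3 := h' t hB
    apply mul_right_cancel₀ hQ₁
    linear_combination Q'.eval t * h3 - h1
  have hdeg : ∀ R : Polynomial ℂ, (∀ t, R.eval t ≠ 0) → ∃ a, R = Polynomial.C a := by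
    intro R hR
    refine ⟨R.coeff 0, Polynomial.eq_C_of_degree_le_zero ?_⟩
    by_contra hdeg
    obtain ⟨t, ht⟩ := Complex.exists_root (not_le.1 hdeg)
    exact hR t ht
  obtain ⟨a, ha⟩ := hdeg P' fun t => (key t).1
  obtain ⟨b, hb⟩ := hdeg Q' fun t => (key t).2.1
  exact ⟨a / b, fun t => by rw [(key t).2.2, ha, hb]; simp⟩

lemma zpow_eq_const {k : ℤ} {c : ℂ} (h : ∀ t : ℂ, t ≠ 0 → t ^ k = c) : k = 0 := by
  have h1 := h 1 one_ne_zero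
  have h2 := h 2 two_ne_zero
  rw [one_zpow] at h1
  rw [← h1] at h2
  have h3 := congrArg (fun z : ℂ => ‖z‖) h2
  simp only [norm_zpow, norm_one, RCLike.norm_ofNat] at h3
  exact (zpow_eq_one_iff_right₀ (by norm_num) (by norm_num)).1 h3

end P1xP1


namespace P1xP1

/-- `s` is a nowhere vanishing section of a line bundle of bidegree `(k, l)`, as a function of
the homogeneous coordinates. -/
structure IsUnitSection (s : (Fin 2 → ℂ) → (Fin 2 → ℂ) → ℂ) (k l : ℤ) : Prop where
  smul : ∀ a b : ℂ, a ≠ 0 → b ≠ 0 → ∀ v w, v ≠ 0 → w ≠ 0 →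
    s (a • v) (b • w) = a ^ k * b ^ l * s v w
  local_eq : ∀ v w, v ≠ 0 → w ≠ 0 → ∃ P Q A : CoxRing, ev v w P ≠ 0 ∧ ev v w Q ≠ 0 ∧
    ev v w A ≠ 0 ∧ ∀ v' w', v' ≠ 0 → w' ≠ 0 → ev v' w' A ≠ 0 → s v' w' * ev v' w' Q = ev v' w' P

/-- The restriction of a polynomial to a parametrized curve. -/
noncomputable def restrictCurve (p q : Fin 2 → Polynomial ℂ) : CoxRing →+* Polynomial ℂ :=
  MvPolynomial.eval₂Hom Polynomial.C (Sum.elim p q)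

lemma eval_restrictCurve (p q : Fin 2 → Polynomial ℂ) (F : CoxRing) (t : ℂ) :
    (restrictCurve p q F).eval t = ev (fun i => (p i).eval t) (fun i => (q i).eval t) F := by
  induction F using MvPolynomial.induction_on with
  | C a => simp [restrictCurve, ev]
  | add F G hF hG => rw [map_add, Polynomial.eval_add, hF, hG, map_add]
  | mul_X F i hF =>
    rw [map_mul, Polynomial.eval_mul, hF, map_mul]
    rcases i with i | i <;> simp [restrictCurve, ev]

namespace IsUnitSection

variable {s : (Fin 2 → ℂ) → (Fin 2 → ℂ) → ℂ} {k l : ℤ}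

lemma ne_zero (hs : IsUnitSection s k l) {v w : Fin 2 → ℂ} (hv : v ≠ 0) (hw : w ≠ 0) :
    s v w ≠ 0 := by
  obtain ⟨P, Q, A, hP, hQ, hA, h⟩ := hs.local_eq v w hv hw
  intro h0
  have := h v w hv hw hA
  rw [h0, zero_mul] at this
  exact hP this.symm

lemma isUnitFunction (hs : IsUnitSection s k l) (p q : Fin 2 → Polynomial ℂ)
    (hp : ∀ t, (fun i => (p i).eval t) ≠ 0) (hq : ∀ t, (fun i => (q i).eval t) ≠ 0) :
    IsUnitFunction fun t => s (fun i => (p i).eval t) (fun i => (q i).eval t) := by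
  intro t
  obtain ⟨P, Q, A, hP, hQ, hA, h⟩ := hs.local_eq _ _ (hp t) (hq t)
  refine ⟨restrictCurve p q P, restrictCurve p q Q, ?_, ?_, restrictCurve p q A, ?_,
    fun s hs => ?_⟩
  · rwa [eval_restrictCurve]
  · rwa [eval_restrictCurve]
  · rwa [eval_restrictCurve]
  · rw [eval_restrictCurve] at hs
    rw [eval_restrictCurve, eval_restrictCurve]
    exact h _ _ (hp s) (hq s) hs

/-- On a line ℙ¹ × {point}, the section is constant along each affine chart (1, t) and (t, 1). Since
(1, t) = t • (t⁻¹, 1), the transition function t ^ k is constant, which forces k = 0. -/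
lemma degree_fst_eq_zero (hs : IsUnitSection s k l) : k = 0 := by
  have hw : ∀ t : ℂ, (fun i => ((![1, 0] : Fin 2 → Polynomial ℂ) i).eval t) ≠ 0 := fun t h => by
    simpa using congrFun h 0
  obtain ⟨c, hc⟩ := (hs.isUnitFunction ![1, Polynomial.X] ![1, 0]
    (fun t h => by simpa using congrFun h 0) hw).exists_const
  obtain ⟨c', hc'⟩ := (hs.isUnitFunction ![Polynomial.X, 1] ![1, 0]
    (fun t h => by simpa using congrFun h 1) hw).exists_const
  have hw0 : (fun i => ((![1, 0] : Fin 2 → Polynomial ℂ) i).eval (0 : ℂ)) = ![1, 0] := by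
    ext i; fin_cases i <;> simp
  have hc0 : c' ≠ 0 := by
    rw [← hc' 0]
    exact hs.ne_zero (fun h => by simpa using congrFun h 1) (hw 0)
  refine zpow_eq_const (c := c / c') fun t ht => ?_
  rw [eq_div_iff hc0, ← hc t, ← hc' t⁻¹]
  have h1 : (fun i => ((![1, Polynomial.X] : Fin 2 → Polynomial ℂ) i).eval t) =
      t • fun i => ((![Polynomial.X, 1] : Fin 2 → Polynomial ℂ) i).eval t⁻¹ := by
    ext i; fin_cases i <;> simp [ht]
  have h2 : (fun i => ((![1, 0] : Fin 2 → Polynomial ℂ) i).eval t) =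
      (1 : ℂ) • fun i => ((![1, 0] : Fin 2 → Polynomial ℂ) i).eval t⁻¹ := by
    ext i; fin_cases i <;> simp
  rw [h1, h2, hs.smul t 1 ht one_ne_zero _ _ (fun h => by simpa using congrFun h 1) (hw _)]
  simp

/-- Exchange of the two factors, for polynomials. -/
lemma ev_rename_swap (v w : Fin 2 → ℂ) (F : CoxRing) :
    ev v w (MvPolynomial.rename Sum.swap F) = ev w v F := by
  rw [ev, MvPolynomial.eval_rename, ev]
  congr 2
  ext i; rcases i with i | i <;> rfl

lemma swap (hs : IsUnitSection s k l) : IsUnitSection (fun v w => s w v) l k where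
  smul a b ha hb v w hv hw := by rw [hs.smul b a hb ha w v hw hv]; ring
  local_eq v w hv hw := by
    obtain ⟨P, Q, A, hP, hQ, hA, h⟩ := hs.local_eq w v hw hv
    refine ⟨MvPolynomial.rename Sum.swap P, MvPolynomial.rename Sum.swap Q,
      MvPolynomial.rename Sum.swap A, ?_, ?_, ?_, fun v' w' hv' hw' h0 => ?_⟩
    · rwa [ev_rename_swap]
    · rwa [ev_rename_swap]
    · rwa [ev_rename_swap]
    · rw [ev_rename_swap] at h0
      rw [ev_rename_swap, ev_rename_swap]
      exact h _ _ hw' hv' h0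

lemma degree_snd_eq_zero (hs : IsUnitSection s k l) : l = 0 := hs.swap.degree_fst_eq_zero

end IsUnitSection

/-! ### Homogeneous lifts of morphisms -/

/-- `F` is a pair of bihomogeneous polynomials without common zeros which induces `f`. -/
def IsLift (f : S → P1) (d : ℕ × ℕ) (F : Fin 2 → CoxRing) : Prop :=
  (∀ i, Bihomogeneous (F i) d) ∧ ∀ (v w : Fin 2 → ℂ) (hv : v ≠ 0) (hw : w ≠ 0),
    ∃ h : (fun i => ev v w (F i)) ≠ 0,
      f (Projectivization.mk ℂ v hv, Projectivization.mk ℂ w hw) =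
        Projectivization.mk ℂ (fun i => ev v w (F i)) h

lemma isLift_of_evalAt {f : S → P1} {d : ℕ × ℕ} {F : Fin 2 → CoxRing}
    (hF : ∀ i, Bihomogeneous (F i) d)
    (h : ∀ p, (fun i => evalAt p (F i)) ≠ 0 ∧ ∃ a : ℂ, (f p).rep = a • fun i => evalAt p (F i)) :
    IsLift f d F := by
  refine ⟨hF, fun v w hv hw => ?_⟩
  obtain ⟨h0, a, ha⟩ := h (Projectivization.mk ℂ v hv, Projectivization.mk ℂ w hw)
  obtain ⟨b, hb, hbv⟩ := exists_rep_mk hv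
  obtain ⟨c, hc, hcw⟩ := exists_rep_mk hw
  have key : (fun i => evalAt (Projectivization.mk ℂ v hv, Projectivization.mk ℂ w hw) (F i)) =
      (b ^ d.1 * c ^ d.2) • fun i => ev v w (F i) := by
    ext i
    rw [evalAt_eq_ev, hbv, hcw, (hF i).ev_smul]
    rfl
  have h1 : (fun i => ev v w (F i)) ≠ 0 := fun h1 => h0 (by rw [key, h1, smul_zero])
  refine ⟨h1, ?_⟩
  rw [← Projectivization.mk_rep (f _), Projectivization.mk_eq_mk_iff']
  exact ⟨a * (b ^ d.1 * c ^ d.2), by rw [ha, key, mul_smul]⟩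

/-- The composition of a morphism with a projection has a homogeneous lift. -/
lemma IsMorphism.exists_isLift {φ : S → S} (hφ : IsMorphism φ) (π : S → P1)
    (j : Fin 2 → Fin 2 ⊕ Fin 2) (δ : ℕ × ℕ)
    (hj : ∀ i, Bihomogeneous (MvPolynomial.X (j i)) δ)
    (hπ : ∀ p i, evalAt p (MvPolynomial.X (j i)) = (π p).rep i) :
    ∃ d F, IsLift (π ∘ φ) d F := by
  have hopen : ∀ i, IsZariskiOpen {p | evalAt p (MvPolynomial.X (j i)) ≠ 0} := fun i =>
    ⟨{MvPolynomial.X (j i)}, by rintro F rfl; exact ⟨δ, hj i⟩, by ext p; simp⟩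
  have hreg : ∀ i i', RegularOn {p | evalAt p (MvPolynomial.X (j i)) ≠ 0}
      (fun p => evalAt p (MvPolynomial.X (j i')) / evalAt p (MvPolynomial.X (j i))) :=
    fun i i' p hp => ⟨_, hopen i, hp, subset_rfl, δ, _, _, hj i', hj i, fun q hq => ⟨hq, rfl⟩⟩
  have main : ∀ i i' : Fin 2, i ≠ i' → (φ ⁻¹' {p | evalAt p (MvPolynomial.X (j i)) ≠ 0}).Nonempty →
      ∃ d F, IsLift (π ∘ φ) d F := by
    intro i i' hii hne
    obtain ⟨d, F, G, hF, hG, h0, h1⟩ := exists_global_quotient hne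
      (hφ.2 _ _ (hopen i) (hreg i i')) (hφ.2 _ _ (hopen i') (hreg i' i)) (by
        intro p (hp : _ ≠ _) (hp' : _ ≠ _)
        simp only [Function.comp_apply]
        field_simp)
    have hcase : ∀ k, k = i ∨ k = i' := by omega
    -- F / G is the pull-back of the ratio of coordinate i' by coordinate i, so G is the component
    -- at i.
    refine ⟨d, fun k => if k = i then G else F, isLift_of_evalAt (fun k => ?_) fun p => ?_⟩
    · split_ifs; exacts [hG, hF]
    by_cases hp : evalAt (φ p) (MvPolynomial.X (j i)) = 0
    · have hp' : evalAt (φ p) (MvPolynomial.X (j i')) ≠ 0 := by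
        intro hp'
        rw [hπ] at hp hp'
        apply (π (φ p)).rep_nonzero
        ext k
        rcases hcase k with rfl | rfl
        exacts [hp, hp']
      obtain ⟨h2, h3⟩ := h1 p hp'
      refine ⟨fun h => h2 (by simpa [hii.symm] using congrFun h i'),
        evalAt (φ p) (MvPolynomial.X (j i')) / evalAt p F, ?_⟩
      simp only [Function.comp_apply] at h3
      have h4 := hp'
      rw [hπ] at h4
      rw [hπ, hπ] at h3
      ext k
      rcases hcase k with rfl | rfl
      · simp [hπ]
        field_simp at h3 ⊢
        linear_combination h3
      · simp [hπ, hii.symm]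
        field_simp
    · obtain ⟨h2, h3⟩ := h0 p hp
      refine ⟨fun h => h2 (by simpa using congrFun h i),
        evalAt (φ p) (MvPolynomial.X (j i)) / evalAt p G, ?_⟩
      simp only [Function.comp_apply] at h3
      have h4 := hp
      rw [hπ] at h4
      rw [hπ, hπ] at h3
      ext k
      rcases hcase k with rfl | rfl
      · simp [hπ]
        field_simp
      · simp [hπ, hii.symm]
        field_simp at h3 ⊢
        linear_combination h3
  let p₀ : S := Classical.arbitrary S
  by_cases h : evalAt (φ p₀) (MvPolynomial.X (j 0)) = 0
  · refine main 1 0 (by decide) ⟨p₀, fun h' => (π (φ p₀)).rep_nonzero ?_⟩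
    rw [hπ] at h h'
    ext k; fin_cases k
    exacts [h, h']
  · exact main 0 1 (by decide) ⟨p₀, h⟩

lemma bihomogeneous_X_inl (i : Fin 2) : Bihomogeneous (MvPolynomial.X (Sum.inl i)) (1, 0) :=
  MvPolynomial.isWeightedHomogeneous_X _ _ _

lemma bihomogeneous_X_inr (i : Fin 2) : Bihomogeneous (MvPolynomial.X (Sum.inr i)) (0, 1) :=
  MvPolynomial.isWeightedHomogeneous_X _ _ _

lemma IsMorphism.exists_isLift_fst {φ : S → S} (hφ : IsMorphism φ) :
    ∃ d F, IsLift (fun p => (φ p).1) d F :=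
  hφ.exists_isLift Prod.fst Sum.inl (1, 0) bihomogeneous_X_inl fun _ i => ev_inl _ _ i

lemma IsMorphism.exists_isLift_snd {φ : S → S} (hφ : IsMorphism φ) :
    ∃ d F, IsLift (fun p => (φ p).2) d F :=
  hφ.exists_isLift Prod.snd Sum.inr (0, 1) bihomogeneous_X_inr fun _ i => ev_inr _ _ i

end P1xP1


/-! ### Bidegrees of composed maps and the automorphism group -/

namespace P1xP1

lemma Bihomogeneous.aeval {P : CoxRing} {c : ℕ × ℕ} (hP : Bihomogeneous P c)
    {F H : Fin 2 → CoxRing} {d e : ℕ × ℕ} (hF : ∀ i, Bihomogeneous (F i) d)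
    (hH : ∀ i, Bihomogeneous (H i) e) :
    Bihomogeneous (MvPolynomial.aeval (Sum.elim F H) P) (c.1 • d + c.2 • e) := by
  rw [bihomogeneous_iff] at hP
  rw [MvPolynomial.aeval_def, MvPolynomial.eval₂_eq']
  refine MvPolynomial.IsWeightedHomogeneous.sum _ _ _ fun m hm => ?_
  have hm' := MvPolynomial.mem_support_iff.1 hm
  have h1 := hP.1 hm'
  have h2 := hP.2 hm'
  simp [Finsupp.weight_apply, Finsupp.sum_fintype] at h1 h2
  refine MvPolynomial.IsWeightedHomogeneous.C_mul ?_ _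
  rw [← h1, ← h2, Fintype.prod_sum_type, Fin.prod_univ_two, Fin.prod_univ_two, add_smul, add_smul]
  exact (((hF 0).pow _).mul ((hF 1).pow _)).mul (((hH 0).pow _).mul ((hH 1).pow _))

lemma ev_aeval (v w : Fin 2 → ℂ) (F H : Fin 2 → CoxRing) (P : CoxRing) :
    ev v w (MvPolynomial.aeval (Sum.elim F H) P) =
      ev (fun i => ev v w (F i)) (fun i => ev v w (H i)) P := by
  induction P using MvPolynomial.induction_on with
  | C a => simp [ev]
  | add F G hF hG => rw [map_add, map_add, hF, hG, map_add]
  | mul_X F i hF =>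
    rw [map_mul, map_mul, hF, map_mul]
    rcases i with i | i <;> simp [ev]

/-- Substituting forms into forms multiplies bidegrees like matrices; this turns the invertibility
of an automorphism into a statement about matrices over ℕ. -/
lemma IsLift.comp {f g h : S → P1} {c d e : ℕ × ℕ} {P F H : Fin 2 → CoxRing}
    (hP : IsLift f c P) (hF : IsLift g d F) (hH : IsLift h e H) :
    IsLift (fun p => f (g p, h p)) (c.1 • d + c.2 • e)
      fun i => MvPolynomial.aeval (Sum.elim F H) (P i) := by
  refine ⟨fun i => (hP.1 i).aeval hF.1 hH.1, fun v w hv hw => ?_⟩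
  obtain ⟨h1, h2⟩ := hF.2 v w hv hw
  obtain ⟨h3, h4⟩ := hH.2 v w hv hw
  obtain ⟨h5, h6⟩ := hP.2 _ _ h1 h3
  simp only [ev_aeval]
  exact ⟨h5, by rw [h2, h4, h6]⟩

lemma isLift_fst : IsLift Prod.fst (1, 0) fun i => MvPolynomial.X (Sum.inl i) :=
  ⟨bihomogeneous_X_inl, fun v w hv hw => by simp only [ev_inl]; exact ⟨hv, trivial⟩⟩

lemma isLift_snd : IsLift Prod.snd (0, 1) fun i => MvPolynomial.X (Sum.inr i) :=
  ⟨bihomogeneous_X_inr, fun v w hv hw => by simp only [ev_inr]; exact ⟨hw, trivial⟩⟩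

/-- The bidegree of a map to `ℙ¹` is well-defined. -/
lemma IsLift.degree_unique {f : S → P1} {d e : ℕ × ℕ} {F G : Fin 2 → CoxRing}
    (hF : IsLift f d F) (hG : IsLift f e G) : d = e := by
  -- The ratio of the two lifts, with junk value 0 at zero vectors so that it becomes a total
  -- function. It is a nowhere vanishing section of bidegree e - d.
  have hex : ∀ v w : Fin 2 → ℂ, ∃ a : ℂ, v ≠ 0 → w ≠ 0 →
      a ≠ 0 ∧ ∀ i, a * ev v w (F i) = ev v w (G i) := by
    intro v w
    by_cases hv : v = 0
    · exact ⟨0, fun h => absurd hv h⟩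
    by_cases hw : w = 0
    · exact ⟨0, fun _ h => absurd hw h⟩
    obtain ⟨h1, h2⟩ := hF.2 v w hv hw
    obtain ⟨h3, h4⟩ := hG.2 v w hv hw
    obtain ⟨a, ha⟩ := (Projectivization.mk_eq_mk_iff ℂ _ _ _ _).1 (h4.symm.trans h2)
    exact ⟨a, fun _ _ => ⟨a.ne_zero, fun i => congrFun ha i⟩⟩
  choose s hs using hex
  have hF0 : ∀ v w : Fin 2 → ℂ, v ≠ 0 → w ≠ 0 → ∃ i, ev v w (F i) ≠ 0 := fun v w hv hw =>
    Function.ne_iff.1 (hF.2 v w hv hw).1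
  have key : IsUnitSection s ((e.1 : ℤ) - d.1) ((e.2 : ℤ) - d.2) := by
    refine ⟨fun a b ha hb v w hv hw => ?_, fun v w hv hw => ?_⟩
    · obtain ⟨i, hi⟩ := hF0 v w hv hw
      have h1 := (hs v w hv hw).2 i
      have h2 := (hs _ _ (smul_ne_zero ha hv) (smul_ne_zero hb hw)).2 i
      rw [(hF.1 i).ev_smul, (hG.1 i).ev_smul, ← h1] at h2
      rw [zpow_sub₀ ha, zpow_sub₀ hb]
      simp only [zpow_natCast]
      have := pow_ne_zero d.1 ha
      have := pow_ne_zero d.2 hb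
      field_simp
      apply mul_right_cancel₀ hi
      linear_combination h2
    · obtain ⟨i, hi⟩ := hF0 v w hv hw
      obtain ⟨h0, h1⟩ := hs v w hv hw
      refine ⟨G i, F i, F i, ?_, hi, hi, fun v' w' hv' hw' _ => (hs v' w' hv' hw').2 i⟩
      rw [← h1 i]
      exact mul_ne_zero h0 hi
  have h1 := key.degree_fst_eq_zero
  have h2 := key.degree_snd_eq_zero
  ext <;> omega

/-! ### The structure of `Aut(S)` -/

/-- The projective linear group of `ℙ¹`, as a group of permutations. -/
noncomputable def PGL : Subgroup (Equiv.Perm P1) :=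
  (MulAction.toPermHom (GL (Fin 2) ℂ) P1).range

lemma eq_linear_of_support {σ : Type*} {F : MvPolynomial σ ℂ} {j k : σ} (hjk : j ≠ k)
    (h : ∀ m, F.coeff m ≠ 0 → m = Finsupp.single j 1 ∨ m = Finsupp.single k 1) :
    ∃ a b : ℂ, F = MvPolynomial.C a * MvPolynomial.X j + MvPolynomial.C b * MvPolynomial.X k := by
  classical
  refine ⟨F.coeff (Finsupp.single j 1), F.coeff (Finsupp.single k 1), ?_⟩
  have hne : Finsupp.single j 1 ≠ Finsupp.single k 1 := fun h =>
    hjk (Finsupp.single_left_injective one_ne_zero h)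
  ext m
  rw [MvPolynomial.coeff_add, MvPolynomial.coeff_C_mul, MvPolynomial.coeff_C_mul,
    MvPolynomial.coeff_X, MvPolynomial.coeff_X]
  by_cases hj : Finsupp.single j 1 = m
  · rw [if_pos hj, if_neg fun h => hne (hj.trans h.symm), hj]; simp
  by_cases hk : Finsupp.single k 1 = m
  · rw [if_neg hj, if_pos hk, hk]; simp
  rw [if_neg hj, if_neg hk]
  by_contra h0
  rcases h m (by simpa using h0) with h | h
  exacts [hj h.symm, hk h.symm]

lemma Bihomogeneous.eq_linear_fst {F : CoxRing} (hF : Bihomogeneous F (1, 0)) :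
    ∃ a b : ℂ, ∀ v w, ev v w F = a * v 0 + b * v 1 := by
  rw [bihomogeneous_iff] at hF
  obtain ⟨a, b, rfl⟩ := eq_linear_of_support (F := F) (j := Sum.inl 0) (k := Sum.inl 1) (by simp) (by
    intro m hm
    have h1 := hF.1 hm
    have h2 := hF.2 hm
    simp [Finsupp.weight_apply, Finsupp.sum_fintype] at h1 h2
    have h3 : m (Sum.inl 0) = 0 ∨ m (Sum.inl 0) = 1 := by omega
    refine h3.symm.imp (fun h3 => ?_) fun h3 => ?_
    all_goals
      ext i
      rcases i with i | i <;> fin_cases i <;> simp <;> omega)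
  exact ⟨a, b, fun v w => by simp [ev]⟩

lemma Bihomogeneous.eq_linear_snd {F : CoxRing} (hF : Bihomogeneous F (0, 1)) :
    ∃ a b : ℂ, ∀ v w, ev v w F = a * w 0 + b * w 1 := by
  rw [bihomogeneous_iff] at hF
  obtain ⟨a, b, rfl⟩ := eq_linear_of_support (F := F) (j := Sum.inr 0) (k := Sum.inr 1) (by simp) (by
    intro m hm
    have h1 := hF.1 hm
    have h2 := hF.2 hm
    simp [Finsupp.weight_apply, Finsupp.sum_fintype] at h1 h2
    have h3 : m (Sum.inr 0) = 0 ∨ m (Sum.inr 0) = 1 := by omega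
    refine h3.symm.imp (fun h3 => ?_) fun h3 => ?_
    all_goals
      ext i
      rcases i with i | i <;> fin_cases i <;> simp <;> omega)
  exact ⟨a, b, fun v w => by simp [ev]⟩

/-- A matrix whose kernel is trivial gives an element of `PGL`. -/
lemma exists_mem_PGL_of_matrix (M : Matrix (Fin 2) (Fin 2) ℂ) (hM : ∀ v, v ≠ 0 → M.mulVec v ≠ 0) :
    ∃ α ∈ PGL, ∀ (v : Fin 2 → ℂ) (hv : v ≠ 0),
      α (Projectivization.mk ℂ v hv) = Projectivization.mk ℂ (M.mulVec v) (hM v hv) := by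
  have hdet : M.det ≠ 0 := fun h => by
    obtain ⟨v, hv, h⟩ := Matrix.exists_mulVec_eq_zero_iff.2 h
    exact hM v hv h
  exact ⟨MulAction.toPermHom _ _ (Matrix.GeneralLinearGroup.mkOfDetNeZero M hdet), ⟨_, rfl⟩,
    fun v hv => rfl⟩

lemma IsLift.exists_PGL_fst {f : S → P1} {F : Fin 2 → CoxRing} (hF : IsLift f (1, 0) F) :
    ∃ α ∈ PGL, ∀ p, f p = α p.1 := by
  choose a b hab using fun i => (hF.1 i).eq_linear_fst
  have key : ∀ v w, (fun i => ev v w (F i)) = Matrix.mulVec !![a 0, b 0; a 1, b 1] v := by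
    intro v w
    ext i
    rw [hab]
    fin_cases i <;> simp [Matrix.mulVec, dotProduct]
  have hw : (![1, 0] : Fin 2 → ℂ) ≠ 0 := fun h => by simpa using congrFun h 0
  obtain ⟨α, hα, h⟩ := exists_mem_PGL_of_matrix !![a 0, b 0; a 1, b 1] fun v hv => by
    rw [← key v ![1, 0]]; exact (hF.2 v _ hv hw).1
  refine ⟨α, hα, fun p => ?_⟩
  obtain ⟨h1, h2⟩ := hF.2 p.1.rep p.2.rep p.1.rep_nonzero p.2.rep_nonzero
  rw [Projectivization.mk_rep, Projectivization.mk_rep] at h2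
  conv_rhs => rw [← p.1.mk_rep]
  rw [h2, h]
  simp only [key]

lemma IsLift.exists_PGL_snd {f : S → P1} {F : Fin 2 → CoxRing} (hF : IsLift f (0, 1) F) :
    ∃ α ∈ PGL, ∀ p, f p = α p.2 := by
  choose a b hab using fun i => (hF.1 i).eq_linear_snd
  have key : ∀ v w, (fun i => ev v w (F i)) = Matrix.mulVec !![a 0, b 0; a 1, b 1] w := by
    intro v w
    ext i
    rw [hab]
    fin_cases i <;> simp [Matrix.mulVec, dotProduct]
  have hv : (![1, 0] : Fin 2 → ℂ) ≠ 0 := fun h => by simpa using congrFun h 0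
  obtain ⟨α, hα, h⟩ := exists_mem_PGL_of_matrix !![a 0, b 0; a 1, b 1] fun w hw => by
    rw [← key ![1, 0] w]; exact (hF.2 _ w hv hw).1
  refine ⟨α, hα, fun p => ?_⟩
  obtain ⟨h1, h2⟩ := hF.2 p.1.rep p.2.rep p.1.rep_nonzero p.2.rep_nonzero
  rw [Projectivization.mk_rep, Projectivization.mk_rep] at h2
  conv_rhs => rw [← p.2.mk_rep]
  rw [h2, h]
  simp only [key]

/-- Every automorphism of `ℙ¹ × ℙ¹` acts by projective transformations on the factors, possibly
after exchanging them. -/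
theorem Aut.exists_PGL (φ : Aut) :
    (∃ α ∈ PGL, ∃ β ∈ PGL, ∀ p, φ.1 p = (α p.1, β p.2)) ∨
      ∃ α ∈ PGL, ∃ β ∈ PGL, ∀ p, φ.1 p = (α p.2, β p.1) := by
  obtain ⟨d, F, hF⟩ := φ.2.1.exists_isLift_fst
  obtain ⟨e, H, hH⟩ := φ.2.1.exists_isLift_snd
  obtain ⟨d', F', hF'⟩ := φ.2.2.exists_isLift_fst
  obtain ⟨e', H', hH'⟩ := φ.2.2.exists_isLift_snd
  -- The matrix with rows d, e times the matrix with rows d', e' is the identity; over ℕ this forces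
  -- the first one to be a permutation matrix.
  have h1 := (hF.comp hF' hH').degree_unique (e := (1, 0)) (by simpa using isLift_fst)
  have h2 := (hH.comp hF' hH').degree_unique (e := (0, 1)) (by simpa using isLift_snd)
  obtain ⟨d₁, d₂⟩ := d
  obtain ⟨e₁, e₂⟩ := e
  obtain ⟨d₁', d₂'⟩ := d'
  obtain ⟨e₁', e₂'⟩ := e'
  simp only [Prod.smul_mk, smul_eq_mul, Prod.mk_add_mk, Prod.mk.injEq, Nat.add_eq_zero_iff,
    mul_eq_zero] at h1 h2
  obtain ⟨h1, h3, h4⟩ := h1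
  obtain ⟨⟨h5, h6⟩, h2⟩ := h2
  have hdeg : (d₁ = 1 ∧ d₂ = 0 ∧ e₁ = 0 ∧ e₂ = 1) ∨ (d₁ = 0 ∧ d₂ = 1 ∧ e₁ = 1 ∧ e₂ = 0) := by
    rcases Nat.add_eq_one_iff.1 h1 with ⟨h7, h8⟩ | ⟨h7, h8⟩ <;>
      rcases Nat.add_eq_one_iff.1 h2 with ⟨h9, h10⟩ | ⟨h9, h10⟩ <;>
      simp only [mul_eq_one, mul_eq_zero] at h7 h8 h9 h10 <;> omega
  rcases hdeg with ⟨rfl, rfl, rfl, rfl⟩ | ⟨rfl, rfl, rfl, rfl⟩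
  · obtain ⟨α, hα, h⟩ := hF.exists_PGL_fst
    obtain ⟨β, hβ, h'⟩ := hH.exists_PGL_snd
    exact Or.inl ⟨α, hα, β, hβ, fun p => Prod.ext (h p) (h' p)⟩
  · obtain ⟨α, hα, h⟩ := hF.exists_PGL_snd
    obtain ⟨β, hβ, h'⟩ := hH.exists_PGL_fst
    exact Or.inr ⟨α, hα, β, hβ, fun p => Prod.ext (h p) (h' p)⟩

end P1xP1


namespace P1xP1

/-! ### Products of projective transformations are automorphisms -/

/-- The linear forms in the variables `X (j k)` with coefficients the rows of a matrix. -/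
noncomputable def rowForms (g : Matrix (Fin 2) (Fin 2) ℂ) (j : Fin 2 → Fin 2 ⊕ Fin 2) (i : Fin 2) :
    CoxRing :=
  MvPolynomial.C (g i 0) * MvPolynomial.X (j 0) + MvPolynomial.C (g i 1) * MvPolynomial.X (j 1)

lemma bihomogeneous_rowForms (g : Matrix (Fin 2) (Fin 2) ℂ) {j : Fin 2 → Fin 2 ⊕ Fin 2} {δ : ℕ × ℕ}
    (hj : ∀ i, Bihomogeneous (MvPolynomial.X (j i)) δ) (i : Fin 2) :
    Bihomogeneous (rowForms g j i) δ :=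
  ((hj 0).C_mul _).add ((hj 1).C_mul _)

/-- The action of a pair of matrices on polynomials by substitution. -/
noncomputable def subst (g h : Matrix (Fin 2) (Fin 2) ℂ) : CoxRing →ₐ[ℂ] CoxRing :=
  MvPolynomial.aeval (Sum.elim (rowForms g Sum.inl) (rowForms h Sum.inr))

lemma Bihomogeneous.subst {F : CoxRing} {d : ℕ × ℕ} (hF : Bihomogeneous F d)
    (g h : Matrix (Fin 2) (Fin 2) ℂ) : Bihomogeneous (subst g h F) d := by
  have := hF.aeval (bihomogeneous_rowForms g bihomogeneous_X_inl)
    (bihomogeneous_rowForms h bihomogeneous_X_inr)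
  rwa [show d.1 • ((1, 0) : ℕ × ℕ) + d.2 • ((0, 1) : ℕ × ℕ) = d by simp] at this

lemma ev_subst (g h : Matrix (Fin 2) (Fin 2) ℂ) (v w : Fin 2 → ℂ) (F : CoxRing) :
    ev v w (subst g h F) = ev (g.mulVec v) (h.mulVec w) F := by
  rw [subst, ev_aeval]
  congr 2 <;> ext i <;> simp [rowForms, ev, Matrix.mulVec, dotProduct]

section ProductMap

variable (g h : GL (Fin 2) ℂ)

lemma smul_eq_mk (p : P1) :
    g • p = Projectivization.mk ℂ (g • p.rep) ((smul_ne_zero_iff_ne g).mpr p.rep_nonzero) := by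
  conv_lhs => rw [← p.mk_rep]
  rfl

lemma Bihomogeneous.evalAt_smul {F : CoxRing} {d : ℕ × ℕ} (hF : Bihomogeneous F d) (p : S) :
    evalAt (g • p.1, h • p.2) F = 0 ↔ evalAt p (P1xP1.subst g.1 h.1 F) = 0 := by
  rw [smul_eq_mk, smul_eq_mk, hF.evalAt_mk, evalAt_eq_ev, ev_subst]
  rfl

lemma Bihomogeneous.evalAt_div_smul {F G : CoxRing} {d : ℕ × ℕ} (hF : Bihomogeneous F d)
    (hG : Bihomogeneous G d) (p : S) :
    evalAt (g • p.1, h • p.2) F / evalAt (g • p.1, h • p.2) G =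
      evalAt p (P1xP1.subst g.1 h.1 F) / evalAt p (P1xP1.subst g.1 h.1 G) := by
  rw [smul_eq_mk, smul_eq_mk, hF.evalAt_div_mk hG, evalAt_eq_ev, ev_subst, evalAt_eq_ev, ev_subst]
  rfl

lemma IsZariskiOpen.preimage_smul {U : Set S} (hU : IsZariskiOpen U) :
    IsZariskiOpen ((fun p : S => (g • p.1, h • p.2)) ⁻¹' U) := by
  obtain ⟨I, hI, rfl⟩ := hU
  refine ⟨subst g.1 h.1 '' I, ?_, ?_⟩
  · rintro _ ⟨F, hF, rfl⟩
    obtain ⟨d, hd⟩ := hI F hF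
    exact ⟨d, hd.subst _ _⟩
  · ext p
    constructor
    · rintro ⟨F, hF, h0⟩
      obtain ⟨d, hd⟩ := hI F hF
      exact ⟨_, ⟨F, hF, rfl⟩, fun h' => h0 ((hd.evalAt_smul g h p).2 h')⟩
    · rintro ⟨_, ⟨F, hF, rfl⟩, h0⟩
      obtain ⟨d, hd⟩ := hI F hF
      exact ⟨F, hF, fun h' => h0 ((hd.evalAt_smul g h p).1 h')⟩

lemma isMorphism_smul : IsMorphism fun p : S => (g • p.1, h • p.2) := by
  refine ⟨fun U hU => hU.preimage_smul g h, fun U f hU hf p hp => ?_⟩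
  obtain ⟨V, hV, hpV, hVU, d, F, G, hF, hG, hq⟩ := hf _ hp
  refine ⟨_, hV.preimage_smul g h, hpV, Set.preimage_mono hVU, d, _, _, hF.subst g.1 h.1,
    hG.subst g.1 h.1, fun q hqV => ?_⟩
  obtain ⟨h1, h2⟩ := hq _ hqV
  exact ⟨fun h' => h1 ((hG.evalAt_smul g h q).2 h'), h2.trans (hF.evalAt_div_smul g h hG q)⟩

end ProductMap

/-- The automorphism of `ℙ¹ × ℙ¹` given by two projective transformations. -/
noncomputable def prodAut {α β : Equiv.Perm P1} (hα : α ∈ PGL) (hβ : β ∈ PGL) : Aut :=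
  ⟨Equiv.prodCongr α β, by
    obtain ⟨g, rfl⟩ := hα
    obtain ⟨h, rfl⟩ := hβ
    exact ⟨isMorphism_smul g h, isMorphism_smul g⁻¹ h⁻¹⟩⟩

/-! ### The line bundles `𝒪(a, b)` -/

/-- A family of bihomogeneous polynomials of bidegree `d`, the one at `p` not vanishing at `p`. -/
structure FormFamily (d : ℕ × ℕ) where
  F : S → CoxRing
  bihom : ∀ p, Bihomogeneous (F p) d
  ne_zero : ∀ p, evalAt p (F p) ≠ 0

lemma isZariskiOpen_ne_zero {F : CoxRing} {d : ℕ × ℕ} (hF : Bihomogeneous F d) :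
    IsZariskiOpen {p | evalAt p F ≠ 0} :=
  ⟨{F}, by rintro _ rfl; exact ⟨d, hF⟩, by ext p; simp⟩

lemma unitOn_div {F G : CoxRing} {d : ℕ × ℕ} (hF : Bihomogeneous F d) (hG : Bihomogeneous G d) :
    UnitOn ({p | evalAt p F ≠ 0} ∩ {p | evalAt p G ≠ 0}) fun x => evalAt x F / evalAt x G :=
  ⟨fun _ hp => ⟨_, (isZariskiOpen_ne_zero hF).inter (isZariskiOpen_ne_zero hG), hp, subset_rfl,
    d, F, G, hF, hG, fun _ hq => ⟨hq.2, rfl⟩⟩, fun _ hp => div_ne_zero hp.1 hp.2⟩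

namespace FormFamily

variable {d e : ℕ × ℕ}

/-- The line bundle `𝒪(d)`, trivialized on the complements of the zero loci of the forms. -/
noncomputable def bundle (F : FormFamily d) : LineBundle where
  U p := {q | evalAt q (F.F p) ≠ 0}
  isOpen p := isZariskiOpen_ne_zero (F.bihom p)
  mem p := F.ne_zero p
  g p q x := evalAt x (F.F p) / evalAt x (F.F q)
  unit p q := unitOn_div (F.bihom p) (F.bihom q)
  cocycle _ _ _ _ hx := div_mul_div_cancel₀ hx.1.2

lemma iso_bundle (F F' : FormFamily d) : LineBundle.Iso F.bundle F'.bundle := by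
  refine ⟨fun p => {q | evalAt q (F'.F p) ≠ 0} ∩ {q | evalAt q (F.F p) ≠ 0},
    fun p x => evalAt x (F'.F p) / evalAt x (F.F p),
    fun p => (F'.bundle.isOpen p).inter (F.bundle.isOpen p), fun p => ⟨F'.ne_zero p, F.ne_zero p⟩,
    fun p x hx => hx.symm, fun p => unitOn_div (F'.bihom p) (F.bihom p), fun p q x hx => ?_⟩
  obtain ⟨⟨h1, h2⟩, h3, h4⟩ := hx
  simp only [Set.mem_ofPred_eq] at h1 h2 h3 h4
  simp only [bundle]
  field_simp

/-- The product of two families. -/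
noncomputable def mul (F : FormFamily d) (F' : FormFamily e) : FormFamily (d + e) where
  F p := F.F p * F'.F p
  bihom p := (F.bihom p).mul (F'.bihom p)
  ne_zero p := by rw [map_mul]; exact mul_ne_zero (F.ne_zero p) (F'.ne_zero p)

lemma iso_mul (F : FormFamily d) (F' : FormFamily e) :
    LineBundle.Iso (F.mul F').bundle (F.bundle.tensor F'.bundle) :=
  LineBundle.iso_of_eqOn _ _ fun p q x _ => by
    simp [bundle, mul, LineBundle.tensor, div_mul_div_comm]

/-- The constant family of bidegree `0`. -/
noncomputable def one : FormFamily 0 where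
  F _ := 1
  bihom _ := MvPolynomial.isWeightedHomogeneous_one _ _
  ne_zero _ := by simp

lemma exists_rep_ne_zero (p : P1) : ∃ i, p.rep i ≠ 0 := Function.ne_iff.1 p.rep_nonzero

/-- The family of coordinates on the first factor. -/
noncomputable def fst : FormFamily (1, 0) where
  F p := MvPolynomial.X (Sum.inl (exists_rep_ne_zero p.1).choose)
  bihom _ := bihomogeneous_X_inl _
  ne_zero p := by
    rw [evalAt_eq_ev, ev_inl]; exact (exists_rep_ne_zero p.1).choose_spec

/-- The family of coordinates on the second factor. -/
noncomputable def snd : FormFamily (0, 1) where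
  F p := MvPolynomial.X (Sum.inr (exists_rep_ne_zero p.2).choose)
  bihom _ := bihomogeneous_X_inr _
  ne_zero p := by
    rw [evalAt_eq_ev, ev_inr]; exact (exists_rep_ne_zero p.2).choose_spec

/-- The pull-back of a family along a product of projective transformations. -/
noncomputable def pullback (F : FormFamily d) (g h : GL (Fin 2) ℂ) : FormFamily d where
  F p := subst g.1 h.1 (F.F (g • p.1, h • p.2))
  bihom p := (F.bihom _).subst _ _
  ne_zero p := fun h0 => F.ne_zero _ (((F.bihom _).evalAt_smul g h p).2 h0)

lemma iso_pullback (F : FormFamily d) (g h : GL (Fin 2) ℂ) {φ : S → S} (hφ : IsMorphism φ)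
    (hgh : φ = fun p : S => (g • p.1, h • p.2)) :
    LineBundle.Iso (F.bundle.pullback hφ) (F.pullback g h).bundle := by
  subst hgh
  exact LineBundle.iso_of_eqOn _ _ fun p q x _ =>
    ((F.bihom _).evalAt_div_smul g h (F.bihom _) x).symm

/-- The bidegree of a line bundle `𝒪(d)` is determined by its isomorphism class. -/
lemma degree_eq_of_iso {F : FormFamily d} {F' : FormFamily e}
    (hiso : LineBundle.Iso F.bundle F'.bundle) : d = e := by
  obtain ⟨W, h, hW, hm, hs, hu, hc⟩ := hiso
  -- The cocycle condition says that the local functions h F / F' agree on overlaps. They glue to a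
  -- nowhere vanishing section of bidegree d - e.
  have hglue : ∀ p q x, x ∈ W p → x ∈ W q →
      h q x * evalAt x (F.F q) / evalAt x (F'.F q) =
        h p x * evalAt x (F.F p) / evalAt x (F'.F p) := by
    intro p q x hp hq
    have h1 := hc p q x ⟨hp, hq⟩
    simp only [bundle] at h1
    have h2 : evalAt x (F.F p) ≠ 0 := (hs p hp).1
    have h3 : evalAt x (F'.F p) ≠ 0 := (hs p hp).2
    have h4 : evalAt x (F.F q) ≠ 0 := (hs q hq).1
    have h5 : evalAt x (F'.F q) ≠ 0 := (hs q hq).2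
    field_simp at h1 ⊢
    linear_combination h1
  -- At each point the chart attached to that very point is used; `hglue` compares it with a fixed
  -- neighbouring chart.
  let s : (Fin 2 → ℂ) → (Fin 2 → ℂ) → ℂ := fun v w => by
    classical
    exact if hv : v ≠ 0 then if hw : w ≠ 0 then
      h (Projectivization.mk ℂ v hv, Projectivization.mk ℂ w hw)
        (Projectivization.mk ℂ v hv, Projectivization.mk ℂ w hw) *
        ev v w (F.F (Projectivization.mk ℂ v hv, Projectivization.mk ℂ w hw)) /
        ev v w (F'.F (Projectivization.mk ℂ v hv, Projectivization.mk ℂ w hw)) else 0 else 0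
  have hs_eq : ∀ v w (hv : v ≠ 0) (hw : w ≠ 0), s v w =
      h (Projectivization.mk ℂ v hv, Projectivization.mk ℂ w hw)
        (Projectivization.mk ℂ v hv, Projectivization.mk ℂ w hw) *
        ev v w (F.F (Projectivization.mk ℂ v hv, Projectivization.mk ℂ w hw)) /
        ev v w (F'.F (Projectivization.mk ℂ v hv, Projectivization.mk ℂ w hw)) := by
    intro v w hv hw
    simp only [s, dif_pos hv, dif_pos hw]
  have key : IsUnitSection s ((d.1 : ℤ) - e.1) ((d.2 : ℤ) - e.2) := by
    refine ⟨fun a b ha hb v w hv hw => ?_, fun v w hv hw => ?_⟩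
    · have h1 : Projectivization.mk ℂ (a • v) (smul_ne_zero ha hv) = Projectivization.mk ℂ v hv :=
        (Projectivization.mk_eq_mk_iff' ℂ _ _ _ _).2 ⟨a, rfl⟩
      have h2 : Projectivization.mk ℂ (b • w) (smul_ne_zero hb hw) = Projectivization.mk ℂ w hw :=
        (Projectivization.mk_eq_mk_iff' ℂ _ _ _ _).2 ⟨b, rfl⟩
      rw [hs_eq _ _ (smul_ne_zero ha hv) (smul_ne_zero hb hw), hs_eq v w hv hw, h1, h2,
        (F.bihom _).ev_smul, (F'.bihom _).ev_smul, zpow_sub₀ ha, zpow_sub₀ hb]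
      simp only [zpow_natCast]
      have := pow_ne_zero e.1 ha
      have := pow_ne_zero e.2 hb
      have h3 := F'.ne_zero (Projectivization.mk ℂ v hv, Projectivization.mk ℂ w hw)
      rw [Ne, (F'.bihom _).evalAt_mk] at h3
      field_simp
    · set p : S := (Projectivization.mk ℂ v hv, Projectivization.mk ℂ w hw) with hp
      obtain ⟨V, hV, hpV, hVW, c, P, Q, hP, hQ, hPQ⟩ := (hu p).1 p (hm p)
      obtain ⟨A, a, hA, hA0, hAV⟩ := hV.exists_bihomogeneous hpV
      have hP0 : evalAt p P ≠ 0 := fun h0 => (hu p).2 p (hm p) (by rw [(hPQ p hpV).2, h0, zero_div])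
      refine ⟨P * F.F p, Q * F'.F p, A, ?_, ?_, ?_, fun v' w' hv' hw' hA' => ?_⟩
      · rw [map_mul]
        exact mul_ne_zero (fun h0 => hP0 ((hP.evalAt_mk hv hw).2 h0))
          fun h0 => F.ne_zero p (((F.bihom p).evalAt_mk hv hw).2 h0)
      · rw [map_mul]
        exact mul_ne_zero (fun h0 => (hPQ p hpV).1 ((hQ.evalAt_mk hv hw).2 h0))
          fun h0 => F'.ne_zero p (((F'.bihom p).evalAt_mk hv hw).2 h0)
      · exact fun h0 => hA0 ((hA.evalAt_mk hv hw).2 h0)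
      · set q : S := (Projectivization.mk ℂ v' hv', Projectivization.mk ℂ w' hw') with hq
        have hqV : q ∈ V := hAV q fun h0 => hA' ((hA.evalAt_mk hv' hw').1 h0)
        obtain ⟨h1, h2⟩ := hPQ q hqV
        have h3 := hglue p q q (hVW hqV) (hm q)
        have h4 : evalAt q (F'.F p) ≠ 0 := (hs p (hVW hqV)).2
        have h5 := F'.ne_zero q
        obtain ⟨a, ha, hav⟩ : ∃ a : ℂ, a ≠ 0 ∧ q.1.rep = a • v' := exists_rep_mk hv'
        obtain ⟨b, hb, hbw⟩ : ∃ b : ℂ, b ≠ 0 ∧ q.2.rep = b • w' := exists_rep_mk hw'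
        rw [hs_eq v' w' hv' hw', map_mul, map_mul, ← hq]
        simp only [evalAt_eq_ev, hav, hbw] at h1 h3 h4 h5
        rw [hQ.ev_smul] at h1
        rw [(F.bihom _).ev_smul, (F'.bihom _).ev_smul, (F.bihom _).ev_smul,
          (F'.bihom _).ev_smul] at h3
        rw [(F'.bihom _).ev_smul] at h4 h5
        replace h2 := h2.trans (hP.evalAt_div_mk hQ hv' hw')
        rw [h2] at h3
        have h6 := right_ne_zero_of_mul h1
        have h7 := right_ne_zero_of_mul h4
        have h8 := right_ne_zero_of_mul h5
        have := pow_ne_zero e.1 ha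
        have := pow_ne_zero e.2 hb
        have := pow_ne_zero d.1 ha
        have := pow_ne_zero d.2 hb
        field_simp at h3 ⊢
        linear_combination h3
  have h1 := key.degree_fst_eq_zero
  have h2 := key.degree_snd_eq_zero
  ext <;> omega

end FormFamily

/-! ### Classes of 𝒪(a, b) and the invariant Picard number -/

/-- The class of `𝒪(d)` in the Picard group. -/
noncomputable def picClass {d : ℕ × ℕ} (F : FormFamily d) : Pic := Quotient.mk _ F.bundle

lemma picClass_eq {d : ℕ × ℕ} (F F' : FormFamily d) : picClass F = picClass F' :=
  Quotient.sound (F.iso_bundle F')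

lemma picClass_mul {d e : ℕ × ℕ} (F : FormFamily d) (F' : FormFamily e) :
    picClass (F.mul F') = picClass F * picClass F' :=
  Quotient.sound (F.iso_mul F')

lemma degree_eq_of_picClass_eq {d e : ℕ × ℕ} {F : FormFamily d} {F' : FormFamily e}
    (h : picClass F = picClass F') : d = e :=
  FormFamily.degree_eq_of_iso (Quotient.exact h)

lemma exists_picClass_eq (m n : ℕ) : ∃ F : FormFamily (m, n),
    picClass F = picClass FormFamily.fst ^ m * picClass FormFamily.snd ^ n := by
  induction m with
  | zero =>
    induction n with
    | zero =>
      refine ⟨FormFamily.one, ?_⟩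
      rw [pow_zero, pow_zero, one_mul]
      exact Quotient.sound (LineBundle.iso_of_eqOn _ _ fun p q x _ => by
        simp [LineBundle.trivial, FormFamily.bundle, FormFamily.one])
    | succ n ih =>
      obtain ⟨F, hF⟩ := ih
      exact ⟨F.mul FormFamily.snd, by rw [picClass_mul, hF, pow_succ, mul_assoc]⟩
  | succ m ih =>
    obtain ⟨F, hF⟩ := ih
    exact ⟨F.mul FormFamily.fst, by rw [picClass_mul, hF, pow_succ, mul_right_comm]⟩

/-- Linear substitution in each factor turns a family of forms into another one of the same
bidegree, and the class depends only on the bidegree. -/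
lemma pullback_picClass {d : ℕ × ℕ} (F : FormFamily d) {φ : Aut} {α β : Equiv.Perm P1}
    (hα : α ∈ PGL) (hβ : β ∈ PGL) (h : ∀ p, φ.1 p = (α p.1, β p.2)) :
    Pic.pullback φ (picClass F) = picClass F := by
  obtain ⟨g, rfl⟩ := hα
  obtain ⟨g', rfl⟩ := hβ
  rw [picClass_eq F (F.pullback g g')]
  exact Quotient.sound ((F.iso_bundle _).symm.pullback φ.2.1 |>.trans
    (F.iso_pullback g g' φ.2.1 (funext h)))

/-- If the invariant Picard number is `1`, some element exchanges the two rulings. -/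
theorem exists_swap_of_rho_eq_one {G : Subgroup Aut} (hG : rho G = 1) :
    ∃ φ ∈ G, ∃ α ∈ PGL, ∃ β ∈ PGL, ∀ p, φ.1 p = (α p.2, β p.1) := by
  by_contra hcon
  have hprod : ∀ φ ∈ G, ∃ α ∈ PGL, ∃ β ∈ PGL, ∀ p, φ.1 p = (α p.1, β p.2) := fun φ hφ =>
    (Aut.exists_PGL φ).resolve_right fun h => hcon ⟨φ, hφ, h⟩
  have hinv : ∀ {d} (F : FormFamily d), picClass F ∈ invariantPic G := by
    intro d F φ hφ
    obtain ⟨α, hα, β, hβ, h⟩ := hprod φ hφ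
    exact pullback_picClass F hα hβ h
  have hli : LinearIndependent ℤ ![Additive.ofMul (⟨_, hinv FormFamily.fst⟩ : invariantPic G),
      Additive.ofMul (⟨_, hinv FormFamily.snd⟩ : invariantPic G)] := by
    rw [LinearIndependent.pair_iff]
    intro a b hab
    have h1 : picClass FormFamily.fst ^ a * picClass FormFamily.snd ^ b = 1 :=
      congrArg (fun x => ((Additive.toMul x : invariantPic G) : Pic)) hab
    -- Families of forms have bidegrees in ℕ × ℕ, so an integral relation is split into its positive
    -- and negative parts.
    obtain ⟨F, hF⟩ := exists_picClass_eq a.toNat b.toNat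
    obtain ⟨F', hF'⟩ := exists_picClass_eq (-a).toNat (-b).toNat
    have h2 : picClass F = picClass F' := by
      rw [← mul_inv_eq_one, hF, hF', ← h1, mul_inv, mul_mul_mul_comm, ← zpow_natCast,
        ← zpow_natCast, ← zpow_natCast, ← zpow_natCast, ← zpow_neg, ← zpow_neg, ← zpow_add,
        ← zpow_add]
      congr 2 <;> omega
    have h3 := degree_eq_of_picClass_eq h2
    rw [Prod.mk.injEq] at h3
    omega
  have h2 := hli.cardinal_le_rank
  have h3 : Module.rank ℤ (Additive (invariantPic G)) = 1 := hG
  rw [h3] at h2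
  simp at h2

end P1xP1


namespace P1xP1

/-! ### Projective transformations of the line -/

/-- The point at infinity of the projective line. -/
noncomputable def ptInf : P1 :=
  Projectivization.mk ℂ ![1, 0] fun h => by simpa using congrFun h 0

/-- The finite points of the projective line. -/
noncomputable def pt (x : ℂ) : P1 :=
  Projectivization.mk ℂ ![x, 1] fun h => by simpa using congrFun h 1

lemma mk_eq_pt {v : Fin 2 → ℂ} (hv : v ≠ 0) (h : v 1 ≠ 0) :
    Projectivization.mk ℂ v hv = pt (v 0 / v 1) := by
  refine (Projectivization.mk_eq_mk_iff' ℂ _ _ _ _).2 ⟨v 1, ?_⟩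
  ext i; fin_cases i <;> simp [h, mul_div_cancel₀]

lemma mk_eq_ptInf {v : Fin 2 → ℂ} (hv : v ≠ 0) (h : v 1 = 0) :
    Projectivization.mk ℂ v hv = ptInf := by
  refine (Projectivization.mk_eq_mk_iff' ℂ _ _ _ _).2 ⟨v 0, ?_⟩
  ext i; fin_cases i <;> simp [h]

lemma eq_ptInf_or_pt (p : P1) : p = ptInf ∨ ∃ x, p = pt x := by
  rw [← p.mk_rep]
  by_cases h : p.rep 1 = 0
  · exact Or.inl (mk_eq_ptInf _ h)
  · exact Or.inr ⟨_, mk_eq_pt _ h⟩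

lemma ptInf_ne_pt (x : ℂ) : ptInf ≠ pt x := by
  intro h
  obtain ⟨a, ha⟩ := (Projectivization.mk_eq_mk_iff' ℂ _ _ _ _).1 h
  have h0 := congrFun ha 0
  have h1 := congrFun ha 1
  simp at h0 h1
  simp [h1] at h0

lemma pt_injective : Function.Injective pt := by
  intro x y h
  obtain ⟨a, ha⟩ := (Projectivization.mk_eq_mk_iff' ℂ _ _ _ _).1 h
  have h0 := congrFun ha 0
  have h1 := congrFun ha 1
  simp at h0 h1
  simpa [h1] using h0.symm

namespace PGL

lemma exists_matrix {α : Equiv.Perm P1} (hα : α ∈ PGL) :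
    ∃ M : Matrix (Fin 2) (Fin 2) ℂ, M.det ≠ 0 ∧ ∀ (v : Fin 2 → ℂ) (hv : v ≠ 0),
      ∃ h, α (Projectivization.mk ℂ v hv) = Projectivization.mk ℂ (M.mulVec v) h := by
  obtain ⟨g, rfl⟩ := hα
  exact ⟨g.1, (Matrix.isUnits_det_units g).ne_zero, fun v hv => ⟨_, rfl⟩⟩

lemma affine {α : Equiv.Perm P1} (hα : α ∈ PGL) (h : α ptInf = ptInf) :
    ∃ c t : ℂ, c ≠ 0 ∧ ∀ x, α (pt x) = pt (c * x + t) := by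
  obtain ⟨M, hdet, hM⟩ := exists_matrix hα
  obtain ⟨h0, h1⟩ := hM ![1, 0] (fun h => by simpa using congrFun h 0)
  have h2 : M 1 0 = 0 := by
    by_contra h2
    have h3 := h1.trans (mk_eq_pt h0 (by simpa [Matrix.mulVec, dotProduct] using h2))
    exact ptInf_ne_pt _ (h.symm.trans h3)
  rw [Matrix.det_fin_two, h2, mul_zero, sub_zero] at hdet
  have h00 := left_ne_zero_of_mul hdet
  have h11 := right_ne_zero_of_mul hdet
  refine ⟨M 0 0 / M 1 1, M 0 1 / M 1 1, div_ne_zero h00 h11, fun x => ?_⟩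
  obtain ⟨h3, h4⟩ := hM ![x, 1] (fun h => by simpa using congrFun h 1)
  rw [pt, h4, mk_eq_pt _ (by simpa [Matrix.mulVec, dotProduct, h2] using h11)]
  congr 1
  simp [Matrix.mulVec, dotProduct, h2]
  ring

lemma inversion {α : Equiv.Perm P1} (hα : α ∈ PGL) (h : α ptInf = pt 0) (h' : α (pt 0) = ptInf) :
    ∃ k : ℂ, k ≠ 0 ∧ ∀ x, x ≠ 0 → α (pt x) = pt (k / x) := by
  obtain ⟨M, hdet, hM⟩ := exists_matrix hα
  obtain ⟨h0, h1⟩ := hM ![1, 0] (fun h => by simpa using congrFun h 0)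
  obtain ⟨h0', h1'⟩ := hM ![0, 1] (fun h => by simpa using congrFun h 1)
  have h11 : M 1 1 = 0 := by
    by_contra h2
    have h3 := h1'.trans (mk_eq_pt h0' (by simpa [Matrix.mulVec, dotProduct] using h2))
    exact ptInf_ne_pt _ (h'.symm.trans h3)
  rw [Matrix.det_fin_two, h11, mul_zero, zero_sub, neg_ne_zero] at hdet
  have h01 := left_ne_zero_of_mul hdet
  have h10 := right_ne_zero_of_mul hdet
  have h00 : M 0 0 = 0 := by
    have h3 := h1.trans (mk_eq_pt h0 (by simpa [Matrix.mulVec, dotProduct] using h10))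
    have h4 := pt_injective (h.symm.trans h3)
    simpa [Matrix.mulVec, dotProduct, h10] using h4.symm
  refine ⟨M 0 1 / M 1 0, div_ne_zero h01 h10, fun x hx => ?_⟩
  obtain ⟨h3, h4⟩ := hM ![x, 1] (fun h => by simpa using congrFun h 1)
  rw [pt, h4, mk_eq_pt _ (by simpa [Matrix.mulVec, dotProduct, h11, h10] using hx)]
  congr 1
  simp [Matrix.mulVec, dotProduct, h11, h00]
  field_simp

lemma eq_of_affine {α β : Equiv.Perm P1} (h : α ptInf = β ptInf)
    (h' : ∀ x, α (pt x) = β (pt x)) : α = β := by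
  ext p
  rcases eq_ptInf_or_pt p with rfl | ⟨x, rfl⟩
  exacts [h, h' x]

/-- The matrix whose columns represent a and b sends ∞ to a and 0 to b; γ is its inverse.
Conjugation by γ reduces the statements below to the points ∞ and 0. -/
lemma exists_move {a b : P1} (hab : a ≠ b) : ∃ γ ∈ PGL, γ a = ptInf ∧ γ b = pt 0 := by
  have hinv : ∀ v, v ≠ 0 → Matrix.mulVec (Matrix.of ![a.rep, b.rep]).transpose v ≠ 0 := by
    intro v hv h
    have h2 : v 0 • a.rep + v 1 • b.rep = 0 := by
      ext i
      have := congrFun h i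
      simp [Matrix.mulVec, dotProduct] at this
      simp
      linear_combination this
    have h3 := Projectivization.linearIndependent_pair_iff_ne.2 hab
    have := LinearIndependent.pair_iff.1 h3 _ _ h2
    exact hv (by ext i; fin_cases i; exacts [this.1, this.2])
  obtain ⟨γ, hγ, h⟩ := exists_mem_PGL_of_matrix _ hinv
  refine ⟨γ⁻¹, inv_mem hγ, ?_, ?_⟩
  · rw [Equiv.Perm.inv_eq_iff_eq, ptInf, h]
    conv_lhs => rw [← a.mk_rep]
    congr 1
    ext i
    simp [Matrix.mulVec, dotProduct]
  · rw [Equiv.Perm.inv_eq_iff_eq, pt, h]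
    conv_lhs => rw [← b.mk_rep]
    congr 1
    ext i
    simp [Matrix.mulVec, dotProduct]

lemma conj_mem {α γ : Equiv.Perm P1} (hα : α ∈ PGL) (hγ : γ ∈ PGL) : γ * α * γ⁻¹ ∈ PGL :=
  mul_mem (mul_mem hγ hα) (inv_mem hγ)

lemma conj_apply_of_eq {X : Type*} {α γ : Equiv.Perm X} {a b c d : X} (ha : γ a = c) (hb : γ b = d)
    (h : α a = b) : (γ * α * γ⁻¹) c = d := by
  simp [← ha, ← hb, h]

/-- A projective transformation fixing two points is a scaling, up to conjugation. -/
lemma scaling {α : Equiv.Perm P1} (hα : α ∈ PGL) (h : α ptInf = ptInf) (h0 : α (pt 0) = pt 0) :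
    ∃ c : ℂ, c ≠ 0 ∧ ∀ x, α (pt x) = pt (c * x) := by
  obtain ⟨c, t, hc, h'⟩ := affine hα h
  rw [h'] at h0
  have := pt_injective h0
  simp at this
  exact ⟨c, hc, fun x => by rw [h', this, add_zero]⟩

/-- With two of the points at ∞ and 0 the map is a scaling, and the third point, finite and nonzero,
forces the factor 1. -/
lemma eq_one_of_three {α : Equiv.Perm P1} (hα : α ∈ PGL) {a b c : P1} (hab : a ≠ b) (hca : c ≠ a)
    (hcb : c ≠ b) (ha : α a = a) (hb : α b = b) (hc : α c = c) : α = 1 := by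
  obtain ⟨γ, hγ, hγa, hγb⟩ := exists_move hab
  have h1 := conj_apply_of_eq hγa hγa ha
  have h2 := conj_apply_of_eq hγb hγb hb
  have h3 := conj_apply_of_eq rfl rfl hc (γ := γ)
  obtain ⟨k, hk, h4⟩ := scaling (conj_mem hα hγ) h1 h2
  have h5 : γ c ≠ ptInf := fun h => hca (γ.injective (h.trans hγa.symm))
  have h6 : γ c ≠ pt 0 := fun h => hcb (γ.injective (h.trans hγb.symm))
  obtain ⟨x, hx⟩ := (eq_ptInf_or_pt (γ c)).resolve_left h5
  have hx0 : x ≠ 0 := by rintro rfl; exact h6 hx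
  rw [hx, h4] at h3
  have h7 : k = 1 := by simpa [hx0] using pt_injective h3
  have h8 : γ * α * γ⁻¹ = 1 :=
    eq_of_affine h1 fun x => by rw [h4, h7, one_mul]; rfl
  rwa [mul_inv_eq_one, mul_eq_left] at h8

/-- The n-th power moves 0 to n t, which vanishes for some n > 0 only if t = 0, in characteristic
zero. -/
lemma eq_one_of_translation {α : Equiv.Perm P1} (h : α ptInf = ptInf) (hfin : IsOfFinOrder α)
    {t : ℂ} (ht : ∀ x, α (pt x) = pt (x + t)) : α = 1 := by
  have hpow : ∀ n : ℕ, (α ^ n) (pt 0) = pt (n * t) := by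
    intro n
    induction n with
    | zero => simp
    | succ n ih => rw [pow_succ', Equiv.Perm.mul_apply, ih, ht]; congr 1; push_cast; ring
  obtain ⟨n, hn, h1⟩ := isOfFinOrder_iff_pow_eq_one.1 hfin
  have h2 := hpow n
  rw [h1] at h2
  have h3 := pt_injective h2.symm
  have h4 : t = 0 := (mul_eq_zero.1 h3).resolve_left (by exact_mod_cast hn.ne')
  exact eq_of_affine h fun x => by rw [ht, h4, add_zero]; rfl

lemma isOfFinOrder_conj {G : Type*} [Group G] {a : G} (h : IsOfFinOrder a) (g : G) :
    IsOfFinOrder (g * a * g⁻¹) := by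
  simpa using (MulAut.conj g).toMonoidHom.isOfFinOrder h

lemma exists_fixed {α : Equiv.Perm P1} (hα : α ∈ PGL) : ∃ a, α a = a := by
  obtain ⟨M, -, hM⟩ := exists_matrix hα
  obtain ⟨μ, hμ⟩ := Module.End.exists_eigenvalue (Matrix.toLin' M)
  obtain ⟨v, hv⟩ := hμ.exists_hasEigenvector
  obtain ⟨h1, h2⟩ := hM v hv.2
  refine ⟨Projectivization.mk ℂ v hv.2, ?_⟩
  rw [h2, Projectivization.mk_eq_mk_iff']
  exact ⟨μ, by rw [← hv.apply_eq_smul, Matrix.toLin'_apply]⟩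

lemma exists_ne (a : P1) : ∃ b : P1, b ≠ a := by
  rcases eq_ptInf_or_pt a with rfl | ⟨x, rfl⟩
  exacts [⟨pt 0, (ptInf_ne_pt 0).symm⟩, ⟨ptInf, ptInf_ne_pt x⟩]

/-- A projective transformation of finite order has a second fixed point. -/
lemma exists_second_fixed {α : Equiv.Perm P1} (hα : α ∈ PGL) (hfin : IsOfFinOrder α) {a : P1}
    (ha : α a = a) : ∃ b, b ≠ a ∧ α b = b := by
  obtain ⟨b₀, hb₀⟩ := exists_ne a
  obtain ⟨γ, hγ, hγa, -⟩ := exists_move hb₀.symm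
  have h1 := conj_apply_of_eq hγa hγa ha
  obtain ⟨c, t, hc, h⟩ := affine (conj_mem hα hγ) h1
  by_cases hc1 : c = 1
  · subst hc1
    have := eq_one_of_translation h1 (isOfFinOrder_conj hfin γ) (t := t)
      fun x => by rw [h, one_mul]
    rw [mul_inv_eq_one, mul_eq_left] at this
    exact ⟨b₀, hb₀, by rw [this]; rfl⟩
  -- The solution of c x + t = x, carried back by γ.
  · refine ⟨γ⁻¹ (pt (t / (1 - c))), fun h2 => ?_, ?_⟩
    · rw [Equiv.Perm.inv_eq_iff_eq, hγa] at h2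
      exact ptInf_ne_pt _ h2.symm
    · have h2 := h (t / (1 - c))
      have h3 : 1 - c ≠ 0 := sub_ne_zero.2 (Ne.symm hc1)
      rw [show c * (t / (1 - c)) + t = t / (1 - c) by field_simp; ring] at h2
      rw [Equiv.Perm.eq_inv_iff_eq]
      simpa using h2

/-- With the common fixed point at ∞ both maps are affine and their commutator is a translation,
which is trivial when of finite order. -/
lemma commute_of_fixed {α β : Equiv.Perm P1} (hα : α ∈ PGL) (hβ : β ∈ PGL) {a : P1} (ha : α a = a)
    (hb : β a = a) (hfin : IsOfFinOrder (α * β * (β * α)⁻¹)) : α * β = β * α := by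
  obtain ⟨b₀, hb₀⟩ := exists_ne a
  obtain ⟨γ, hγ, hγa, -⟩ := exists_move hb₀.symm
  have h1 := conj_apply_of_eq hγa hγa ha
  have h2 := conj_apply_of_eq hγa hγa hb
  obtain ⟨c, t, hc, h⟩ := affine (conj_mem hα hγ) h1
  obtain ⟨c', t', hc', h'⟩ := affine (conj_mem hβ hγ) h2
  have key := isOfFinOrder_conj hfin γ
  rw [show γ * (α * β * (β * α)⁻¹) * γ⁻¹ = (γ * α * γ⁻¹) * (γ * β * γ⁻¹) *
    ((γ * β * γ⁻¹) * (γ * α * γ⁻¹))⁻¹ by group] at key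
  set A := γ * α * γ⁻¹
  set B := γ * β * γ⁻¹
  have h3 : A * B * (B * A)⁻¹ = 1 := by
    refine eq_one_of_translation (t := c * t' + t - (c' * t + t')) ?_ key fun x => ?_
    · have : (B * A)⁻¹ ptInf = ptInf := by
        rw [Equiv.Perm.inv_eq_iff_eq, Equiv.Perm.mul_apply, h1, h2]
      rw [Equiv.Perm.mul_apply, this, Equiv.Perm.mul_apply, h2, h1]
    · have : (B * A)⁻¹ (pt x) = pt ((x - (c' * t + t')) / (c' * c)) := by
        rw [Equiv.Perm.inv_eq_iff_eq, Equiv.Perm.mul_apply, h, h']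
        congr 1
        field_simp
        ring
      rw [Equiv.Perm.mul_apply, this, Equiv.Perm.mul_apply, h', h]
      congr 1
      field_simp
      ring
  have h4 : γ * (α * β) * γ⁻¹ = γ * (β * α) * γ⁻¹ := by
    rw [mul_inv_eq_one] at h3
    simpa [A, B, mul_assoc] using h3
  simpa using h4

/-- With the fixed points at ∞ and 0, the only nontrivial scaling with trivial square is x ↦ -x. -/
lemma involution_unique {α β : Equiv.Perm P1} (hα : α ∈ PGL) (hβ : β ∈ PGL) (hα2 : α * α = 1)
    (hβ2 : β * β = 1) (hα1 : α ≠ 1) (hβ1 : β ≠ 1) {a b : P1} (hab : a ≠ b) (h1 : α a = a)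
    (h2 : α b = b) (h3 : β a = a) (h4 : β b = b) : α = β := by
  obtain ⟨γ, hγ, hγa, hγb⟩ := exists_move hab
  have key : ∀ δ ∈ PGL, δ * δ = 1 → δ ≠ 1 → δ a = a → δ b = b →
      (γ * δ * γ⁻¹) ptInf = ptInf ∧ ∀ x, (γ * δ * γ⁻¹) (pt x) = pt (-x) := by
    intro δ hδ hδ2 hδ1 ha hb
    have h1 := conj_apply_of_eq hγa hγa ha
    obtain ⟨c, hc, h⟩ := scaling (conj_mem hδ hγ) h1 (conj_apply_of_eq hγb hγb hb)
    refine ⟨h1, ?_⟩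
    have h5 : (γ * δ * γ⁻¹) * (γ * δ * γ⁻¹) = 1 := by
      rw [show (γ * δ * γ⁻¹) * (γ * δ * γ⁻¹) = γ * (δ * δ) * γ⁻¹ by group, hδ2]; simp
    have h6 := congrArg (fun f => f (pt 1)) h5
    simp only [Equiv.Perm.mul_apply (γ * δ * γ⁻¹)] at h6
    rw [h, h] at h6
    have h7 : c * c = 1 := by simpa using pt_injective h6
    rcases mul_self_eq_one_iff.1 h7 with rfl | rfl
    · exfalso
      apply hδ1
      have : γ * δ * γ⁻¹ = 1 := eq_of_affine h1 fun x => by rw [h, one_mul]; rfl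
      rwa [mul_inv_eq_one, mul_eq_left] at this
    · exact fun x => by rw [h]; congr 1; ring
  have hA := key α hα hα2 hα1 h1 h2
  have hB := key β hβ hβ2 hβ1 h3 h4
  have : γ * α * γ⁻¹ = γ * β * γ⁻¹ :=
    eq_of_affine (hA.1.trans hB.1.symm) fun x => (hA.2 x).trans (hB.2 x).symm
  simpa using this

lemma conj_eq_inv_of_standard {α ω : Equiv.Perm P1} (hα : α ∈ PGL) (hω : ω ∈ PGL)
    (h1 : α ptInf = ptInf) (h2 : α (pt 0) = pt 0) (h3 : ω ptInf = pt 0) (h4 : ω (pt 0) = ptInf) :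
    α * ω * α = ω := by
  obtain ⟨c, hc, h⟩ := scaling hα h1 h2
  obtain ⟨k, hk, h'⟩ := inversion hω h3 h4
  refine eq_of_affine (by simp [h1, h2, h3]) fun x => ?_
  by_cases hx : x = 0
  · subst hx; simp [h1, h2, h4]
  · rw [Equiv.Perm.mul_apply, Equiv.Perm.mul_apply, h, h' _ (mul_ne_zero hc hx), h, h' x hx]
    congr 1
    field_simp

/-- A transformation exchanging two points inverts the transformations fixing both of them. -/
lemma conj_eq_inv {α ω : Equiv.Perm P1} (hα : α ∈ PGL) (hω : ω ∈ PGL) {a b : P1} (hab : a ≠ b)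
    (h1 : α a = a) (h2 : α b = b) (h3 : ω a = b) (h4 : ω b = a) : α * ω * α = ω := by
  obtain ⟨γ, hγ, hγa, hγb⟩ := exists_move hab
  have := conj_eq_inv_of_standard (conj_mem hα hγ) (conj_mem hω hγ)
    (conj_apply_of_eq hγa hγa h1) (conj_apply_of_eq hγb hγb h2)
    (conj_apply_of_eq hγa hγb h3) (conj_apply_of_eq hγb hγa h4)
  rw [show γ * α * γ⁻¹ * (γ * ω * γ⁻¹) * (γ * α * γ⁻¹) = γ * (α * ω * α) * γ⁻¹ by group] at this
  simpa using this

end PGL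

end P1xP1


namespace P1xP1

/-! ### Finite groups of projective transformations -/

/-- A faithful action of a group on `ℙ¹` by projective transformations. -/
structure MoebiusAction (H : Type*) [Group H] where
  ρ : H →* Equiv.Perm P1
  injective : Function.Injective ρ
  mem : ∀ h, ρ h ∈ PGL

namespace MoebiusAction

variable {H : Type*} [Group H] (m : MoebiusAction H)

/-- The restriction to a subgroup. -/
def restrict (K : Subgroup H) : MoebiusAction K where
  ρ := m.ρ.comp K.subtype
  injective := m.injective.comp K.subtype_injective
  mem k := m.mem k

/-- There is an invariant pair of points. -/
def IsDihedral : Prop :=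
  ∃ a b, a ≠ b ∧ ∀ h, (m.ρ h a = a ∧ m.ρ h b = b) ∨ (m.ρ h a = b ∧ m.ρ h b = a)

lemma mul_apply (g h : H) (x : P1) : m.ρ (g * h) x = m.ρ g (m.ρ h x) := by
  rw [map_mul, Equiv.Perm.mul_apply]

lemma inv_apply_eq {g : H} {x y : P1} : m.ρ g⁻¹ x = y ↔ x = m.ρ g y := by
  rw [map_inv, Equiv.Perm.inv_eq_iff_eq]

lemma map_eq_one {g : H} : m.ρ g = 1 ↔ g = 1 := by
  rw [← map_one m.ρ, m.injective.eq_iff]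

lemma eq_one_of_three {g : H} {a b c : P1} (hab : a ≠ b) (hca : c ≠ a) (hcb : c ≠ b)
    (ha : m.ρ g a = a) (hb : m.ρ g b = b) (hc : m.ρ g c = c) : g = 1 :=
  m.map_eq_one.1 (PGL.eq_one_of_three (m.mem g) hab hca hcb ha hb hc)

lemma mul_mul_eq_of_swap {g w : H} {a b : P1} (hab : a ≠ b) (h1 : m.ρ g a = a) (h2 : m.ρ g b = b)
    (h3 : m.ρ w a = b) (h4 : m.ρ w b = a) : g * w * g = w :=
  m.injective (by simpa using PGL.conj_eq_inv (m.mem g) (m.mem w) hab h1 h2 h3 h4)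

/-- The points with nontrivial stabilizer. -/
def Special : Type := {x : P1 // ∃ h, h ≠ 1 ∧ m.ρ h x = x}

instance : MulAction H m.Special where
  smul h x := ⟨m.ρ h x.1, by
    obtain ⟨g, hg, hgx⟩ := x.2
    refine ⟨h * g * h⁻¹, by simpa using hg, ?_⟩
    rw [m.mul_apply, m.mul_apply, m.inv_apply_eq.2 rfl, hgx]⟩
  one_smul x := Subtype.ext (by change m.ρ 1 x.1 = x.1; rw [map_one]; rfl)
  mul_smul g h x := Subtype.ext (m.mul_apply g h x.1)

lemma smul_eq_iff (h : H) (x : m.Special) : h • x = x ↔ m.ρ h x.1 = x.1 := Subtype.ext_iff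

section Finite

variable [Finite H]

lemma isOfFinOrder (h : H) : IsOfFinOrder (m.ρ h) := m.ρ.isOfFinOrder (isOfFinOrder_of_finite h)

lemma exists_fixed_iff {h : H} (hh : h ≠ 1) : ∃ a b, a ≠ b ∧ ∀ x, m.ρ h x = x ↔ x = a ∨ x = b := by
  obtain ⟨a, ha⟩ := PGL.exists_fixed (m.mem h)
  obtain ⟨b, hab, hb⟩ := PGL.exists_second_fixed (m.mem h) (m.isOfFinOrder h) ha
  refine ⟨a, b, hab.symm, fun x => ⟨fun hx => ?_, ?_⟩⟩
  · by_contra hcon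
    rw [not_or] at hcon
    exact hh (m.eq_one_of_three hab.symm hcon.1 hcon.2 ha hb hx)
  · rintro (rfl | rfl)
    exacts [ha, hb]

/-- The stabilizer of a point fixes a second point. -/
lemma exists_common_fixed (a : P1) : ∃ b, b ≠ a ∧ ∀ h, m.ρ h a = a → m.ρ h b = b := by
  by_cases hex : ∃ g, g ≠ 1 ∧ m.ρ g a = a
  · obtain ⟨g, hg, hga⟩ := hex
    obtain ⟨b, hb, hgb⟩ := PGL.exists_second_fixed (m.mem g) (m.isOfFinOrder g) hga
    refine ⟨b, hb, fun h hh => ?_⟩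
    -- The stabilizer of a is commutative, so h permutes the fixed points a, b of g; fixing a, it
    -- must fix b.
    have hcomm : h * g = g * h := m.injective (by
      rw [map_mul, map_mul]
      refine PGL.commute_of_fixed (m.mem h) (m.mem g) hh hga ?_
      rw [← map_mul, ← map_mul, ← map_inv, ← map_mul]
      exact m.isOfFinOrder _)
    have h1 : m.ρ g (m.ρ h b) = m.ρ h b := by
      rw [← m.mul_apply, ← hcomm, m.mul_apply, hgb]
    by_contra h2
    refine hg (m.eq_one_of_three hb.symm (fun h3 => hb ?_) h2 hga hgb h1)
    exact (m.ρ h).injective (h3.trans hh.symm)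
  · obtain ⟨b, hb⟩ := PGL.exists_ne a
    refine ⟨b, hb, fun h hh => ?_⟩
    have : h = 1 := by
      by_contra h1
      exact hex ⟨h, h1, hh⟩
    rw [this, map_one]; rfl

lemma involution_unique {v w : H} (hv : v * v = 1) (hw : w * w = 1) (hv1 : v ≠ 1) (hw1 : w ≠ 1)
    {a : P1} (ha : m.ρ v a = a) (hb : m.ρ w a = a) : v = w := by
  obtain ⟨b, hab, h⟩ := m.exists_common_fixed a
  refine m.injective (PGL.involution_unique (m.mem v) (m.mem w) ?_ ?_ ?_ ?_ hab.symm ha (h v ha)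
    hb (h w hb))
  · rw [← map_mul, hv, map_one]
  · rw [← map_mul, hw, map_one]
  · rwa [Ne, m.map_eq_one]
  · rwa [Ne, m.map_eq_one]

/-! ### Counting orbits -/

instance : Finite m.Special := by
  have : {x : P1 | ∃ h, h ≠ 1 ∧ m.ρ h x = x} = ⋃ h : {h : H // h ≠ 1}, {x | m.ρ h.1 x = x} := by
    ext x; simp
  refine Set.Finite.to_subtype (s := {x : P1 | ∃ h, h ≠ 1 ∧ m.ρ h x = x}) ?_
  rw [this]
  refine Set.finite_iUnion fun h => ?_
  obtain ⟨a, b, -, hab⟩ := m.exists_fixed_iff h.2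
  exact (Set.toFinite {a, b}).subset fun x hx => (hab x).1 hx

lemma card_fixedBy {h : H} (hh : h ≠ 1) : Nat.card (MulAction.fixedBy m.Special h) = 2 := by
  obtain ⟨a, b, hab, hfix⟩ := m.exists_fixed_iff hh
  have ha := (hfix a).2 (Or.inl rfl)
  have hb := (hfix b).2 (Or.inr rfl)
  obtain ⟨A, rfl⟩ : ∃ A : m.Special, A.1 = a := ⟨⟨a, h, hh, ha⟩, rfl⟩
  obtain ⟨B, rfl⟩ : ∃ B : m.Special, B.1 = b := ⟨⟨b, h, hh, hb⟩, rfl⟩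
  have : MulAction.fixedBy m.Special h = {A, B} := by
    ext x
    rw [MulAction.mem_fixedBy, smul_eq_iff, hfix, Set.mem_insert_iff, Set.mem_singleton_iff]
    exact or_congr Subtype.ext_iff.symm Subtype.ext_iff.symm
  rw [this, Nat.card_coe_set_eq, Set.ncard_pair]
  exact fun h => hab (congrArg Subtype.val h)

/-- An orbit of two points is an invariant pair. A fixed point together with the second point fixed
by its stabilizer is one as well. -/
lemma three_le_card_orbit (hm : ¬ m.IsDihedral) (x : m.Special) :
    3 ≤ Nat.card (MulAction.orbit H x) := by
  by_contra hlt
  apply hm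
  by_cases hfix : ∀ h, m.ρ h x.1 = x.1
  · obtain ⟨b, hb, h⟩ := m.exists_common_fixed x.1
    exact ⟨x.1, b, hb.symm, fun g => Or.inl ⟨hfix g, h g (hfix g)⟩⟩
  push Not at hfix
  obtain ⟨g, hg⟩ := hfix
  have hsub : {x, g • x} ⊆ MulAction.orbit H x := by
    rintro y (rfl | rfl)
    exacts [MulAction.mem_orbit_self _, MulAction.mem_orbit _ _]
  have hne : x ≠ g • x := fun h => hg ((m.smul_eq_iff g x).1 h.symm)
  have heq : {x, g • x} = MulAction.orbit H x := by
    refine Set.eq_of_subset_of_ncard_le hsub ?_ (Set.toFinite _)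
    rw [Set.ncard_pair hne, ← Nat.card_coe_set_eq]
    omega
  refine ⟨x.1, m.ρ g x.1, fun h => hg h.symm, fun h => ?_⟩
  have h1 : h • x ∈ ({x, g • x} : Set m.Special) := heq ▸ MulAction.mem_orbit _ _
  have h2 : h • g • x ∈ ({x, g • x} : Set m.Special) :=
    heq ▸ (mul_smul h g x ▸ MulAction.mem_orbit _ _)
  have hne' : h • x ≠ h • g • x := fun h' => hne (smul_left_cancel h h')
  have key : (h • x = x ∧ h • g • x = g • x) ∨ (h • x = g • x ∧ h • g • x = x) := by
    rcases h1 with h1 | h1 <;> rcases h2 with h2 | h2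
    · exact absurd (h1.trans h2.symm) hne'
    · exact Or.inl ⟨h1, h2⟩
    · exact Or.inr ⟨h1, h2⟩
    · exact absurd (h1.trans h2.symm) hne'
  exact key.imp (fun h => ⟨congrArg Subtype.val h.1, congrArg Subtype.val h.2⟩)
    fun h => ⟨congrArg Subtype.val h.1, congrArg Subtype.val h.2⟩

lemma exists_card_orbit_mul (x : m.Special) :
    ∃ n, 2 ≤ n ∧ Nat.card (MulAction.orbit H x) * n = Nat.card H := by
  refine ⟨Nat.card (MulAction.stabilizer H x), ?_, ?_⟩
  · obtain ⟨h, hh, hx⟩ := x.2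
    have : Nontrivial (MulAction.stabilizer H x) :=
      ⟨⟨⟨h, (m.smul_eq_iff h x).2 hx⟩, 1, fun h' => hh (congrArg Subtype.val h')⟩⟩
    exact Finite.one_lt_card
  · rw [← Nat.card_prod]
    exact Nat.card_congr (MulAction.orbitProdStabilizerEquivGroup H x)

/-- Burnside's orbit count: the identity fixes every special point and each other element fixes
exactly two. -/
lemma card_special_add : Nat.card m.Special + 2 * (Nat.card H - 1) =
    Nat.card (MulAction.orbitRel.Quotient H m.Special) * Nat.card H := by
  classical
  have := Fintype.ofFinite H
  have := Fintype.ofFinite m.Special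
  have := Fintype.ofFinite (MulAction.orbitRel.Quotient H m.Special)
  have h1 := MulAction.sum_card_fixedBy_eq_card_orbits_mul_card_group H m.Special
  rw [← Finset.add_sum_erase _ _ (Finset.mem_univ (1 : H))] at h1
  have h2 : ∀ h ∈ Finset.univ.erase (1 : H), Fintype.card (MulAction.fixedBy m.Special h) = 2 := by
    intro h hh
    rw [← Nat.card_eq_fintype_card]
    exact m.card_fixedBy (Finset.ne_of_mem_erase hh)
  rw [Finset.sum_congr rfl h2, Finset.sum_const, Finset.card_erase_of_mem (Finset.mem_univ _),
    Finset.card_univ] at h1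
  have h3 : Fintype.card (MulAction.fixedBy m.Special (1 : H)) = Nat.card m.Special := by
    rw [← Nat.card_eq_fintype_card]
    simp
  rw [h3] at h1
  simp only [Nat.card_eq_fintype_card (α := H),
    Nat.card_eq_fintype_card (α := MulAction.orbitRel.Quotient H m.Special)]
  rw [smul_eq_mul, mul_comm _ 2] at h1
  exact h1

lemma card_special_eq_sum [Fintype (MulAction.orbitRel.Quotient H m.Special)] :
    Nat.card m.Special =
      ∑ ω : MulAction.orbitRel.Quotient H m.Special, Nat.card (MulAction.orbit H ω.out) := by
  rw [Nat.card_congr (MulAction.selfEquivSigmaOrbits H m.Special), Nat.card_sigma]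

end Finite

end MoebiusAction

/-- Dividing the sum by N gives 1/n₁ + 1/n₂ + 1/n₃ = 1 + 2/N, which exceeds 1. With o₃ ≥ 3 excluding
n₁ = n₂ = 2, only (2, 3, 3), (2, 3, 4) and (2, 3, 5) remain. -/
lemma card_of_orbits_sorted {N n₁ n₂ n₃ o₁ o₂ o₃ : ℕ} (h₁ : o₁ * n₁ = N) (h₂ : o₂ * n₂ = N)
    (h₃ : o₃ * n₃ = N) (hn : 2 ≤ n₁) (h12 : n₁ ≤ n₂) (h23 : n₂ ≤ n₃)
    (ho₃ : 3 ≤ o₃) (hsum : o₁ + o₂ + o₃ = N + 2) : N = 12 ∨ N = 24 ∨ N = 60 := by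
  have e1 : n₁ = 2 := by
    by_contra h
    have : o₁ * 3 ≤ N := h₁ ▸ Nat.mul_le_mul_left _ (by omega)
    have : o₂ * 3 ≤ N := h₂ ▸ Nat.mul_le_mul_left _ (by omega)
    have : o₃ * 3 ≤ N := h₃ ▸ Nat.mul_le_mul_left _ (by omega)
    omega
  subst e1
  have e2 : n₂ = 3 := by
    rcases Nat.lt_or_ge n₂ 4 with h | h
    · interval_cases n₂ <;> omega
    · have : o₂ * 4 ≤ N := h₂ ▸ Nat.mul_le_mul_left _ h
      have : o₃ * 4 ≤ N := h₃ ▸ Nat.mul_le_mul_left _ (by omega)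
      omega
  subst e2
  rcases Nat.lt_or_ge n₃ 6 with h | h
  · interval_cases n₃ <;> omega
  · have : o₃ * 6 ≤ N := h₃ ▸ Nat.mul_le_mul_left _ h
    omega

lemma card_of_orbits {N n₁ n₂ n₃ o₁ o₂ o₃ : ℕ} (h₁ : o₁ * n₁ = N) (h₂ : o₂ * n₂ = N)
    (h₃ : o₃ * n₃ = N) (hn₁ : 2 ≤ n₁) (hn₂ : 2 ≤ n₂) (hn₃ : 2 ≤ n₃) (ho₁ : 3 ≤ o₁) (ho₂ : 3 ≤ o₂)
    (ho₃ : 3 ≤ o₃) (hsum : o₁ + o₂ + o₃ = N + 2) : N = 12 ∨ N = 24 ∨ N = 60 := by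
  rcases le_total n₁ n₂ with h12 | h12 <;> rcases le_total n₂ n₃ with h23 | h23 <;>
    rcases le_total n₁ n₃ with h13 | h13
  · exact card_of_orbits_sorted h₁ h₂ h₃ hn₁ h12 h23 ho₃ hsum
  · exact card_of_orbits_sorted h₁ h₂ h₃ hn₁ h12 h23 ho₃ hsum
  · exact card_of_orbits_sorted h₁ h₃ h₂ hn₁ h13 h23 ho₂ (by omega)
  · exact card_of_orbits_sorted h₃ h₁ h₂ hn₃ h13 h12 ho₂ (by omega)
  · exact card_of_orbits_sorted h₂ h₁ h₃ hn₂ h12 h13 ho₃ (by omega)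
  · exact card_of_orbits_sorted h₂ h₃ h₁ hn₂ h23 h13 ho₁ (by omega)
  · exact card_of_orbits_sorted h₃ h₂ h₁ hn₃ h23 h12 ho₁ (by omega)
  · exact card_of_orbits_sorted h₃ h₂ h₁ hn₃ h23 h12 ho₁ (by omega)

namespace MoebiusAction

variable {H : Type*} [Group H] (m : MoebiusAction H)

/-- A finite group of projective transformations without an invariant pair of points has order
`12`, `24` or `60`. -/
theorem card_of_not_isDihedral [Finite H] (hm : ¬ m.IsDihedral) :
    Nat.card H = 12 ∨ Nat.card H = 24 ∨ Nat.card H = 60 := by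
  classical
  have := Fintype.ofFinite (MulAction.orbitRel.Quotient H m.Special)
  have h1 := m.card_special_add
  have h2 := m.card_special_eq_sum
  have hN : 2 ≤ Nat.card H := by
    by_contra hlt
    have : Subsingleton H := Finite.card_le_one_iff_subsingleton.1 (by omega)
    exact hm ⟨ptInf, pt 0, ptInf_ne_pt 0, fun h => by
      rw [Subsingleton.elim h 1, map_one]; exact Or.inl ⟨rfl, rfl⟩⟩
  have h3 : ∀ ω : MulAction.orbitRel.Quotient H m.Special,
      3 ≤ Nat.card (MulAction.orbit H ω.out) := fun ω => m.three_le_card_orbit hm _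
  choose n hn hn' using fun ω : MulAction.orbitRel.Quotient H m.Special =>
    m.exists_card_orbit_mul ω.out
  have h4 : ∀ ω : MulAction.orbitRel.Quotient H m.Special,
      2 * Nat.card (MulAction.orbit H ω.out) ≤ Nat.card H := fun ω => by
    rw [← hn' ω, mul_comm]; exact Nat.mul_le_mul_left _ (hn ω)
  have h5 := Finset.card_nsmul_le_sum Finset.univ _ 3 fun ω _ => h3 ω
  have h6 := Finset.sum_le_card_nsmul Finset.univ _ _ fun ω _ => h4 ω
  rw [← Finset.mul_sum, ← h2, smul_eq_mul, Finset.card_univ] at h6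
  rw [← h2, smul_eq_mul, Finset.card_univ] at h5
  rw [Nat.card_eq_fintype_card (α := MulAction.orbitRel.Quotient H m.Special)] at h1
  set r := Fintype.card (MulAction.orbitRel.Quotient H m.Special) with hr
  set N := Nat.card H
  -- With s special points, s + 2(N - 1) = r N, 3 r ≤ s and 2 s ≤ r N. The first bound excludes r ≤
  -- 2 and the second excludes r ≥ 4; then s = N + 2.
  have hr3 : r = 3 := by
    rcases Nat.lt_or_ge r 4 with h | h
    · interval_cases r <;> omega
    · have : 4 * N ≤ r * N := Nat.mul_le_mul_right _ h
      omega
  let e := Fintype.equivFinOfCardEq (hr.symm.trans hr3)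
  rw [← e.symm.sum_comp, Fin.sum_univ_three] at h2
  exact card_of_orbits (hn' _) (hn' _) (hn' _) (hn _) (hn _) (hn _) (h3 _) (h3 _) (h3 _)
    (by rw [← h2]; rw [hr3] at h1; omega)

end MoebiusAction

end P1xP1


namespace P1xP1

/-! ### Pairs generating a tetrahedral group -/

/-- The relations satisfied by an element `t` of order `3` and an element `v` of order `2`
generating a group isomorphic to `𝔄₄`. -/
structure IsTetrahedralPair {G : Type*} [Group G] (t v : G) : Prop where
  cube : t * t * t = 1
  sq : v * v = 1
  ne : v ≠ 1
  rel : t * (t * v * t⁻¹) * t⁻¹ = v * (t * v * t⁻¹)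

namespace IsTetrahedralPair

section

variable {G G' : Type*} [Group G] [Group G'] {t v : G}

lemma map (h : IsTetrahedralPair t v) (f : G →* G') (hf : f v ≠ 1) :
    IsTetrahedralPair (f t) (f v) where
  cube := by rw [← map_mul, ← map_mul, h.cube, map_one]
  sq := by rw [← map_mul, h.sq, map_one]
  ne := hf
  rel := by simpa using congrArg f h.rel

lemma of_map {f : G →* G'} (hf : Function.Injective f) (h : IsTetrahedralPair (f t) (f v)) :
    IsTetrahedralPair t v where
  cube := hf (by simpa using h.cube)
  sq := hf (by simpa using h.sq)
  ne := fun h' => h.ne (by rw [h', map_one])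
  rel := hf (by simpa using h.rel)

lemma conj_sq (h : IsTetrahedralPair t v) : (t * v * t⁻¹) * (t * v * t⁻¹) = 1 := by
  rw [show (t * v * t⁻¹) * (t * v * t⁻¹) = t * (v * v) * t⁻¹ by group, h.sq]; simp

/-- By the relation, the product of the involutions v and t v t⁻¹ is a conjugate of t v t⁻¹, hence
has trivial square; so they commute. -/
lemma commute (h : IsTetrahedralPair t v) : Commute v (t * v * t⁻¹) := by
  have h1 : (v * (t * v * t⁻¹)) * (v * (t * v * t⁻¹)) = 1 := by
    rw [← h.rel, show t * (t * v * t⁻¹) * t⁻¹ * (t * (t * v * t⁻¹) * t⁻¹) =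
      t * ((t * v * t⁻¹) * (t * v * t⁻¹)) * t⁻¹ by group, h.conj_sq]
    simp
  have h2 : v⁻¹ = v := inv_eq_of_mul_eq_one_left h.sq
  have h3 : (t * v * t⁻¹)⁻¹ = t * v * t⁻¹ := inv_eq_of_mul_eq_one_left h.conj_sq
  rw [Commute, SemiconjBy, ← inv_eq_of_mul_eq_one_left h1, mul_inv_rev, h2, h3]

lemma ne_one (h : IsTetrahedralPair t v) : t ≠ 1 := by
  rintro rfl
  have := h.rel
  simp at this
  exact h.ne this

lemma mul_conj_ne_one (h : IsTetrahedralPair t v) : v * (t * v * t⁻¹) ≠ 1 := by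
  rw [← h.rel, Ne, mul_inv_eq_one, mul_eq_left, mul_inv_eq_one, mul_eq_left]
  exact h.ne

/-- Every element of the group generated by a tetrahedral pair has a normal form. -/
lemma exists_word (h : IsTetrahedralPair t v) {x : G} (hx : x ∈ Subgroup.closure {t, v}) :
    ∃ a b i : ℕ, x = v ^ a * (t * v * t⁻¹) ^ b * t ^ i := by
  have hv : ∀ a b i : ℕ, v * (v ^ a * (t * v * t⁻¹) ^ b * t ^ i) =
      v ^ (a + 1) * (t * v * t⁻¹) ^ b * t ^ i := fun a b i => by
    rw [pow_succ', mul_assoc v, mul_assoc v]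
  have ht : ∀ a b i : ℕ, t * (v ^ a * (t * v * t⁻¹) ^ b * t ^ i) =
      v ^ b * (t * v * t⁻¹) ^ (a + b) * t ^ (i + 1) := fun a b i => by
    have h1 : t * v ^ a * t⁻¹ = (t * v * t⁻¹) ^ a := conj_pow.symm
    have h2 : t * (t * v * t⁻¹) ^ b * t⁻¹ = v ^ b * (t * v * t⁻¹) ^ b := by
      rw [← conj_pow, h.rel, h.commute.mul_pow]
    calc t * (v ^ a * (t * v * t⁻¹) ^ b * t ^ i)
        = (t * v ^ a * t⁻¹) * (t * (t * v * t⁻¹) ^ b * t⁻¹) * (t * t ^ i) := by group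
      _ = _ := by
        rw [h1, h2, ← mul_assoc (_ ^ a), ((h.commute.symm.pow_pow a b).eq), pow_add, pow_succ' t i,
          ← mul_assoc (v ^ b)]
  induction hx using Subgroup.closure_induction_left with
  | one => exact ⟨0, 0, 0, by simp⟩
  | mul_left x hx y hy ih =>
    obtain ⟨a, b, i, rfl⟩ := ih
    rcases hx with rfl | rfl
    exacts [⟨_, _, _, ht a b i⟩, ⟨_, _, _, hv a b i⟩]
  | inv_mul_cancel x hx y hy ih =>
    obtain ⟨a, b, i, rfl⟩ := ih
    rcases hx with rfl | rfl
    · have hinv := inv_eq_of_mul_eq_one_left h.cube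
      have h2 : ∀ y, x⁻¹ * y = x * (x * y) := fun y => by rw [← mul_assoc, hinv]
      rw [h2 (_ * _), ht, ht]
      exact ⟨_, _, _, rfl⟩
    · rw [inv_eq_of_mul_eq_one_left h.sq, hv]
      exact ⟨_, _, _, rfl⟩

/-- The inverse of t ^ i lies in the four-group of v and its conjugate, so its square is trivial. As
t has order 3, this gives 3 ∣ i; then v, its conjugate and their product being nontrivial makes a
and b even. -/
lemma word_eq_one (h : IsTetrahedralPair t v) {a b i : ℕ}
    (hw : v ^ a * (t * v * t⁻¹) ^ b * t ^ i = 1) : 2 ∣ a ∧ 2 ∣ b ∧ 3 ∣ i := by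
  have ht : orderOf t = 3 := by
    have := Fact.mk Nat.prime_three
    exact orderOf_eq_prime (by rw [pow_three, ← mul_assoc]; exact h.cube) h.ne_one
  have hv : orderOf v = 2 := orderOf_eq_prime (by rw [pow_two]; exact h.sq) h.ne
  have hv2 : ∀ n, v ^ (2 * n) = 1 := fun n => by rw [pow_mul, pow_two, h.sq, one_pow]
  have hw2 : ∀ n, (t * v * t⁻¹) ^ (2 * n) = 1 := fun n => by
    rw [pow_mul, pow_two, h.conj_sq, one_pow]
  have h1 : t ^ (i * 2) = 1 := by
    rw [pow_mul, ← inv_eq_of_mul_eq_one_right hw, inv_pow, inv_eq_one,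
      (h.commute.pow_pow a b).mul_pow, ← pow_mul, ← pow_mul, mul_comm a, mul_comm b, hv2, hw2,
      mul_one]
  rw [← orderOf_dvd_iff_pow_eq_one, ht] at h1
  have h3 : 3 ∣ i := by omega
  have hti : t ^ i = 1 := orderOf_dvd_iff_pow_eq_one.1 (by rwa [ht])
  rw [hti, mul_one] at hw
  have hw1 : t * v * t⁻¹ ≠ 1 := by rw [Ne, mul_inv_eq_one, mul_eq_left]; exact h.ne
  refine ⟨?_, ?_, h3⟩ <;> by_contra hodd
  · obtain ⟨a, rfl⟩ : ∃ k, a = 2 * k + 1 := ⟨a / 2, by omega⟩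
    rw [pow_succ, hv2, one_mul] at hw
    rcases Nat.even_or_odd' b with ⟨b, rfl | rfl⟩
    · rw [hw2, mul_one] at hw; exact h.ne hw
    · rw [pow_succ, hw2, one_mul] at hw; exact h.mul_conj_ne_one hw
  · obtain ⟨b, rfl⟩ : ∃ k, b = 2 * k + 1 := ⟨b / 2, by omega⟩
    rw [pow_succ, hw2, one_mul] at hw
    rcases Nat.even_or_odd' a with ⟨a, rfl | rfl⟩
    · rw [hv2, one_mul] at hw; exact hw1 hw
    · rw [pow_succ, hv2, one_mul] at hw; exact h.mul_conj_ne_one hw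

lemma word_of_dvd (h : IsTetrahedralPair t v) {a b i : ℕ} (ha : 2 ∣ a) (hb : 2 ∣ b) (hi : 3 ∣ i) :
    v ^ a * (t * v * t⁻¹) ^ b * t ^ i = 1 := by
  obtain ⟨a, rfl⟩ := ha
  obtain ⟨b, rfl⟩ := hb
  obtain ⟨i, rfl⟩ := hi
  rw [pow_mul, pow_mul, pow_mul, pow_two, pow_two, h.sq, h.conj_sq, pow_three, ← mul_assoc, h.cube]
  simp

/-- A homomorphism which preserves a tetrahedral pair is injective on the group it generates. -/
lemma injective_closure (h : IsTetrahedralPair t v) (f : G →* G')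
    (h' : IsTetrahedralPair (f t) (f v)) :
    Function.Injective (f.comp (Subgroup.closure {t, v}).subtype) := by
  rw [injective_iff_map_eq_one]
  rintro ⟨x, hx⟩ hfx
  obtain ⟨a, b, i, rfl⟩ := h.exists_word hx
  have h1 : f t * f v * (f t)⁻¹ = f (t * v * t⁻¹) := by simp
  have h2 : f v ^ a * (f t * f v * (f t)⁻¹) ^ b * f t ^ i = 1 := by
    rw [h1, ← map_pow, ← map_pow, ← map_pow, ← map_mul, ← map_mul]
    exact hfx
  obtain ⟨ha, hb, hi⟩ := h'.word_eq_one h2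
  exact Subtype.ext (h.word_of_dvd ha hb hi)

end

-- A 3-cycle and a double transposition. The list of twelve words is what makes the projection onto
-- 𝔄₄ surjective in `exists_subgroup`.
set_option maxRecDepth 100000 in
lemma exists_alternating : ∃ t v : alternatingGroup (Fin 4), IsTetrahedralPair t v ∧
    ∀ x, ∃ a b : Fin 2, ∃ i : Fin 3, x = v ^ a.1 * (t * v * t⁻¹) ^ b.1 * t ^ i.1 := by
  refine ⟨⟨Equiv.swap 0 1 * Equiv.swap 1 2, Equiv.Perm.mem_alternatingGroup.2 (by decide)⟩,
    ⟨Equiv.swap 0 1 * Equiv.swap 2 3, Equiv.Perm.mem_alternatingGroup.2 (by decide)⟩,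
    ⟨by decide, by decide, by decide, by decide⟩, by decide⟩

/-- A tetrahedral pair generates a group isomorphic to `𝔄₄`. -/
theorem exists_subgroup {G : Type*} [Group G] {t v : G} (h : IsTetrahedralPair t v) :
    ∃ K : Subgroup G, Nonempty (K ≃* alternatingGroup (Fin 4)) := by
  obtain ⟨t₀, v₀, h₀, hword⟩ := exists_alternating
  -- The subgroup generated by (t₀, t) and (v₀, v) is the graph of the wanted embedding: both
  -- projections are injective on it, and the first one is onto.
  let T : alternatingGroup (Fin 4) × G := (t₀, t)
  let V : alternatingGroup (Fin 4) × G := (v₀, v)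
  have hTV : IsTetrahedralPair T V :=
    ⟨Prod.ext h₀.cube h.cube, Prod.ext h₀.sq h.sq, fun h' => h.ne (congrArg Prod.snd h'),
      Prod.ext h₀.rel h.rel⟩
  have h1 := hTV.injective_closure (MonoidHom.fst _ _) h₀
  have h2 := hTV.injective_closure (MonoidHom.snd _ _) h
  have h3 : Function.Surjective ((MonoidHom.fst (alternatingGroup (Fin 4)) G).comp
      (Subgroup.closure {T, V}).subtype) := by
    intro x
    obtain ⟨a, b, i, rfl⟩ := hword x
    have hT : T ∈ Subgroup.closure {T, V} := Subgroup.subset_closure (by simp)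
    have hV : V ∈ Subgroup.closure {T, V} := Subgroup.subset_closure (by simp)
    exact ⟨⟨V ^ a.1 * (T * V * T⁻¹) ^ b.1 * T ^ i.1, mul_mem (mul_mem (pow_mem hV _)
      (pow_mem (mul_mem (mul_mem hT hV) (inv_mem hT)) _)) (pow_mem hT _)⟩, rfl⟩
  exact ⟨_, ⟨(MonoidHom.ofInjective h2).symm.trans (MulEquiv.ofBijective _ ⟨h1, h3⟩)⟩⟩

end IsTetrahedralPair

end P1xP1


namespace P1xP1

/-! ### Groups of order four -/

/-- `P` is a Klein four-group. -/
def IsKlein {G : Type*} [Group G] (P : Subgroup G) : Prop :=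
  Nat.card P = 4 ∧ ∀ p ∈ P, p * p = 1

section CardFour

variable {G : Type*} [Group G] {P : Subgroup G}

lemma mem_of_card_four (hP : Nat.card P = 4) {u v w x : G} (hu : u ∈ P) (hv : v ∈ P) (hw : w ∈ P)
    (hu1 : u ≠ 1) (hv1 : v ≠ 1) (hw1 : w ≠ 1) (huv : u ≠ v) (huw : u ≠ w) (hvw : v ≠ w)
    (hx : x ∈ P) : x = 1 ∨ x = u ∨ x = v ∨ x = w := by
  classical
  have hfin : (P : Set G).Finite := Set.finite_of_ncard_pos (by
    rw [← Nat.card_coe_set_eq]; exact hP ▸ by norm_num)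
  have hcard : ((({1, u, v, w} : Finset G) : Set G)).ncard = 4 := by
    rw [Set.ncard_coe_finset, Finset.card_eq_of_equiv_fin]
    exact Finset.equivFinOfCardEq (by
      rw [Finset.card_insert_of_notMem, Finset.card_insert_of_notMem, Finset.card_pair hvw] <;>
        simp [*, Ne.symm hu1, Ne.symm hv1, Ne.symm hw1])
  have heq : (({1, u, v, w} : Finset G) : Set G) = P := by
    refine Set.eq_of_subset_of_ncard_le ?_ ?_ hfin
    · intro y hy
      simp at hy
      rcases hy with rfl | rfl | rfl | rfl
      exacts [one_mem P, hu, hv, hw]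
    · rw [hcard, ← Nat.card_coe_set_eq]; exact hP.le
  have : x ∈ (({1, u, v, w} : Finset G) : Set G) := heq ▸ hx
  simpa using this

lemma exists_mem_ne (hP : Nat.card P = 4) (a b : G) : ∃ x ∈ P, x ≠ a ∧ x ≠ b := by
  have h1 : ({a, b} : Set G).ncard < (P : Set G).ncard := by
    rw [← Nat.card_coe_set_eq (P : Set G)]
    exact lt_of_le_of_lt (Set.ncard_insert_le a {b}) (by
      rw [Set.ncard_singleton]; exact hP ▸ by norm_num)
  obtain ⟨x, hx, hx'⟩ := Set.exists_mem_notMem_of_ncard_lt_ncard h1 (Set.toFinite _)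
  simp at hx'
  exact ⟨x, hx, hx'⟩

lemma IsKlein.mem_cases (hP : IsKlein P) {v w x : G} (hv : v ∈ P) (hw : w ∈ P) (hv1 : v ≠ 1)
    (hw1 : w ≠ 1) (hvw : v ≠ w) (hx : x ∈ P) : x = 1 ∨ x = v ∨ x = w ∨ x = v * w :=
  mem_of_card_four hP.1 hv hw (mul_mem hv hw) hv1 hw1
    (fun h => hvw ((eq_inv_of_mul_eq_one_left h).trans (inv_eq_of_mul_eq_one_left (hP.2 w hw))))
    hvw (by simpa using hw1) (by simpa using hv1) hx

end CardFour

namespace MoebiusAction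

variable {H : Type*} [Group H] (m : MoebiusAction H)

lemma pair_cases {h : H} {a b : P1} (hab : a ≠ b) (ha : m.ρ h a = a ∨ m.ρ h a = b)
    (hb : m.ρ h b = a ∨ m.ρ h b = b) :
    (m.ρ h a = a ∧ m.ρ h b = b) ∨ (m.ρ h a = b ∧ m.ρ h b = a) := by
  have hne : m.ρ h a ≠ m.ρ h b := fun h' => hab ((m.ρ h).injective h')
  rcases ha with ha | ha <;> rcases hb with hb | hb
  · exact absurd (ha.trans hb.symm) hne
  · exact Or.inl ⟨ha, hb⟩
  · exact Or.inr ⟨ha, hb⟩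
  · exact absurd (ha.trans hb.symm) hne

/-- An element commuting with `v` preserves the set of fixed points of `v`. -/
lemma fixed_of_commute {g v : H} (hgv : g * v = v * g) {x : P1} (hx : m.ρ v x = x) :
    m.ρ v (m.ρ g x) = m.ρ g x := by
  rw [← m.mul_apply, ← hgv, m.mul_apply, hx]

variable [Finite H]

/-- A Klein four-group is its own centralizer. -/
lemma mem_of_centralizes (m : MoebiusAction H) {P : Subgroup H} (hP : IsKlein P) {g : H}
    (hg : ∀ p ∈ P, g * p = p * g) : g ∈ P := by
  obtain ⟨v, hv, hv1, -⟩ := exists_mem_ne hP.1 1 1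
  obtain ⟨w, hw, hw1, hwv⟩ := exists_mem_ne hP.1 1 v
  have hvw : v * w = w * v := by
    have h1 := inv_eq_of_mul_eq_one_left (hP.2 _ (mul_mem hv hw))
    rw [mul_inv_rev, inv_eq_of_mul_eq_one_left (hP.2 v hv),
      inv_eq_of_mul_eq_one_left (hP.2 w hw)] at h1
    exact h1.symm
  obtain ⟨a, b, hab, hfix⟩ := m.exists_fixed_iff hv1
  have ha := (hfix a).2 (Or.inl rfl)
  have hb := (hfix b).2 (Or.inr rfl)
  have hswap : ∀ z : H, z * v = v * z →
      (m.ρ z a = a ∧ m.ρ z b = b) ∨ (m.ρ z a = b ∧ m.ρ z b = a) := fun z hz =>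
    m.pair_cases hab ((hfix _).1 (m.fixed_of_commute hz ha))
      ((hfix _).1 (m.fixed_of_commute hz hb))
  -- Commuting with v, the element w preserves the fixed points of v; fixing them would make it
  -- equal to v.
  have hws : m.ρ w a = b ∧ m.ρ w b = a := (hswap w hvw.symm).resolve_left fun h =>
    hwv (m.involution_unique (hP.2 w hw) (hP.2 v hv) hw1 hv1 h.1 ha)
  -- Such a z is inverted by w and commutes with w, so its square is trivial and it is 1 or v. If g
  -- exchanges a and b, this is applied to w g.
  have main : ∀ z : H, z * v = v * z → z * w = w * z → m.ρ z a = a → m.ρ z b = b → z ∈ P := by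
    intro z hzv hzw hza hzb
    have h1 := m.mul_mul_eq_of_swap hab hza hzb hws.1 hws.2
    have h2 : z * z = 1 := by
      rw [hzw, mul_assoc] at h1
      simpa using h1
    by_cases hz1 : z = 1
    · exact hz1 ▸ one_mem P
    · exact m.involution_unique h2 (hP.2 v hv) hz1 hv1 hza ha ▸ hv
  have hgv := hg v hv
  have hgw := hg w hw
  rcases hswap g hgv with h | h
  · exact main g hgv hgw h.1 h.2
  · refine (Subgroup.mul_mem_cancel_left P hw).1 (main (w * g) ?_ ?_ ?_ ?_)
    · rw [mul_assoc, hgv, ← mul_assoc, ← hvw, mul_assoc]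
    · rw [mul_assoc, hgw]
    · rw [m.mul_apply, h.1, hws.2]
    · rw [m.mul_apply, h.2, hws.1]

/-- An element of order `3` normalizing a Klein four-group belongs to a tetrahedral pair. -/
lemma exists_tetrahedralPair_of_klein (m : MoebiusAction H) {P : Subgroup H} (hP : IsKlein P) {t : H}
    (ht3 : t * t * t = 1) (ht1 : t ≠ 1) (ht : ∀ p ∈ P, t * p * t⁻¹ ∈ P) :
    ∃ v ∈ P, IsTetrahedralPair t v := by
  have htP : t ∉ P := fun h => ht1 (by rw [hP.2 t h, one_mul] at ht3; exact ht3)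
  obtain ⟨v, hv, hne⟩ : ∃ v ∈ P, t * v * t⁻¹ ≠ v := by
    by_contra hcon
    push Not at hcon
    exact htP (m.mem_of_centralizes hP fun p hp => mul_inv_eq_iff_eq_mul.1 (hcon p hp))
  have hv1 : v ≠ 1 := by rintro rfl; simp at hne
  have hw1 : t * v * t⁻¹ ≠ 1 := by rwa [Ne, mul_inv_eq_one, mul_eq_left]
  refine ⟨v, hv, ht3, hP.2 v hv, hv1, ?_⟩
  have hcyc : t * (t * (t * v * t⁻¹) * t⁻¹) * t⁻¹ = v := by
    rw [show t * (t * (t * v * t⁻¹) * t⁻¹) * t⁻¹ = (t * t * t) * v * (t * t * t)⁻¹ by group, ht3]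
    simp
  rcases hP.mem_cases hv (ht v hv) hv1 hw1 hne.symm (ht _ (ht v hv)) with h | h | h | h
  · rw [mul_inv_eq_one, mul_eq_left] at h; exact absurd h hw1
  · rw [h] at hcyc; exact absurd hcyc hne
  · rw [mul_left_inj, mul_right_inj] at h; exact absurd h hne
  · exact h

/-- A nontrivial normal subgroup of a non-dihedral group is a Klein four-group or is itself
not dihedral. -/
theorem isKlein_of_normal (hm : ¬ m.IsDihedral) (K : Subgroup H) [K.Normal] (hK : K ≠ ⊥)
    (hKm : (m.restrict K).IsDihedral) : IsKlein K := by
  obtain ⟨a, b, hab, hKab⟩ := hKm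
  replace hKab : ∀ k ∈ K, (m.ρ k a = a ∧ m.ρ k b = b) ∨ (m.ρ k a = b ∧ m.ρ k b = a) :=
    fun k hk => hKab ⟨k, hk⟩
  obtain ⟨g, hg⟩ : ∃ g, ¬ ((m.ρ g a = a ∧ m.ρ g b = b) ∨ (m.ρ g a = b ∧ m.ρ g b = a)) := by
    by_contra hcon
    push Not at hcon
    exact hm ⟨a, b, hab, fun h => by have := hcon h; tauto⟩
  -- By normality the translate of the pair {a, b} by g is again K-invariant. It differs from {a,
  -- b}, so it contains a point c outside.
  have hconj : ∀ k ∈ K, (m.ρ k (m.ρ g a) = m.ρ g a ∧ m.ρ k (m.ρ g b) = m.ρ g b) ∨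
      (m.ρ k (m.ρ g a) = m.ρ g b ∧ m.ρ k (m.ρ g b) = m.ρ g a) := by
    intro k hk
    have h1 : ∀ x, m.ρ k (m.ρ g x) = m.ρ g (m.ρ (g⁻¹ * k * g) x) := fun x => by
      rw [← m.mul_apply, ← m.mul_apply]; congr 2; group
    have h2 : g⁻¹ * k * g ∈ K := by
      simpa using Subgroup.Normal.conj_mem ‹K.Normal› k hk g⁻¹
    rw [h1, h1]
    rcases hKab _ h2 with h | h
    · exact Or.inl ⟨by rw [h.1], by rw [h.2]⟩
    · exact Or.inr ⟨by rw [h.1], by rw [h.2]⟩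
  obtain ⟨c, d, hca, hcb, hcd⟩ : ∃ c d, c ≠ a ∧ c ≠ b ∧
      ∀ k ∈ K, (m.ρ k c = c ∧ m.ρ k d = d) ∨ (m.ρ k c = d ∧ m.ρ k d = c) := by
    by_cases h1 : m.ρ g a ≠ a ∧ m.ρ g a ≠ b
    · exact ⟨_, _, h1.1, h1.2, hconj⟩
    by_cases h2 : m.ρ g b ≠ a ∧ m.ρ g b ≠ b
    · refine ⟨m.ρ g b, m.ρ g a, h2.1, h2.2, fun k hk => ?_⟩
      exact (hconj k hk).imp And.symm And.symm
    exact absurd (m.pair_cases hab (by tauto) (by tauto)) hg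
  have hfix1 : ∀ k ∈ K, m.ρ k a = a → m.ρ k c = c → k = 1 := by
    intro k hk hka hkc
    have hkb : m.ρ k b = b := by
      rcases hKab k hk with h | h
      · exact h.2
      · exact absurd (hka.symm.trans h.1) hab
    exact m.eq_one_of_three hab hca hcb hka hkb hkc
  have hsq : ∀ k ∈ K, k * k = 1 := by
    intro k hk
    refine hfix1 _ (mul_mem hk hk) ?_ ?_
    · rw [m.mul_apply]
      rcases hKab k hk with h | h
      · rw [h.1, h.1]
      · rw [h.1, h.2]
    · rw [m.mul_apply]
      rcases hcd k hk with h | h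
      · rw [h.1, h.1]
      · rw [h.1, h.2]
  refine ⟨?_, hsq⟩
  -- An element of K is determined by whether it fixes a and whether it fixes c.
  have hle : Nat.card K ≤ 4 := by
    have hinj : Function.Injective fun k : K => (m.ρ k a = a, m.ρ k c = c) := by
      rintro ⟨k, hk⟩ ⟨l, hl⟩ hkl
      rw [Prod.mk.injEq, eq_iff_iff, eq_iff_iff] at hkl
      have h1 : k⁻¹ * l = 1 := by
        refine hfix1 _ (mul_mem (inv_mem hk) hl) ?_ ?_
        · rw [m.mul_apply, m.inv_apply_eq]
          rcases hKab k hk with h | h <;> rcases hKab l hl with h' | h'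
          · rw [h.1, h'.1]
          · exact absurd ((hkl.1.1 h.1).symm.trans h'.1) hab
          · exact absurd ((hkl.1.2 h'.1).symm.trans h.1) hab
          · rw [h.1, h'.1]
        · rw [m.mul_apply, m.inv_apply_eq]
          have := hkl.2
          rcases hcd k hk with h | h <;> rcases hcd l hl with h' | h'
          · rw [h.1, h'.1]
          · rw [h.1, hkl.2.1 h.1]
          · rw [h'.1, hkl.2.2 h'.1]
          · rw [h.1, h'.1]
      exact Subtype.ext (inv_mul_eq_one.1 h1)
    have := Nat.card_le_card_of_injective _ hinj
    simpa using this
  have hnt : Nontrivial K := (Subgroup.nontrivial_iff_ne_bot K).2 hK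
  have h2 : 1 < Nat.card K := Finite.one_lt_card
  obtain ⟨⟨k, hk⟩, hk1'⟩ := exists_ne (1 : K)
  have hk1 : k ≠ 1 := fun h => hk1' (Subtype.ext h)
  have hord : 2 ∣ Nat.card K := by
    have h3 := orderOf_dvd_natCard (⟨k, hk⟩ : K)
    rwa [orderOf_eq_prime (p := 2) (by rw [pow_two]; exact Subtype.ext (hsq k hk)) hk1'] at h3
  by_contra hne4
  have hcard : Nat.card K = 2 := by omega
  have huniq : ∀ l ∈ K, l ≠ 1 → l = k := by
    intro l hl hl1
    obtain ⟨x, y, hxy, hxyu⟩ := Nat.card_eq_two_iff.1 hcard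
    have hmem : ∀ z : K, z = x ∨ z = y := fun z => by
      have : z ∈ ({x, y} : Set K) := hxyu ▸ Set.mem_univ z
      simpa using this
    have : (⟨l, hl⟩ : K) = ⟨k, hk⟩ := by
      have hl' : (⟨l, hl⟩ : K) ≠ 1 := fun h => hl1 (congrArg Subtype.val h)
      rcases hmem ⟨l, hl⟩ with h3 | h3 <;> rcases hmem ⟨k, hk⟩ with h4 | h4 <;>
        rcases hmem 1 with h5 | h5 <;> rw [h3] at hl' ⊢ <;> rw [h4] at hk1' ⊢ <;>
        rw [h5] at hl' hk1' <;> first | rfl | exact absurd rfl hl' | exact absurd rfl hk1'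
    exact congrArg Subtype.val this
  obtain ⟨p, q, hpq, hfix⟩ := m.exists_fixed_iff hk1
  -- A normal subgroup of order 2 is central, so all of H would preserve the two fixed points of k.
  have hcomm : ∀ h, h * k = k * h := fun h =>
    mul_inv_eq_iff_eq_mul.1 (huniq _ (Subgroup.Normal.conj_mem ‹K.Normal› k hk h)
      (by rwa [Ne, mul_inv_eq_one, mul_eq_left]))
  exact hm ⟨p, q, hpq, fun h => m.pair_cases hpq
    ((hfix _).1 (m.fixed_of_commute (hcomm h) ((hfix p).2 (Or.inl rfl))))
    ((hfix _).1 (m.fixed_of_commute (hcomm h) ((hfix q).2 (Or.inr rfl))))⟩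

end MoebiusAction

end P1xP1


/-! ### Sylow theory: polyhedral groups contain tetrahedral pairs -/

namespace P1xP1

lemma card_sylow_two_mul_index {H : Type*} [Group H] [Finite H] (P : Sylow 2 H) :
    ∃ k, Nat.card P = 2 ^ k ∧ 2 ^ k * (P : Subgroup H).index = Nat.card H ∧
      ¬ 2 ∣ (P : Subgroup H).index := by
  obtain ⟨k, hk⟩ := IsPGroup.iff_card.1 P.2
  exact ⟨k, hk, hk ▸ (P : Subgroup H).card_mul_index, P.not_dvd_index⟩

lemma exists_eq_eight_mul {k : ℕ} (hk : 3 ≤ k) : ∃ j, 2 ^ k = 8 * j :=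
  ⟨2 ^ (k - 3), by rw [show 8 = 2 ^ 3 by norm_num, ← pow_add]; congr 1; omega⟩

/-- A group of order four with an automorphism of order three is a Klein four-group. -/
lemma isKlein_of_cycle {G : Type*} [Group G] {P : Subgroup G} (hP : Nat.card P = 4) {t v : G}
    (ht : ∀ p ∈ P, t * p * t⁻¹ ∈ P) (hv : v ∈ P) (hne : t * v * t⁻¹ ≠ v)
    (ht3 : t * (t * (t * v * t⁻¹) * t⁻¹) * t⁻¹ = v) : IsKlein P := by
  set w := t * v * t⁻¹ with hw
  set u := t * w * t⁻¹ with hu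
  have hwP : w ∈ P := ht v hv
  have huP : u ∈ P := ht w hwP
  have hv1 : v ≠ 1 := by
    intro h
    apply hne
    rw [hw, h]; simp
  have hw1 : w ≠ 1 := by rwa [hw, Ne, mul_inv_eq_one, mul_eq_left]
  have hu1 : u ≠ 1 := by rwa [hu, Ne, mul_inv_eq_one, mul_eq_left]
  have huw : u ≠ w := fun h => by
    rw [hu, hw, mul_left_inj, mul_right_inj, ← hw] at h; exact hne h
  have huv : u ≠ v := fun h => by
    rw [h, ← hw] at ht3; exact hne ht3
  have hcard : ∀ x ∈ P, x * x * (x * x) = 1 := fun x hx => by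
    have h1 := pow_card_eq_one' (x := (⟨x, hx⟩ : P))
    rw [hP] at h1
    have h2 : x ^ 4 = 1 := congrArg Subtype.val h1
    rw [← h2]; simp only [pow_succ, pow_zero, one_mul, mul_assoc]
  have hsqw : w * w = t * (v * v) * t⁻¹ := by rw [hw]; group
  have hsqu : u * u = t * (w * w) * t⁻¹ := by rw [hu]; group
  -- The elements other than 1 are v, w, u, permuted cyclically by t. If v² were w or u, then v⁴ or
  -- w⁴ would be u, while all fourth powers are trivial.
  have hsqv : v * v = 1 := by
    rcases mem_of_card_four hP hv hwP huP hv1 hw1 hu1 hne.symm huv.symm huw.symm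
      (mul_mem hv hv) with h | h | h | h
    · exact h
    · exact absurd (mul_eq_left.1 h) hv1
    · have h4 := hcard v hv
      rw [h, hsqw, h, ← hu] at h4
      exact absurd h4 hu1
    · have h5 : w * w = v := by rw [hsqw, h, ht3]
      have h4 := hcard w hwP
      rw [h5, h] at h4
      exact absurd h4 hu1
  refine ⟨hP, fun p hp => ?_⟩
  rcases mem_of_card_four hP hv hwP huP hv1 hw1 hu1 hne.symm huv.symm huw.symm hp with
    rfl | rfl | rfl | rfl
  · simp
  · exact hsqv
  · rw [hsqw, hsqv]; simp
  · rw [hsqu, hsqw, hsqv]; simp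

namespace MoebiusAction

variable {H : Type*} [Group H]

lemma restrict_isDihedral_of_card (m : MoebiusAction H) (K : Subgroup H) [Finite K]
    (h12 : Nat.card K ≠ 12) (h24 : Nat.card K ≠ 24) (h60 : Nat.card K ≠ 60) :
    (m.restrict K).IsDihedral := by
  by_contra h
  rcases (m.restrict K).card_of_not_isDihedral h with h | h | h <;> contradiction

/-- A nontrivial normal subgroup whose order is not that of a polyhedral group is a Klein
four-group. -/
lemma isKlein_of_normal_of_card [Finite H] (m : MoebiusAction H) (hm : ¬ m.IsDihedral)
    (K : Subgroup H) [K.Normal] (h1 : Nat.card K ≠ 1) (h12 : Nat.card K ≠ 12)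
    (h24 : Nat.card K ≠ 24) (h60 : Nat.card K ≠ 60) : IsKlein K :=
  m.isKlein_of_normal hm K (fun h => h1 (by rw [h, Subgroup.card_bot]))
    (m.restrict_isDihedral_of_card K h12 h24 h60)

/-- Here a Sylow 2-subgroup P has order 4. By Burnside's transfer theorem, if its normalizer
centralized it there would be a normal complement of order 3 or 15, and a proper polyhedral or Klein
order is required. Hence some t normalizes P and acts nontrivially on it, with an action of order 3,
which makes P a Klein four-group. -/
lemma exists_tetrahedralPair_of_odd [Finite H] (m : MoebiusAction H) (hm : ¬ m.IsDihedral)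
    (hcard : Nat.card H = 12 ∨ Nat.card H = 60) : ∃ t v : H, IsTetrahedralPair t v := by
  let P : Sylow 2 H := default
  obtain ⟨k, hk, hidx, hodd⟩ := card_sylow_two_mul_index P
  have hP4 : Nat.card (P : Subgroup H) = 4 ∧ (P : Subgroup H).index * 4 = Nat.card H := by
    have hk2 : k = 2 := by
      rcases Nat.lt_or_ge k 3 with h | h
      · interval_cases k <;> omega
      · obtain ⟨j, hj⟩ := exists_eq_eight_mul h
        rw [hj, mul_assoc] at hidx
        omega
    subst hk2
    exact ⟨hk, by omega⟩
  have hcomm : ∀ x ∈ (P : Subgroup H), ∀ y ∈ (P : Subgroup H), x * y = y * x := fun x hx y hy => by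
    have := (IsPGroup.isMulCommutative_of_card_eq_prime_sq (p := 2)
      (G := (P : Subgroup H)) hP4.1).is_comm.comm ⟨x, hx⟩ ⟨y, hy⟩
    exact congrArg Subtype.val this
  have hnc : ¬ Subgroup.normalizer ((P : Subgroup H) : Set H) ≤
      Subgroup.centralizer ((P : Subgroup H) : Set H) := by
    intro hle
    have h1 := (MonoidHom.ker_transferSylow_isComplement' P hle).card_mul_card
    rw [hP4.1] at h1
    have h2 := m.isKlein_of_normal_of_card hm (MonoidHom.transferSylow P hle).ker (by omega)
      (by omega) (by omega) (by omega)
    have := h2.1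
    omega
  obtain ⟨t, htN, htC⟩ := Set.not_subset.1 hnc
  have ht : ∀ p ∈ (P : Subgroup H), t * p * t⁻¹ ∈ (P : Subgroup H) := fun p hp =>
    (Subgroup.mem_normalizer_iff.1 htN p).1 hp
  obtain ⟨v, hv, hne⟩ : ∃ v ∈ (P : Subgroup H), t * v * t⁻¹ ≠ v := by
    by_contra hcon
    push Not at hcon
    exact htC (Subgroup.mem_centralizer_iff.2 fun p hp =>
      (mul_inv_eq_iff_eq_mul.1 (hcon p hp)).symm)
  let f : Subgroup.normalizer ((P : Subgroup H) : Set H) →* Equiv.Perm (P : Subgroup H) :=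
    (MulAut.toPerm _).comp (P : Subgroup H).normalizerMonoidHom
  have hf : ∀ (g : Subgroup.normalizer ((P : Subgroup H) : Set H)) (p : (P : Subgroup H)),
      ((f g p : (P : Subgroup H)) : H) = g.1 * p.1 * g.1⁻¹ := fun g p => rfl
  -- P is commutative and acts trivially on itself, so the order of the acting group divides an odd
  -- index; being a divisor of 24 = 4!, it divides 3.
  have hker : ((P : Subgroup H).subgroupOf (Subgroup.normalizer ((P : Subgroup H) : Set H))) ≤
      f.ker := by
    intro g hg
    rw [MonoidHom.mem_ker]
    ext p
    rw [hf, hcomm g.1 hg p.1 p.2]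
    simp
  have hfodd : ¬ 2 ∣ Nat.card f.range := by
    rw [← Subgroup.index_ker]
    intro h2
    apply hodd
    exact (h2.trans (Subgroup.index_dvd_of_le hker)).trans
      (Subgroup.relIndex_dvd_index_of_le (Subgroup.le_normalizer))
  have hf3 : (f ⟨t, htN⟩) ^ 3 = 1 := by
    have h1 : Nat.card f.range ∣ Nat.card (Equiv.Perm (P : Subgroup H)) :=
      Subgroup.card_subgroup_dvd_card _
    rw [Nat.card_perm, hP4.1] at h1
    have h2 : Nat.card f.range ∣ 3 := by
      have hc : Nat.Coprime (Nat.card f.range) 8 := by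
        rw [show 8 = 2 ^ 3 by norm_num]
        exact Nat.Coprime.pow_right _ ((Nat.prime_two.coprime_iff_not_dvd.2 hfodd).symm)
      exact hc.dvd_of_dvd_mul_left (by rwa [show 8 * 3 = Nat.factorial 4 by rfl])
    obtain ⟨j, hj⟩ := h2
    have h3 := pow_card_eq_one' (x := (⟨f ⟨t, htN⟩, ⟨_, rfl⟩⟩ : f.range))
    have h4 : (f ⟨t, htN⟩) ^ Nat.card f.range = 1 := congrArg Subtype.val h3
    rw [hj, pow_mul, h4, one_pow]
  have hcyc : ∀ p ∈ (P : Subgroup H), t ^ 3 * p * (t ^ 3)⁻¹ = p := by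
    intro p hp
    have h1 := hf (⟨t, htN⟩ ^ 3) ⟨p, hp⟩
    rw [map_pow, hf3] at h1
    exact h1.symm
  have hklein : IsKlein (P : Subgroup H) := isKlein_of_cycle hP4.1 ht hv hne (by
    refine Eq.trans ?_ (hcyc v hv)
    simp only [pow_three, mul_inv_rev, mul_assoc])
  have ht3P : t ^ 3 ∈ (P : Subgroup H) := m.mem_of_centralizes hklein fun p hp =>
    mul_inv_eq_iff_eq_mul.1 (hcyc p hp)
  have h4 : t ^ 4 * v * (t ^ 4)⁻¹ = t * v * t⁻¹ := by
    conv_rhs => rw [← hcyc v hv]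
    group
  -- The element t may have order 6. As t³ lies in P, (t⁴)³ = 1, and t⁴ acts on P as t does.
  obtain ⟨v, -, h⟩ := m.exists_tetrahedralPair_of_klein hklein (t := t ^ 4) (by
      have := hklein.2 _ ht3P
      rw [show t ^ 4 * t ^ 4 * t ^ 4 = (t ^ 3 * t ^ 3) * (t ^ 3 * t ^ 3) by group, this, one_mul])
    (fun h1 => hne (by rw [← h4, h1]; simp))
    (fun p hp => (Subgroup.mem_normalizer_iff.1 (pow_mem htN 4) p).1 hp)
  exact ⟨_, _, h⟩

/-- A normal Klein four-group in a group of order divisible by `3` gives a tetrahedral pair. -/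
lemma exists_tetrahedralPair_of_normal [Finite H] (m : MoebiusAction H) (h3 : 3 ∣ Nat.card H)
    {K : Subgroup H} [K.Normal] (hK : IsKlein K) : ∃ t v : H, IsTetrahedralPair t v := by
  have := Fact.mk Nat.prime_three
  obtain ⟨t, ht⟩ := exists_prime_orderOf_dvd_card' 3 h3
  obtain ⟨v, -, h⟩ := m.exists_tetrahedralPair_of_klein hK (t := t)
    (by have := pow_orderOf_eq_one t; rwa [ht, pow_three, ← mul_assoc] at this)
    (fun h => by rw [h, orderOf_one] at ht; omega)
    (fun p hp => Subgroup.Normal.conj_mem ‹K.Normal› p hp t)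
  exact ⟨t, v, h⟩

/-- A finite non-dihedral group of projective transformations contains a tetrahedral pair. -/
theorem exists_tetrahedralPair [Finite H] (m : MoebiusAction H) (hm : ¬ m.IsDihedral) :
    ∃ t v : H, IsTetrahedralPair t v := by
  rcases m.card_of_not_isDihedral hm with hcard | hcard | hcard
  · exact m.exists_tetrahedralPair_of_odd hm (Or.inl hcard)
  swap
  · exact m.exists_tetrahedralPair_of_odd hm (Or.inr hcard)
  let P : Sylow 2 H := default
  obtain ⟨k, hk, hidx, hodd⟩ := card_sylow_two_mul_index P
  have hP8 : Nat.card (P : Subgroup H) = 8 ∧ (P : Subgroup H).index = 3 := by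
    have hk2 : k = 3 := by
      rcases Nat.lt_or_ge k 4 with h | h
      · interval_cases k <;> omega
      · have hj : 2 ^ k = 16 * 2 ^ (k - 4) := by
          rw [show 16 = 2 ^ 4 by norm_num, ← pow_add]; congr 1; omega
        rw [hj, mul_assoc] at hidx
        omega
    subst hk2
    exact ⟨hk, by omega⟩
  have hns : Nat.card (Sylow 2 H) ≠ 1 := by
    intro h1
    have : Subsingleton (Sylow 2 H) := (Nat.card_eq_one_iff_unique.1 h1).1
    have hN : (P : Subgroup H).Normal := Sylow.normal_of_subsingleton P
    have := (m.isKlein_of_normal_of_card hm (P : Subgroup H) (by omega) (by omega) (by omega)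
      (by omega)).1
    omega
  have hn3 : Nat.card (Sylow 2 H) = 3 := by
    have h1 := P.card_dvd_index
    rw [hP8.2] at h1
    exact (Nat.dvd_prime Nat.prime_three).1 h1 |>.resolve_left hns
  -- In order 24, a normal Sylow 2-subgroup would have order 8 without being Klein, so there are
  -- three of them and the kernel of the action on them is nontrivial. It is Klein or has order 12;
  -- order 24 would contradict transitivity, and 60 does not divide 24.
  let f := MulAction.toPermHom H (Sylow 2 H)
  have hker : Nat.card f.range * Nat.card f.ker = 24 := by
    rw [← Subgroup.index_ker, mul_comm, Subgroup.card_mul_index, hcard]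
  have hrange : Nat.card f.range ∣ 6 := by
    have h1 : Nat.card f.range ∣ Nat.card (Equiv.Perm (Sylow 2 H)) :=
      Subgroup.card_subgroup_dvd_card _
    rwa [Nat.card_perm, hn3] at h1
  have hle : Nat.card f.range ≤ 6 := Nat.le_of_dvd (by norm_num) hrange
  have hker1 : Nat.card f.ker ≠ 1 := fun h => by rw [h] at hker; omega
  have h3 : 3 ∣ Nat.card H := by rw [hcard]; norm_num
  by_cases hd : (m.restrict f.ker).IsDihedral
  · exact m.exists_tetrahedralPair_of_normal h3
      (m.isKlein_of_normal hm f.ker (fun h => hker1 (by rw [h, Subgroup.card_bot])) hd)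
  · rcases (m.restrict f.ker).card_of_not_isDihedral hd with h | h | h
    · obtain ⟨t, v, htv⟩ := (m.restrict f.ker).exists_tetrahedralPair_of_odd hd (Or.inl h)
      exact ⟨t, v, htv.map f.ker.subtype fun h => htv.ne (Subtype.ext h)⟩
    · exfalso
      have htop : f.ker = ⊤ := Subgroup.eq_top_of_card_eq _ (by rw [h, hcard])
      apply hns
      refine Nat.card_eq_one_iff_unique.2 ⟨⟨fun Q R => ?_⟩, ⟨P⟩⟩
      obtain ⟨g, hg⟩ := MulAction.exists_smul_eq H Q R
      have hg1 : f g = 1 := by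
        rw [← MonoidHom.mem_ker, htop]; trivial
      rw [← hg]
      exact (congrArg (fun e => e Q) hg1).symm
    · rw [h] at hker; omega

end MoebiusAction

end P1xP1


namespace P1xP1

/-! ### Subgroups of `PGL₂ × PGL₂` -/

/-- A subgroup of `PGL` acts on `ℙ¹`. -/
noncomputable def MoebiusAction.ofSubgroup (Γ : Subgroup (Equiv.Perm P1)) (hΓ : Γ ≤ PGL) :
    MoebiusAction Γ where
  ρ := Γ.subtype
  injective := Γ.subtype_injective
  mem h := hΓ h.2

section Projections

variable {A B : Type*} [Group A] [Group B]

/-- The image of the first projection. -/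
abbrev projFst (H : Subgroup (A × B)) : Subgroup A := H.map (MonoidHom.fst A B)

/-- The image of the second projection. -/
abbrev projSnd (H : Subgroup (A × B)) : Subgroup B := H.map (MonoidHom.snd A B)

/-- The elements `a` of the first projection with `(a, 1) ∈ H`. -/
def kerFst (H : Subgroup (A × B)) : Subgroup (projFst H) :=
  (H.comap (MonoidHom.inl A B)).subgroupOf (projFst H)

/-- The elements `b` of the second projection with `(1, b) ∈ H`. -/
def kerSnd (H : Subgroup (A × B)) : Subgroup (projSnd H) :=
  (H.comap (MonoidHom.inr A B)).subgroupOf (projSnd H)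

lemma mem_kerFst {H : Subgroup (A × B)} {x : projFst H} : x ∈ kerFst H ↔ ((x : A), (1 : B)) ∈ H :=
  Iff.rfl

lemma mem_kerSnd {H : Subgroup (A × B)} {x : projSnd H} : x ∈ kerSnd H ↔ ((1 : A), (x : B)) ∈ H :=
  Iff.rfl

instance (H : Subgroup (A × B)) : (kerFst H).Normal := by
  refine ⟨fun x hx g => ?_⟩
  obtain ⟨⟨a, b⟩, hab, hg⟩ := g.2
  have h1 := mul_mem (mul_mem hab (mem_kerFst.1 hx)) (inv_mem hab)
  rw [mem_kerFst, Subgroup.coe_mul, Subgroup.coe_mul, Subgroup.coe_inv, ← hg]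
  simpa using h1

instance (H : Subgroup (A × B)) : (kerSnd H).Normal := by
  refine ⟨fun x hx g => ?_⟩
  obtain ⟨⟨a, b⟩, hab, hg⟩ := g.2
  have h1 := mul_mem (mul_mem hab (mem_kerSnd.1 hx)) (inv_mem hab)
  rw [mem_kerSnd, Subgroup.coe_mul, Subgroup.coe_mul, Subgroup.coe_inv, ← hg]
  simpa using h1

instance (H : Subgroup (A × B)) [Finite H] : Finite (projFst H) :=
  Finite.of_surjective (fun x : H => (⟨_, x, x.2, rfl⟩ : projFst H)) (by
    rintro ⟨_, x, hx, rfl⟩; exact ⟨⟨x, hx⟩, rfl⟩)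

instance (H : Subgroup (A × B)) [Finite H] : Finite (projSnd H) :=
  Finite.of_surjective (fun x : H => (⟨_, x, x.2, rfl⟩ : projSnd H)) (by
    rintro ⟨_, x, hx, rfl⟩; exact ⟨⟨x, hx⟩, rfl⟩)

end Projections

namespace MoebiusAction

/-- A finite subgroup of `PGL₂ × PGL₂` whose projections are not dihedral contains a tetrahedral
pair. -/
theorem exists_tetrahedralPair_prod (H : Subgroup (Equiv.Perm P1 × Equiv.Perm P1)) [Finite H]
    (m₁ : MoebiusAction (projFst H)) (m₂ : MoebiusAction (projSnd H))
    (h₁ : ¬ m₁.IsDihedral) (h₂ : ¬ m₂.IsDihedral) :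
    ∃ t ∈ H, ∃ v ∈ H, IsTetrahedralPair t v := by
  by_cases hd₁ : (m₁.restrict (kerFst H)).IsDihedral
  swap
  · obtain ⟨t, v, h⟩ := (m₁.restrict (kerFst H)).exists_tetrahedralPair hd₁
    have h' := h.map ((MonoidHom.inl (Equiv.Perm P1) (Equiv.Perm P1)).comp
      ((projFst H).subtype.comp (kerFst H).subtype)) fun h' => h.ne (by
        exact Subtype.ext (Subtype.ext (congrArg Prod.fst h')))
    exact ⟨_, mem_kerFst.1 t.2, _, mem_kerFst.1 v.2, h'⟩
  by_cases hd₂ : (m₂.restrict (kerSnd H)).IsDihedral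
  swap
  · obtain ⟨t, v, h⟩ := (m₂.restrict (kerSnd H)).exists_tetrahedralPair hd₂
    have h' := h.map ((MonoidHom.inr (Equiv.Perm P1) (Equiv.Perm P1)).comp
      ((projSnd H).subtype.comp (kerSnd H).subtype)) fun h' => h.ne (by
        exact Subtype.ext (Subtype.ext (congrArg Prod.snd h')))
    exact ⟨_, mem_kerSnd.1 t.2, _, mem_kerSnd.1 v.2, h'⟩
  by_cases hb₂ : kerSnd H = ⊥
  · obtain ⟨t, v, h⟩ := m₁.exists_tetrahedralPair h₁
    obtain ⟨t', ht', htt⟩ := t.2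
    obtain ⟨v', hv', hvv⟩ := v.2
    have h' := h.map (projFst H).subtype fun h' => h.ne (Subtype.ext h')
    rw [(projFst H).subtype_apply, (projFst H).subtype_apply, ← htt, ← hvv] at h'
    -- A trivial kernel makes H isomorphic to its first projection, from which the pair is lifted.
    have hinj : Function.Injective ((MonoidHom.fst (Equiv.Perm P1) (Equiv.Perm P1)).comp
        H.subtype) := by
      rw [injective_iff_map_eq_one]
      rintro ⟨⟨x, y⟩, hxy⟩ (rfl : x = 1)
      have h1 : (⟨y, ⟨_, hxy, rfl⟩⟩ : projSnd H) ∈ kerSnd H := mem_kerSnd.2 hxy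
      rw [hb₂, Subgroup.mem_bot] at h1
      exact Subtype.ext (Prod.ext rfl (congrArg Subtype.val h1))
    have h2 := IsTetrahedralPair.of_map (t := (⟨t', ht'⟩ : H)) (v := (⟨v', hv'⟩ : H)) hinj h'
    exact ⟨t', ht', v', hv', h2.map H.subtype fun h3 => h2.ne (Subtype.ext h3)⟩
  by_cases hb₁ : kerFst H = ⊥
  · obtain ⟨t, v, h⟩ := m₂.exists_tetrahedralPair h₂
    obtain ⟨t', ht', htt⟩ := t.2
    obtain ⟨v', hv', hvv⟩ := v.2
    have h' := h.map (projSnd H).subtype fun h' => h.ne (Subtype.ext h')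
    rw [(projSnd H).subtype_apply, (projSnd H).subtype_apply, ← htt, ← hvv] at h'
    have hinj : Function.Injective ((MonoidHom.snd (Equiv.Perm P1) (Equiv.Perm P1)).comp
        H.subtype) := by
      rw [injective_iff_map_eq_one]
      rintro ⟨⟨x, y⟩, hxy⟩ (rfl : y = 1)
      have h1 : (⟨x, ⟨_, hxy, rfl⟩⟩ : projFst H) ∈ kerFst H := mem_kerFst.2 hxy
      rw [hb₁, Subgroup.mem_bot] at h1
      exact Subtype.ext (Prod.ext (congrArg Subtype.val h1) rfl)
    have h2 := IsTetrahedralPair.of_map (t := (⟨t', ht'⟩ : H)) (v := (⟨v', hv'⟩ : H)) hinj h'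
    exact ⟨t', ht', v', hv', h2.map H.subtype fun h3 => h2.ne (Subtype.ext h3)⟩
  have hk₁ := m₁.isKlein_of_normal h₁ (kerFst H) hb₁ hd₁
  have hk₂ := m₂.isKlein_of_normal h₂ (kerSnd H) hb₂ hd₂
  have h3 : 3 ∣ Nat.card H := by
    refine dvd_trans ?_ (Subgroup.card_map_dvd H (MonoidHom.fst _ _))
    rcases m₁.card_of_not_isDihedral h₁ with h | h | h <;> rw [h] <;> norm_num
  have := Fact.mk Nat.prime_three
  obtain ⟨⟨⟨t, t'⟩, htH⟩, hord⟩ := exists_prime_orderOf_dvd_card' 3 h3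
  have hcube : ((t, t') : Equiv.Perm P1 × Equiv.Perm P1) * (t, t') * (t, t') = 1 := by
    have h4 := pow_orderOf_eq_one (⟨(t, t'), htH⟩ : H)
    rw [hord, pow_three, ← mul_assoc] at h4
    exact congrArg Subtype.val h4
  have hne : ((t, t') : Equiv.Perm P1 × Equiv.Perm P1) ≠ 1 := fun h4 => by
    rw [show (⟨(t, t'), htH⟩ : H) = 1 from Subtype.ext h4, orderOf_one] at hord
    omega
  have hc₁ : t * t * t = 1 := congrArg Prod.fst hcube
  have hc₂ : t' * t' * t' = 1 := congrArg Prod.snd hcube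
  -- Otherwise t' would lie in the Klein kernel, with trivial square and trivial cube.
  have ht1 : t ≠ 1 := by
    rintro rfl
    have h4 := hk₂.2 ⟨t', ⟨_, htH, rfl⟩⟩ (mem_kerSnd.2 htH)
    have h5 : t' * t' = 1 := congrArg Subtype.val h4
    rw [h5, one_mul] at hc₂
    exact hne (Prod.ext rfl hc₂)
  have ht1' : t' ≠ 1 := by
    rintro rfl
    have h4 := hk₁.2 ⟨t, ⟨_, htH, rfl⟩⟩ (mem_kerFst.2 htH)
    have h5 : t * t = 1 := congrArg Subtype.val h4
    rw [h5, one_mul] at hc₁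
    exact hne (Prod.ext hc₁ rfl)
  obtain ⟨v, hv, hp⟩ := m₁.exists_tetrahedralPair_of_klein hk₁ (t := ⟨t, ⟨_, htH, rfl⟩⟩)
    (Subtype.ext hc₁) (fun h => ht1 (congrArg Subtype.val h))
    fun p hp => (inferInstance : (kerFst H).Normal).conj_mem p hp _
  obtain ⟨v', hv', hp'⟩ := m₂.exists_tetrahedralPair_of_klein hk₂ (t := ⟨t', ⟨_, htH, rfl⟩⟩)
    (Subtype.ext hc₂) (fun h => ht1' (congrArg Subtype.val h))
    fun p hp => (inferInstance : (kerSnd H).Normal).conj_mem p hp _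
  have hq := hp.map (projFst H).subtype fun h' => hp.ne (Subtype.ext h')
  have hq' := hp'.map (projSnd H).subtype fun h' => hp'.ne (Subtype.ext h')
  refine ⟨(t, t'), htH, (v, v'), ?_, ⟨Prod.ext hq.cube hq'.cube, Prod.ext hq.sq hq'.sq,
    fun h => hq.ne (congrArg Prod.fst h), Prod.ext hq.rel hq'.rel⟩⟩
  -- (v, v') is the product of (v, 1) and (1, v'), both in H.
  simpa using mul_mem (mem_kerFst.1 hv) (mem_kerSnd.1 hv')

end MoebiusAction

/-! ### The torus and its normalizer -/

/-- `γ` fixes the two torus fixed points of `ℙ¹`. -/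
def IsDiagonal (γ : Equiv.Perm P1) : Prop :=
  γ ∈ PGL ∧ γ ptInf = ptInf ∧ γ (pt 0) = pt 0

/-- `γ` preserves the set of the two torus fixed points of `ℙ¹`. -/
def IsMonomial (γ : Equiv.Perm P1) : Prop :=
  γ ∈ PGL ∧ ((γ ptInf = ptInf ∧ γ (pt 0) = pt 0) ∨ (γ ptInf = pt 0 ∧ γ (pt 0) = ptInf))

lemma scale_smul_ptInf (a : ℂˣ) : scale a • ptInf = ptInf := by
  rw [ptInf, Projectivization.smul_mk]
  exact mk_eq_ptInf _ (by simp [scale, Matrix.GeneralLinearGroup.mkOfDetNeZero])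

/-- The torus uses the coordinate (1 : x), whereas `pt x` is (x : 1); hence the division. -/
lemma scale_smul_pt (a : ℂˣ) (x : ℂ) : scale a • pt x = pt (x / a) := by
  rw [pt, Projectivization.smul_mk, mk_eq_pt _ (by
    simp [scale, Matrix.GeneralLinearGroup.mkOfDetNeZero])]
  congr 1
  simp [scale, Matrix.GeneralLinearGroup.mkOfDetNeZero]

lemma isDiagonal_scale (a : ℂˣ) : IsDiagonal (MulAction.toPermHom (GL (Fin 2) ℂ) P1 (scale a)) :=
  ⟨⟨_, rfl⟩, scale_smul_ptInf a, by
    have := scale_smul_pt a 0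
    rwa [zero_div] at this⟩

lemma IsDiagonal.exists_scale {γ : Equiv.Perm P1} (h : IsDiagonal γ) :
    ∃ a : ℂˣ, ∀ p, γ p = scale a • p := by
  obtain ⟨c, hc, h'⟩ := PGL.scaling h.1 h.2.1 h.2.2
  refine ⟨(Units.mk0 c hc)⁻¹, fun p => ?_⟩
  rcases eq_ptInf_or_pt p with rfl | ⟨x, rfl⟩
  · rw [h.2.1, scale_smul_ptInf]
  · rw [h', scale_smul_pt]
    congr 1
    simp [mul_comm]

lemma mem_torus_iff {φ : Aut} : φ ∈ torus ↔
    ∃ α β, IsDiagonal α ∧ IsDiagonal β ∧ ∀ p, φ.1 p = (α p.1, β p.2) := by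
  constructor
  · rintro ⟨a, b, h⟩
    exact ⟨_, _, isDiagonal_scale a, isDiagonal_scale b, h⟩
  · rintro ⟨α, β, hα, hβ, h⟩
    obtain ⟨a, ha⟩ := hα.exists_scale
    obtain ⟨b, hb⟩ := hβ.exists_scale
    exact ⟨a, b, fun p => by rw [h, ha, hb]⟩

lemma IsMonomial.conj {γ δ : Equiv.Perm P1} (hγ : IsMonomial γ) (hδ : IsDiagonal δ) :
    IsDiagonal (γ * δ * γ⁻¹) := by
  obtain ⟨h1, h2 | h2⟩ := hγ
  · exact ⟨PGL.conj_mem hδ.1 h1, PGL.conj_apply_of_eq h2.1 h2.1 hδ.2.1,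
      PGL.conj_apply_of_eq h2.2 h2.2 hδ.2.2⟩
  · exact ⟨PGL.conj_mem hδ.1 h1, PGL.conj_apply_of_eq h2.2 h2.2 hδ.2.2,
      PGL.conj_apply_of_eq h2.1 h2.1 hδ.2.1⟩

lemma IsMonomial.inv {γ : Equiv.Perm P1} (hγ : IsMonomial γ) : IsMonomial γ⁻¹ := by
  refine ⟨inv_mem hγ.1, ?_⟩
  simp only [Equiv.Perm.inv_eq_iff_eq]
  rcases hγ.2 with h | h
  · exact Or.inl ⟨h.1.symm, h.2.symm⟩
  · exact Or.inr ⟨h.2.symm, h.1.symm⟩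

/-- `φ` is given by monomial matrices, possibly after exchanging the factors. -/
def IsMonomialAut (φ : Aut) : Prop :=
  ∃ α β, IsMonomial α ∧ IsMonomial β ∧
    ((∀ p, φ.1 p = (α p.1, β p.2)) ∨ ∀ p, φ.1 p = (α p.2, β p.1))

lemma Aut.inv_apply_eq {φ : Aut} {p q : S} : (φ⁻¹ : Aut).1 p = q ↔ p = φ.1 q :=
  Equiv.Perm.inv_eq_iff_eq

lemma Aut.mul_apply (φ ψ : Aut) (p : S) : (φ * ψ).1 p = φ.1 (ψ.1 p) := rfl

lemma inv_apply_of_prod {φ : Aut} {α β : Equiv.Perm P1} (h : ∀ p, φ.1 p = (α p.1, β p.2)) (p : S) :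
    (φ⁻¹ : Aut).1 p = (α⁻¹ p.1, β⁻¹ p.2) := by
  rw [Aut.inv_apply_eq, h]; simp

lemma inv_apply_of_swap {φ : Aut} {α β : Equiv.Perm P1} (h : ∀ p, φ.1 p = (α p.2, β p.1)) (p : S) :
    (φ⁻¹ : Aut).1 p = (β⁻¹ p.2, α⁻¹ p.1) := by
  rw [Aut.inv_apply_eq, h]; simp

lemma IsMonomialAut.inv {φ : Aut} (hφ : IsMonomialAut φ) : IsMonomialAut φ⁻¹ := by
  obtain ⟨α, β, hα, hβ, h | h⟩ := hφ
  · exact ⟨_, _, hα.inv, hβ.inv, Or.inl (inv_apply_of_prod h)⟩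
  · exact ⟨_, _, hβ.inv, hα.inv, Or.inr (inv_apply_of_swap h)⟩

lemma IsMonomialAut.conj_mem {φ τ : Aut} (hφ : IsMonomialAut φ) (hτ : τ ∈ torus) :
    φ * τ * φ⁻¹ ∈ torus := by
  rw [mem_torus_iff] at hτ ⊢
  obtain ⟨γ, δ, hγ, hδ, hτ⟩ := hτ
  obtain ⟨α, β, hα, hβ, h | h⟩ := hφ
  · exact ⟨_, _, hα.conj hγ, hβ.conj hδ, fun p => by
      rw [Aut.mul_apply, Aut.mul_apply, inv_apply_of_prod h, hτ, h]; rfl⟩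
  · exact ⟨_, _, hα.conj hδ, hβ.conj hγ, fun p => by
      rw [Aut.mul_apply, Aut.mul_apply, inv_apply_of_swap h, hτ, h]; rfl⟩

lemma IsMonomialAut.mem_normalizer {φ : Aut} (hφ : IsMonomialAut φ) :
    φ ∈ Subgroup.normalizer (torus : Set Aut) := by
  rw [Subgroup.mem_normalizer_iff]
  refine fun τ => ⟨hφ.conj_mem, fun h => ?_⟩
  have := hφ.inv.conj_mem h
  simpa [mul_assoc] using this

/-- Scaling by 2 is a test element whose only fixed points are ∞ and 0. If its conjugate is
diagonal, α preserves {∞, 0}, and a map with trivial cube cannot exchange two points. -/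
lemma isDiagonal_of_conj_scale {α : Equiv.Perm P1} (hα : α ∈ PGL) (h3 : α * α * α = 1)
    (h : IsDiagonal (α * MulAction.toPermHom (GL (Fin 2) ℂ) P1 (scale (Units.mk0 2 two_ne_zero)) *
      α⁻¹)) : IsDiagonal α := by
  set σ := MulAction.toPermHom (GL (Fin 2) ℂ) P1 (scale (Units.mk0 2 two_ne_zero)) with hσ
  have hfix : ∀ p, σ p = p → p = ptInf ∨ p = pt 0 := by
    intro p hp
    rcases eq_ptInf_or_pt p with rfl | ⟨x, rfl⟩
    · exact Or.inl rfl
    · right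
      have h1 : σ (pt x) = pt (x / 2) := scale_smul_pt _ x
      rw [h1] at hp
      have h2 := pt_injective hp
      congr 1
      linear_combination -2 * h2
  have hinv : ∀ q, (α * σ * α⁻¹) q = q → σ (α⁻¹ q) = α⁻¹ q := by
    intro q hq
    rw [Equiv.Perm.eq_inv_iff_eq]
    exact hq
  have h1 := hfix _ (hinv _ h.2.1)
  have h2 := hfix _ (hinv _ h.2.2)
  simp only [Equiv.Perm.inv_eq_iff_eq] at h1 h2
  have h4 := congrArg (fun f => f ptInf) h3
  simp only [Equiv.Perm.mul_apply, Equiv.Perm.one_apply] at h4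
  rcases h1 with h1 | h1 <;> rcases h2 with h2 | h2
  · exact absurd (h1.trans h2.symm) (ptInf_ne_pt 0)
  · exact ⟨hα, h1.symm, h2.symm⟩
  · rw [← h2, ← h1, ← h2] at h4
    exact absurd h4.symm (ptInf_ne_pt 0)
  · exact absurd (h1.trans h2.symm) (ptInf_ne_pt 0)

/-- Elements of order three of the normalizer of the torus are in the torus. -/
lemma mem_torus_of_cube_eq_one {φ : Aut} (hφ : φ ∈ Subgroup.normalizer (torus : Set Aut))
    (h3 : φ * φ * φ = 1) : φ ∈ torus := by
  have hcube : ∀ p, φ.1 (φ.1 (φ.1 p)) = p := fun p =>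
    congrArg (fun ψ : Aut => ψ.1 p) h3
  rcases Aut.exists_PGL φ with ⟨α, hα, β, hβ, h⟩ | ⟨α, hα, β, hβ, h⟩
  · have hσ := isDiagonal_scale (Units.mk0 2 two_ne_zero)
    let τ : Aut := prodAut hσ.1 hσ.1
    have hτ : τ ∈ torus := mem_torus_iff.2 ⟨_, _, hσ, hσ, fun p => rfl⟩
    have h1 := (Subgroup.mem_normalizer_iff.1 hφ τ).1 hτ
    obtain ⟨γ, δ, hγ, hδ, hγδ⟩ := mem_torus_iff.1 h1
    have h2 : ∀ p, (φ * τ * φ⁻¹).1 p =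
        ((α * MulAction.toPermHom (GL (Fin 2) ℂ) P1 (scale (Units.mk0 2 two_ne_zero)) * α⁻¹) p.1,
          (β * MulAction.toPermHom (GL (Fin 2) ℂ) P1 (scale (Units.mk0 2 two_ne_zero)) * β⁻¹) p.2) :=
      fun p => by
        rw [Aut.mul_apply, Aut.mul_apply, inv_apply_of_prod h, h]; rfl
    have h4 : ∀ p : S, _ := fun p => (h2 p).symm.trans (hγδ p)
    have hα3 : α * α * α = 1 := by
      ext x
      have := hcube (x, x)
      rw [h, h, h] at this
      exact congrArg Prod.fst this
    have hβ3 : β * β * β = 1 := by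
      ext x
      have := hcube (x, x)
      rw [h, h, h] at this
      exact congrArg Prod.snd this
    refine mem_torus_iff.2 ⟨α, β, isDiagonal_of_conj_scale hα hα3 ?_,
      isDiagonal_of_conj_scale hβ hβ3 ?_, h⟩
    · rw [show _ * _ * _ = γ from Equiv.ext fun x => congrArg Prod.fst (h4 (x, x))]
      exact hγ
    · rw [show _ * _ * _ = δ from Equiv.ext fun x => congrArg Prod.snd (h4 (x, x))]
      exact hδ
  · exfalso
    -- The cube of a map exchanging the factors has a first component depending only on the second
    -- coordinate, so it is not the identity.
    have h1 := hcube (ptInf, ptInf)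
    have h2 := hcube (ptInf, pt 0)
    rw [h, h, h] at h1 h2
    have h4 : α (β (α ptInf)) = α (β (α (pt 0))) :=
      (congrArg Prod.fst h1).trans (congrArg Prod.fst h2).symm
    exact ptInf_ne_pt 0 (by simpa using h4)

lemma torus_commute {φ ψ : Aut} (hφ : φ ∈ torus) (hψ : ψ ∈ torus) : φ * ψ = ψ * φ := by
  obtain ⟨a, b, h⟩ := hφ
  obtain ⟨c, d, h'⟩ := hψ
  refine Subtype.ext (Equiv.ext fun p => ?_)
  change φ.1 (ψ.1 p) = ψ.1 (φ.1 p)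
  rw [h, h', h, h', ← mul_smul, ← mul_smul, ← mul_smul, ← mul_smul, ← scale_mul, ← scale_mul,
    ← scale_mul, ← scale_mul, mul_comm c, mul_comm d]

/-- The obstruction to embedding 𝔄₄ in the normalizer: both elements would land in the commutative
torus. -/
lemma exists_noncommuting_three_cycles : ∃ x y : alternatingGroup (Fin 4),
    x * x * x = 1 ∧ y * y * y = 1 ∧ x * y ≠ y * x :=
  ⟨⟨Equiv.swap 0 1 * Equiv.swap 1 2, Equiv.Perm.mem_alternatingGroup.2 (by decide)⟩,
    ⟨Equiv.swap 0 1 * Equiv.swap 1 3, Equiv.Perm.mem_alternatingGroup.2 (by decide)⟩,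
    by decide, by decide, by decide⟩

/-- A toric group has no subgroup isomorphic to `𝔄₄`. -/
theorem IsToric.not_exists_alternating {G : Subgroup Aut} (hG : IsToric G) :
    ¬ ∃ K : Subgroup G, Nonempty (K ≃* alternatingGroup (Fin 4)) := by
  rintro ⟨K, ⟨e⟩⟩
  obtain ⟨c, hc⟩ := hG
  let f : alternatingGroup (Fin 4) →* Aut := (MulAut.conj c).toMonoidHom.comp
    (G.subtype.comp (K.subtype.comp e.symm.toMonoidHom))
  have hf : Function.Injective f := (MulAut.conj c).injective.comp
    (G.subtype_injective.comp (K.subtype_injective.comp e.symm.injective))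
  have hmem : ∀ x, x * x * x = 1 → f x ∈ torus := fun x hx =>
    mem_torus_of_cube_eq_one (hc ⟨_, (e.symm x).1.2, rfl⟩) (by
      rw [← map_mul, ← map_mul, hx, map_one])
  obtain ⟨x, y, hx, hy, hxy⟩ := exists_noncommuting_three_cycles
  exact hxy (hf (by rw [map_mul, map_mul, torus_commute (hmem x hx) (hmem y hy)]))

end P1xP1


namespace P1xP1

/-! ### The subgroup preserving the factors -/

/-- Pairs of permutations acting on the product. -/
noncomputable def prodPerm : Equiv.Perm P1 × Equiv.Perm P1 →* Equiv.Perm S where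
  toFun x := Equiv.prodCongr x.1 x.2
  map_one' := rfl
  map_mul' _ _ := rfl

lemma prodPerm_injective : Function.Injective prodPerm := by
  intro x y h
  have h1 : ∀ p : S, (x.1 p.1, x.2 p.2) = (y.1 p.1, y.2 p.2) := fun p => congrArg (fun e => e p) h
  exact Prod.ext (Equiv.ext fun p => congrArg Prod.fst (h1 (p, p)))
    (Equiv.ext fun p => congrArg Prod.snd (h1 (p, p)))

/-- The elements of `G` preserving the two factors, as pairs of permutations. -/
noncomputable def factorSubgroup (G : Subgroup Aut) : Subgroup (Equiv.Perm P1 × Equiv.Perm P1) :=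
  (G.map Aut.subtype).comap prodPerm

lemma mem_factorSubgroup_iff {G : Subgroup Aut} {α β : Equiv.Perm P1} :
    (α, β) ∈ factorSubgroup G ↔ ∃ φ ∈ G, ∀ p, φ.1 p = (α p.1, β p.2) := by
  constructor
  · rintro ⟨φ, hφ, h⟩
    exact ⟨φ, hφ, fun p => congrArg (fun e => e p) h⟩
  · rintro ⟨φ, hφ, h⟩
    exact ⟨φ, hφ, Equiv.ext h⟩

instance (G : Subgroup Aut) [Finite G] : Finite (factorSubgroup G) := by
  have : Finite (G.map Aut.subtype) := Finite.of_surjective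
    (fun x : G => (⟨_, x, x.2, rfl⟩ : G.map Aut.subtype)) (by
      rintro ⟨_, x, hx, rfl⟩; exact ⟨⟨x, hx⟩, rfl⟩)
  exact Finite.of_injective (fun x : factorSubgroup G => (⟨_, x.2⟩ : G.map Aut.subtype))
    fun x y h => Subtype.ext (prodPerm_injective (congrArg Subtype.val h))

lemma mem_PGL_of_prod {φ : Aut} {α β : Equiv.Perm P1} (h : ∀ p, φ.1 p = (α p.1, β p.2)) :
    α ∈ PGL ∧ β ∈ PGL := by
  rcases Aut.exists_PGL φ with ⟨γ, hγ, δ, hδ, h'⟩ | ⟨γ, hγ, δ, hδ, h'⟩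
  · have h1 : ∀ p : S, _ := fun p => (h p).symm.trans (h' p)
    rw [show α = γ from Equiv.ext fun x => congrArg Prod.fst (h1 (x, x)),
      show β = δ from Equiv.ext fun x => congrArg Prod.snd (h1 (x, x))]
    exact ⟨hγ, hδ⟩
  · exfalso
    have h1 := congrArg Prod.fst ((h (ptInf, ptInf)).symm.trans (h' (ptInf, ptInf)))
    have h2 := congrArg Prod.fst ((h (ptInf, pt 0)).symm.trans (h' (ptInf, pt 0)))
    exact ptInf_ne_pt 0 (γ.injective (h1.symm.trans h2))

lemma map_fst_le_PGL (G : Subgroup Aut) : projFst (factorSubgroup G) ≤ PGL := by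
  rintro _ ⟨⟨α, β⟩, h, rfl⟩
  obtain ⟨φ, -, h⟩ := mem_factorSubgroup_iff.1 h
  exact (mem_PGL_of_prod h).1

lemma map_snd_le_PGL (G : Subgroup Aut) : projSnd (factorSubgroup G) ≤ PGL := by
  rintro _ ⟨⟨α, β⟩, h, rfl⟩
  obtain ⟨φ, -, h⟩ := mem_factorSubgroup_iff.1 h
  exact (mem_PGL_of_prod h).2

/-- The first projection of the factor subgroup is conjugate to the second one if there is an
element exchanging the factors. -/
lemma conj_mem_map_snd {G : Subgroup Aut} {σ : Aut} (hσ : σ ∈ G) {A B : Equiv.Perm P1}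
    (hAB : ∀ p, σ.1 p = (A p.2, B p.1)) {α : Equiv.Perm P1}
    (hα : α ∈ projFst (factorSubgroup G)) :
    A⁻¹ * α * A ∈ projSnd (factorSubgroup G) := by
  obtain ⟨⟨α, β⟩, h, rfl⟩ := hα
  obtain ⟨φ, hφ, h⟩ := mem_factorSubgroup_iff.1 h
  refine ⟨(B⁻¹ * β * B, A⁻¹ * α * A), mem_factorSubgroup_iff.2 ⟨σ⁻¹ * φ * σ,
    mul_mem (mul_mem (inv_mem hσ) hφ) hσ, fun p => ?_⟩, rfl⟩
  rw [Aut.mul_apply, Aut.mul_apply, hAB, h, inv_apply_of_swap hAB]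
  rfl

/-- If the projections of the factor subgroup are dihedral, the group is toric. -/
lemma isToric_of_invariant_pair {G : Subgroup Aut} {σ : Aut} (hσ : σ ∈ G) {A B : Equiv.Perm P1}
    (hA : A ∈ PGL) (hAB : ∀ p, σ.1 p = (A p.2, B p.1)) {a b : P1} (hab : a ≠ b)
    (hinv : ∀ α ∈ projFst (factorSubgroup G),
      (α a = a ∧ α b = b) ∨ (α a = b ∧ α b = a)) : IsToric G := by
  obtain ⟨C, hC, hCa, hCb⟩ := PGL.exists_move hab
  have hmono : ∀ α ∈ projFst (factorSubgroup G), IsMonomial (C * α * C⁻¹) := by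
    intro α hα
    refine ⟨PGL.conj_mem (map_fst_le_PGL G hα) hC, (hinv α hα).imp (fun h => ?_) fun h => ?_⟩
    · exact ⟨PGL.conj_apply_of_eq hCa hCa h.1, PGL.conj_apply_of_eq hCb hCb h.2⟩
    · exact ⟨PGL.conj_apply_of_eq hCa hCb h.1, PGL.conj_apply_of_eq hCb hCa h.2⟩
  have hmem : ∀ (φ : Aut) (α β : Equiv.Perm P1), φ ∈ G → (∀ p, φ.1 p = (α p.1, β p.2)) →
      α ∈ projFst (factorSubgroup G) := fun φ α β hφ h =>
    ⟨(α, β), mem_factorSubgroup_iff.2 ⟨φ, hφ, h⟩, rfl⟩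
  -- The conjugating element is (C, C A): A identifies the second factor with the first, then C
  -- moves the invariant pair to {∞, 0}.
  have hc : ∀ p, (prodAut hC (mul_mem hC hA)).1 p = (C p.1, (C * A) p.2) := fun p => rfl
  refine ⟨prodAut hC (mul_mem hC hA), ?_⟩
  set c := prodAut hC (mul_mem hC hA)
  rintro _ ⟨φ, hφ, rfl⟩
  apply IsMonomialAut.mem_normalizer
  change IsMonomialAut (c * φ * c⁻¹)
  rcases Aut.exists_PGL φ with ⟨α, -, β, -, h⟩ | ⟨α, -, β, -, h⟩
  -- A β A⁻¹ is the first component of σ φ σ⁻¹, so the second factor needs no separate hypothesis.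
  · refine ⟨_, _, hmono α (hmem φ α β hφ h), hmono (A * β * A⁻¹)
      (hmem (σ * φ * σ⁻¹) _ (B * α * B⁻¹) (mul_mem (mul_mem hσ hφ) (inv_mem hσ)) fun p => ?_),
      Or.inl fun p => ?_⟩
    · rw [Aut.mul_apply, Aut.mul_apply, inv_apply_of_swap hAB, h, hAB]; rfl
    · rw [Aut.mul_apply, Aut.mul_apply, inv_apply_of_prod hc, h, hc]
      simp
  -- When φ exchanges the factors, φ σ⁻¹ and σ φ preserve them; their first components are α A⁻¹ and
  -- A β.
  · refine ⟨_, _, hmono (α * A⁻¹) (hmem (φ * σ⁻¹) _ (β * B⁻¹) (mul_mem hφ (inv_mem hσ))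
      fun p => ?_), hmono (A * β) (hmem (σ * φ) _ (B * α) (mul_mem hσ hφ) fun p => ?_),
      Or.inr fun p => ?_⟩
    · rw [Aut.mul_apply, inv_apply_of_swap hAB, h]; rfl
    · rw [Aut.mul_apply, h, hAB]; rfl
    · rw [Aut.mul_apply, Aut.mul_apply, inv_apply_of_prod hc, h, hc]
      simp

/-- A finite group with an element exchanging the factors, which has no subgroup isomorphic to
`𝔄₄`, is toric. -/
theorem isToric_of_not_exists_alternating {G : Subgroup Aut} [Finite G] {σ : Aut} (hσ : σ ∈ G)
    {A B : Equiv.Perm P1} (hA : A ∈ PGL) (hAB : ∀ p, σ.1 p = (A p.2, B p.1))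
    (hG : ¬ ∃ K : Subgroup G, Nonempty (K ≃* alternatingGroup (Fin 4))) : IsToric G := by
  by_contra htor
  let m₁ := MoebiusAction.ofSubgroup _ (map_fst_le_PGL G)
  let m₂ := MoebiusAction.ofSubgroup _ (map_snd_le_PGL G)
  have h₁ : ¬ m₁.IsDihedral := by
    rintro ⟨a, b, hab, h⟩
    exact htor (isToric_of_invariant_pair hσ hA hAB hab fun α hα => h ⟨α, hα⟩)
  have h₂ : ¬ m₂.IsDihedral := by
    rintro ⟨a, b, hab, h⟩
    -- A carries a pair invariant under the second projection to one invariant under the first.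
    refine h₁ ⟨A a, A b, fun h' => hab (A.injective h'), fun α => ?_⟩
    have h' := h ⟨_, conj_mem_map_snd hσ hAB α.2⟩
    have key : ∀ x y, (A⁻¹ * α.1 * A) x = y ↔ m₁.ρ α (A x) = A y := fun x y => by
      rw [Equiv.Perm.mul_apply, Equiv.Perm.mul_apply, Equiv.Perm.inv_eq_iff_eq]; rfl
    rw [← key, ← key, ← key, ← key]
    exact h'
  obtain ⟨t, ht, v, hv, h⟩ := MoebiusAction.exists_tetrahedralPair_prod (factorSubgroup G) m₁ m₂ h₁ h₂
  obtain ⟨φ, hφ, hφt⟩ := ht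
  obtain ⟨ψ, hψ, hψv⟩ := hv
  have h' := h.map prodPerm fun h' => h.ne (prodPerm_injective (h'.trans (map_one _).symm))
  rw [← hφt, ← hψv] at h'
  exact hG (IsTetrahedralPair.of_map (t := (⟨φ, hφ⟩ : G)) (v := (⟨ψ, hψ⟩ : G))
    (f := Aut.subtype.comp G.subtype) (Aut.subtype_injective.comp G.subtype_injective)
    h').exists_subgroup

end P1xP1

/-! ### The main theorem -/

theorem mainTheorem8 (G : Subgroup P1xP1.Aut) [Finite G] (hG : P1xP1.rho G = 1) :
    P1xP1.IsToric G ↔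
      ¬ ∃ K : Subgroup G, Nonempty (K ≃* alternatingGroup (Fin 4)) := by
  refine ⟨P1xP1.IsToric.not_exists_alternating, fun h => ?_⟩
  obtain ⟨σ, hσ, A, hA, B, -, hAB⟩ := P1xP1.exists_swap_of_rho_eq_one hG
  exact P1xP1.isToric_of_not_exists_alternating hσ hA hAB h
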